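/- Let $p$ be a prime and $n\ge 0$. **Notation.** Let $R$ be a ring (associative, unital) and $M$ an $R$-bimodule. For $k\ge 1$ let $M^{\otimes_R k}$ be the $k$-fold tensor power, let $M^{\circledcirc_R k}=M^{\otimes_R k}/[R,M^{\otimes_R k}]$ be the cyclic tensor power, where $[R,M^{\otimes_R k}]$ is the subgroup generated by all $rx-xr$, and let the cyclic group $C_k$ act on $M^{\circledcirc_R k}$ by cyclically permuting the tensor factors. The ghost map $w$ on $\prod_{i<m}M^{\otimes_R p^i}$ has components $$w_j(m_0,\dots,m_{m-1})=\sum_{i=0}^{j}\mathrm{tr}_{C_{p^{j-i}}}^{C_{p^j}}\big(m_i^{\otimes p^{j-i}}\big)\in M^{\circledcirc_R p^j},\qquad 0\le j<m .$$ Choose a free resolution of $(R;M)$, i.e. a reflexive coequaliser $f,g\colon(\overline S;\overline Q)\rightrightarrows(S;Q)\xrightarrow{\ \epsilon\ }(R;M)$ in the category of pairs (ring; bimodule), where $\overline S$, $S$ are free rings and $\overline Q$, $Q$ are free bimodules over them. The set $W_{m,p}(R;M)$ is the quotient of $\prod_{i<m}M^{\otimes_R p^i}$ by the equivalence relation generated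 by $\epsilon_*q\sim\epsilon_*u$ whenever there is $z\in\prod_{i<m}\overline Q^{\otimes_{\overline S}p^i}$ with $w(q)=w(f_*z)$ and $w(u)=w(g_*z)$. It is an abelian group, in which $[\epsilon_*q]+[\epsilon_*u]=[\epsilon_*v]$ whenever $w(v)=w(q)+w(u)$ (and such a $v$ exists for all $q,u$). The iterated Verschiebung is the homomorphism $$V^i\colon (M^{\circledcirc_R p^i})_{C_{p^i}}\to W_{i+1,p}(R;M)$$ induced by $x\mapsto[(0,\dots,0,x)]$. For $x\in M^{\otimes_R p^i}$ with $i\le n$, write $V^i\tau(x)\in W_{n+1,p}(R;M)$ for the class of the sequence with $x$ in position $i$ and $0$ elsewhere. **Proposition.** 1. For every ring $R$ and $R$-bimodule $M$, and for any choice of set-theoretic sections $s_i$ of the quotient maps $M^{\otimes_R p^i}\to (M^{\circledcirc_R p^i})_{C_{p^i}}/\ker V^i$, $0\le i\le n$, the map $$\prod_{i=0}^{n}(M^{\circledcirc_R p^i})_{C_{p^i}}/\ker V^i\longrightarrow W_{n+1,p}(R;M),\qquad (c_i)_i\longmapsto[(s_0(c_0),\dots,s_n(c_n))]$$ is a bijection.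 2. Let $M=R$, and suppose that $R/[R,R]$ has no $p$-power torsion, where $[R,R]$ is the subgroup generated by the commutators. Then for any section $s$ of $R\to R/[R,R]$, the map $\prod_{i=0}^{n}R/[R,R]\to W_{n+1,p}(R;R)$, $(c_i)_i\mapsto[(s(c_0),\dots,s(c_n))]$, is a bijection, where $R$ is identified with $R^{\otimes_R p^i}$ by $r\mapsto r\otimes1\otimes\dots\otimes1$. 3. Let $R$ be a commutative ring without $p$-power torsion and $M$ a free $R$-module, regarded as a bimodule with equal left and right actions (so that $M^{\circledcirc_R k}=M^{\otimes_R k}$). For any choice of sections $s_i$ of $M^{\otimes_R p^i}\to(M^{\otimes_R p^i})_{C_{p^i}}$, the map $$\prod_{i=0}^{n}(M^{\otimes_R p^i})_{C_{p^i}}\to W_{n+1,p}(R;M),\qquad (c_i)_i\mapsto[(s_0(c_0),\dots,s_n(c_n))]$$ is a bijection. Moreover, every $R$-basis $(b_x)_{x\in X}$ of $M$ determines, with no further choices, a bijection $$\Phi\colon\prod_{i=0}^{n}(M^{\otimes_R p^i})_{C_{p^i}}\xrightarrow{\ \cong\ } W_{n+1,p}(R;M),\qquad \Phi\Big(\big(\textstyle\sum_{x}a_{i,x}\,[b_{x_1}\otimes\dots\otimes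 b_{x_{p^i}}]\big)_{i}\Big)=\sum_{i=0}^{n}\sum_{x}V^i\tau\big(a_{i,x}\,b_{x_1}\otimes\dots\otimes b_{x_{p^i}}\big).$$ Here, for each $i$, $x$ runs over finitely many elements of $X^{p^i}$ in pairwise distinct $C_{p^i}$-orbits, with nonzero coefficients $a_{i,x}\in R$. -/

import Mathlib

universe u v w u₁ v₁ u₂ v₂

open scoped TensorProduct

noncomputable section

namespace WittCoeff

/-! ## Tensor powers and cyclic tensor powers of a bimodule

An `R`-bimodule is an abelian group `M` with commuting left and right actions of `R`; the right
action is an action of `Rᵐᵒᵖ`, so `MulOpposite.op r • m` is the element `m r`. -/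

section Tensor

variable (R : Type u) (M : Type v) [Ring R] [AddCommGroup M] [Module R M] [Module Rᵐᵒᵖ M]

/-- The subgroup of `M ⊗_ℤ ⋯ ⊗_ℤ M` (with `k` factors) generated by
`⋯ ⊗ mᵢ r ⊗ mᵢ₊₁ ⊗ ⋯ - ⋯ ⊗ mᵢ ⊗ r mᵢ₊₁ ⊗ ⋯`. -/
def balRel (k : ℕ) : AddSubgroup (⨂[ℤ]^k M) :=
  AddSubgroup.closure {x | ∃ (m : Fin k → M) (i j : Fin k) (r : R), (i : ℕ) + 1 = j ∧
    x = PiTensorProduct.tprod ℤ (Function.update m i (MulOpposite.op r • m i)) -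
      PiTensorProduct.tprod ℤ (Function.update m j (r • m j))}

/-- The subgroup of `M ⊗_ℤ ⋯ ⊗_ℤ M` (with `k` factors) generated by the relations of `balRel`
together with `m₁ ⊗ ⋯ ⊗ m_k r - r m₁ ⊗ ⋯ ⊗ m_k` (the case where `i` is the last index). -/
def cycRel (k : ℕ) : AddSubgroup (⨂[ℤ]^k M) :=
  AddSubgroup.closure {x | ∃ (m : Fin k → M) (i j : Fin k) (r : R), finRotate k i = j ∧
    x = PiTensorProduct.tprod ℤ (Function.update m i (MulOpposite.op r • m i)) -
      PiTensorProduct.tprod ℤ (Function.update m j (r • m j))}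

/-- The tensor power `M ⊗_R ⋯ ⊗_R M` with `k ≥ 1` factors, as an abelian group. -/
abbrev Tens (k : ℕ) : Type v := (⨂[ℤ]^k M) ⧸ balRel R M k

/-- The cyclic tensor power with `k ≥ 1` factors: the quotient of `M ⊗_R ⋯ ⊗_R M` by the
subgroup generated by the elements `r x - x r`. -/
abbrev Cyc (k : ℕ) : Type v := (⨂[ℤ]^k M) ⧸ cycRel R M k

variable {M}

/-- The elementary tensor `m₁ ⊗ ⋯ ⊗ m_k`. -/
def elem {k : ℕ} (m : Fin k → M) : Tens R M k :=
  QuotientAddGroup.mk' (balRel R M k) (PiTensorProduct.tprod ℤ m)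

variable (M) {R}

theorem finRotate_of_succ {k : ℕ} {i j : Fin k} (h : (i : ℕ) + 1 = j) : finRotate k i = j := by
  cases k with
  | zero => exact i.elim0
  | succ k =>
    have hi : (i : ℕ) < k := by omega
    rw [show i = ⟨(i : ℕ), hi.trans k.lt_succ_self⟩ from rfl, finRotate_of_lt hi]
    exact Fin.ext h

variable (R)

theorem balRel_le_cycRel (k : ℕ) : balRel R M k ≤ cycRel R M k := by
  apply AddSubgroup.closure_mono
  rintro x ⟨m, i, j, r, h, rfl⟩
  exact ⟨m, i, j, r, finRotate_of_succ h, rfl⟩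

/-- The projection from the tensor power to the cyclic tensor power. -/
def Tens.toCyc (k : ℕ) : Tens R M k →+ Cyc R M k :=
  QuotientAddGroup.map _ _ (AddMonoidHom.id _) (balRel_le_cycRel R M k)

/-- The cyclic permutation of the factors of `M ⊗_ℤ ⋯ ⊗_ℤ M`. -/
def rotZ (k : ℕ) : (⨂[ℤ]^k M) →+ (⨂[ℤ]^k M) :=
  (PiTensorProduct.reindex ℤ (fun _ => M) (finRotate k)).toLinearMap.toAddMonoidHom

theorem rotZ_tprod {k : ℕ} (m : Fin k → M) :
    rotZ M k (PiTensorProduct.tprod ℤ m) =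
      PiTensorProduct.tprod ℤ (fun l => m ((finRotate k).symm l)) :=
  PiTensorProduct.reindex_tprod (finRotate k) m

theorem cycRel_le_comap_rotZ (k : ℕ) : cycRel R M k ≤ (cycRel R M k).comap (rotZ M k) := by
  refine (AddSubgroup.closure_le _).2 ?_
  rintro x ⟨m, i, j, r, h, rfl⟩
  refine AddSubgroup.subset_closure
    ⟨fun l => m ((finRotate k).symm l), finRotate k i, finRotate k j, r, by rw [h], ?_⟩
  have key : ∀ (a : Fin k) (y : M),
      (fun l => Function.update m a y ((finRotate k).symm l)) =
        Function.update (fun l => m ((finRotate k).symm l)) (finRotate k a) y := by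
    intro a y
    funext l
    by_cases hl : l = finRotate k a
    · subst hl
      rw [Equiv.symm_apply_apply, Function.update_self, Function.update_self]
    · have : (finRotate k).symm l ≠ a :=
        fun h' => hl (by rw [← h', Equiv.apply_symm_apply])
      rw [Function.update_of_ne hl, Function.update_of_ne this]
  rw [map_sub, rotZ_tprod, rotZ_tprod, key, key]
  simp only [Equiv.symm_apply_apply]

/-- The action of the generator of the cyclic group of order `k` on the cyclic tensor power with
`k` factors, by cyclic permutation of the factors. -/
def Cyc.rot (k : ℕ) : Cyc R M k →+ Cyc R M k :=
  QuotientAddGroup.map _ _ (rotZ M k) (cycRel_le_comap_rotZ R M k)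

/-- The coinvariants of the cyclic group of order `k` acting on the cyclic tensor power. -/
abbrev Coinv (k : ℕ) : Type v := Cyc R M k ⧸ (Cyc.rot R M k - AddMonoidHom.id _).range

/-- The projection from the tensor power to the coinvariants of the cyclic tensor power. -/
def Tens.toCoinv (k : ℕ) : Tens R M k →+ Coinv R M k :=
  (QuotientAddGroup.mk' _).comp (Tens.toCyc R M k)

end Tensor

/-! ## Tensor powers of elements -/

section Power

variable (R : Type u) {M : Type v} [Ring R] [AddCommGroup M] [Module R M] [Module Rᵐᵒᵖ M]

open GradedMonoid

/-- The product `x ⊗ y` of elements of tensor powers over `ℤ`. -/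
def tmulZ {k l : ℕ} (x : ⨂[ℤ]^k M) (y : ⨂[ℤ]^l M) : ⨂[ℤ]^(k + l) M :=
  GMul.mul (A := fun i => ⨂[ℤ]^i M) x y

/-- The power `x ⊗ ⋯ ⊗ x` with `N` factors of an element `x` of the `k`-fold tensor power over
`ℤ`; it lies in the tensor power with `l = N k` factors. -/
def powZ {k l : ℕ} (N : ℕ) (h : N * k = l) (x : ⨂[ℤ]^k M) : ⨂[ℤ]^l M :=
  TensorPower.cast ℤ M (show N • k = l from h) (GMonoid.gnpow (A := fun i => ⨂[ℤ]^i M) N x)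

theorem tmulZ_eq {k l : ℕ} (x : ⨂[ℤ]^k M) (y : ⨂[ℤ]^l M) :
    tmulZ x y = ((TensorProduct.mk ℤ _ _).compr₂
      ↑(TensorPower.mulEquiv : _ ≃ₗ[ℤ] (⨂[ℤ]^(k + l)) M) :
      ⨂[ℤ]^k M →ₗ[ℤ] (⨂[ℤ]^l) M →ₗ[ℤ] (⨂[ℤ]^(k + l)) M) x y := rfl

theorem tmulZ_tprod {k l : ℕ} (a : Fin k → M) (b : Fin l → M) :
    tmulZ (PiTensorProduct.tprod ℤ a) (PiTensorProduct.tprod ℤ b) =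
      PiTensorProduct.tprod ℤ (Fin.append a b) :=
  TensorPower.tprod_mul_tprod ℤ a b

theorem append_update_left' {M : Type v} {k l : ℕ} (a : Fin k → M) (b : Fin l → M) (i : Fin k) (y : M) :
    Fin.append (Function.update a i y) b =
      Function.update (Fin.append a b) (Fin.castAdd l i) y := by
  funext t
  refine Fin.addCases (fun s => ?_) (fun s => ?_) t
  · by_cases hs : s = i
    · subst hs; simp
    · have : Fin.castAdd l s ≠ Fin.castAdd l i := fun h => hs (Fin.castAdd_injective _ _ h)
      simp [Function.update_of_ne hs, Function.update_of_ne this]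
  · have : Fin.natAdd k s ≠ Fin.castAdd l i := by
      intro h; have := congrArg Fin.val h; simp at this; omega
    simp [Function.update_of_ne this]

theorem append_update_right' {M : Type v} {k l : ℕ} (a : Fin k → M) (b : Fin l → M) (i : Fin l) (y : M) :
    Fin.append a (Function.update b i y) =
      Function.update (Fin.append a b) (Fin.natAdd k i) y := by
  funext t
  refine Fin.addCases (fun s => ?_) (fun s => ?_) t
  · have : Fin.castAdd l s ≠ Fin.natAdd k i := by
      intro h; have := congrArg Fin.val h; simp at this; omega
    simp [Function.update_of_ne this]
  · by_cases hs : s = i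
    · subst hs; simp
    · have : Fin.natAdd k s ≠ Fin.natAdd k i := fun h => hs (Fin.natAdd_injective _ _ h)
      simp [Function.update_of_ne hs, Function.update_of_ne this]

theorem mul_mem_balRel_left {k l : ℕ} {x : ⨂[ℤ]^k M} (hx : x ∈ balRel R M k) (y : ⨂[ℤ]^l M) :
    tmulZ x y ∈ balRel R M (k + l) := by
  induction y using PiTensorProduct.induction_on with
  | smul_tprod c b =>
    have h1 : tmulZ x (c • PiTensorProduct.tprod ℤ b)
        = c • tmulZ x (PiTensorProduct.tprod ℤ b) := by
      simp only [tmulZ_eq, map_smul]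
    rw [h1]
    clear h1
    refine AddSubgroup.zsmul_mem _ ?_ c
    induction hx using AddSubgroup.closure_induction with
    | mem x hx =>
      obtain ⟨m, i, j, r, h, rfl⟩ := hx
      refine AddSubgroup.subset_closure
        ⟨Fin.append m b, Fin.castAdd l i, Fin.castAdd l j, r, by simpa using h, ?_⟩
      rw [tmulZ_eq, map_sub, LinearMap.sub_apply,
        ← tmulZ_eq, ← tmulZ_eq,
        tmulZ_tprod, tmulZ_tprod, append_update_left',
        append_update_left']
      simp
    | zero =>
      rw [tmulZ_eq, map_zero]; exact zero_mem _
    | add x y _ _ h1 h2 =>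
      rw [tmulZ_eq, map_add]; exact add_mem h1 h2
    | neg x _ h1 =>
      rw [tmulZ_eq, map_neg]; exact neg_mem h1
  | add y z hy hz =>
    rw [tmulZ_eq, map_add]; exact add_mem hy hz

theorem mul_mem_balRel_right {k l : ℕ} (x : ⨂[ℤ]^k M) {y : ⨂[ℤ]^l M} (hy : y ∈ balRel R M l) :
    tmulZ x y ∈ balRel R M (k + l) := by
  induction x using PiTensorProduct.induction_on with
  | smul_tprod c a =>
    have h1 : tmulZ (c • PiTensorProduct.tprod ℤ a) y
        = c • tmulZ (PiTensorProduct.tprod ℤ a) y := by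
      simp only [tmulZ_eq, map_smul, LinearMap.smul_apply]
    rw [h1]
    clear h1
    refine AddSubgroup.zsmul_mem _ ?_ c
    induction hy using AddSubgroup.closure_induction with
    | mem x hx =>
      obtain ⟨m, i, j, r, h, rfl⟩ := hx
      refine AddSubgroup.subset_closure
        ⟨Fin.append a m, Fin.natAdd k i, Fin.natAdd k j, r, by simp; omega, ?_⟩
      rw [tmulZ_eq, map_sub,
        ← tmulZ_eq, ← tmulZ_eq,
        tmulZ_tprod, tmulZ_tprod, append_update_right',
        append_update_right']
      simp
    | zero =>
      rw [tmulZ_eq, map_zero]; exact zero_mem _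
    | add x y _ _ h1 h2 =>
      rw [tmulZ_eq, map_add]; exact add_mem h1 h2
    | neg x _ h1 =>
      rw [tmulZ_eq, map_neg]; exact neg_mem h1
  | add y z hy hz =>
    rw [tmulZ_eq, map_add]; exact add_mem hy hz

theorem gnpow_sub_mem {k : ℕ} {x y : ⨂[ℤ]^k M} (h : x - y ∈ balRel R M k) (N : ℕ) :
    GMonoid.gnpow (A := fun i => ⨂[ℤ]^i M) N x - GMonoid.gnpow (A := fun i => ⨂[ℤ]^i M) N y ∈ balRel R M (N • k) := by
  have main : ∀ N : ℕ, ∃ (d : ℕ) (a b : ⨂[ℤ]^d M), a - b ∈ balRel R M d ∧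
      (GradedMonoid.mk (A := fun i => ⨂[ℤ]^i M) k x) ^ N = GradedMonoid.mk (A := fun i => ⨂[ℤ]^i M) d a ∧
      (GradedMonoid.mk (A := fun i => ⨂[ℤ]^i M) k y) ^ N = GradedMonoid.mk (A := fun i => ⨂[ℤ]^i M) d b := by
    intro N
    induction N with
    | zero =>
      exact ⟨0, GOne.one (A := fun i => ⨂[ℤ]^i M), GOne.one (A := fun i => ⨂[ℤ]^i M), by rw [sub_self]; exact zero_mem _, pow_zero _, pow_zero _⟩
    | succ N ih =>
      obtain ⟨d, a, b, hab, ha, hb⟩ := ih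
      refine ⟨d + k, tmulZ a x, tmulZ b y, ?_, ?_, ?_⟩
      · have e : tmulZ a x - tmulZ b y
            = tmulZ (a - b) x + tmulZ b (x - y) := by
          simp only [tmulZ_eq, map_sub, LinearMap.sub_apply]
          abel
        rw [e]
        exact add_mem (mul_mem_balRel_left R hab x) (mul_mem_balRel_right R b h)
      · rw [pow_succ, ha]; rfl
      · rw [pow_succ, hb]; rfl
  obtain ⟨d, a, b, hab, ha, hb⟩ := main N
  rw [GradedMonoid.mk_pow] at ha hb
  obtain ⟨rfl, ha⟩ := Sigma.mk.inj ha
  obtain ⟨_, hb⟩ := Sigma.mk.inj hb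
  rw [eq_of_heq ha, eq_of_heq hb]
  exact hab

theorem powZ_sub_mem {k l : ℕ} (N : ℕ) (h : N * k = l) {x y : ⨂[ℤ]^k M}
    (hxy : x - y ∈ balRel R M k) : powZ N h x - powZ N h y ∈ balRel R M l := by
  subst h
  have := gnpow_sub_mem R hxy N
  simpa [powZ] using this

/-- The power `x ⊗ ⋯ ⊗ x` with `N` factors of an element `x` of `M^{⊗_R k}`; it lies in
`M^{⊗_R l}` with `l = N k`. -/
def Tens.pow {k l : ℕ} (N : ℕ) (h : N * k = l) (x : Tens R M k) : Tens R M l :=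
  Quotient.liftOn' x (fun y => QuotientAddGroup.mk' (balRel R M l) (powZ N h y)) (by
    intro a b hab
    refine (QuotientAddGroup.eq).2 ?_
    have hab' : -a + b ∈ balRel R M k := QuotientAddGroup.leftRel_apply.1 hab
    have h2 : b - a ∈ balRel R M k := by rwa [sub_eq_neg_add]
    have := powZ_sub_mem R N h h2
    rwa [sub_eq_neg_add] at this)

end Power

/-! ## Ghost maps -/

section Ghost

variable (R : Type u) (M : Type v) [Ring R] [AddCommGroup M] [Module R M] [Module Rᵐᵒᵖ M]

/-- The product of the tensor powers `M^{⊗_R p^i}` for `0 ≤ i < n`. -/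
abbrev Tuple (p n : ℕ) : Type v := ∀ i : Fin n, Tens R M (p ^ (i : ℕ))

variable {R M}

theorem pow_sub_mul_pow' {p i j : ℕ} (h : i ≤ j) : p ^ (j - i) * p ^ i = p ^ j := by
  rw [← pow_add, Nat.sub_add_cancel h]

/-- The ghost map. Its `j`-th component is the sum over `i ≤ j` of the transfers from
`C_{p^{j-i}}` to `C_{p^j}` of the classes of `mᵢ^{⊗ p^{j-i}}` in the cyclic tensor power. The
powers `rot^t`, for `0 ≤ t < p^i`, represent the cosets of the subgroup `C_{p^{j-i}}` of the
cyclic group `C_{p^j}`, which is generated by `rot^{p^i}`. -/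
def ghost {p n : ℕ} (m : Tuple R M p n) (j : Fin n) : Cyc R M (p ^ (j : ℕ)) :=
  ∑ i : Fin n, if h : (i : ℕ) ≤ j then
    ∑ t ∈ Finset.range (p ^ (i : ℕ)), (Cyc.rot R M (p ^ (j : ℕ)))^[t]
      (Tens.toCyc R M _ (Tens.pow R (p ^ ((j : ℕ) - i)) (pow_sub_mul_pow' h) (m i)))
  else 0

end Ghost

/-! ## The category of bimodules and free resolutions -/

set_option linter.checkUnivs false in
/-- A pair `(R; M)` of a ring `R` and an `R`-bimodule `M`. -/
structure Bimod where
  R : Type u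
  M : Type v
  [ring : Ring R]
  [addCommGroup : AddCommGroup M]
  [left : Module R M]
  [right : Module Rᵐᵒᵖ M]
  [smulComm : SMulCommClass R Rᵐᵒᵖ M]

attribute [instance] Bimod.ring Bimod.addCommGroup Bimod.left Bimod.right Bimod.smulComm

/-- The tensor power `M^{⊗_R k}`, for `k ≥ 1`. -/
abbrev Bimod.tens (A : Bimod.{u, v}) (k : ℕ) : Type v := Tens A.R A.M k

/-- The coinvariants of the cyclic group of order `k` on the cyclic tensor power of `M` with `k ≥ 1`
factors. -/
abbrev Bimod.coinv (A : Bimod.{u, v}) (k : ℕ) : Type v := Coinv A.R A.M k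

/-- The projection from `M^{⊗_R k}` to the coinvariants of the cyclic tensor power. -/
def Bimod.proj (A : Bimod.{u, v}) (k : ℕ) : A.tens k →+ A.coinv k := Tens.toCoinv A.R A.M k

/-- The elementary tensor `r m₁ ⊗ m₂ ⊗ ⋯ ⊗ m_k`. -/
def smulElem (A : Bimod.{u, v}) {k : ℕ} (r : A.R) (m : Fin k → A.M) : A.tens k :=
  elem A.R fun l => if (l : ℕ) = 0 then r • m l else m l

/-- A morphism `(R; M) → (R'; M')`: a ring homomorphism and a compatible additive map. -/
structure Hom (A : Bimod.{u, v}) (B : Bimod.{u₁, v₁}) where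
  ringHom : A.R →+* B.R
  addHom : A.M →+ B.M
  map_left : ∀ (r : A.R) (m : A.M), addHom (r • m) = ringHom r • addHom m
  map_right : ∀ (r : A.R) (m : A.M),
    addHom (MulOpposite.op r • m) = MulOpposite.op (ringHom r) • addHom m

section Functoriality

variable {A : Bimod.{u, v}} {B : Bimod.{u₁, v₁}}

/-- The map `f ⊗ ⋯ ⊗ f` on the tensor powers over `ℤ`. -/
def mapZ (f : A.M →+ B.M) (k : ℕ) : (⨂[ℤ]^k A.M) →+ (⨂[ℤ]^k B.M) :=
  (PiTensorProduct.map (fun _ : Fin k => f.toIntLinearMap)).toAddMonoidHom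

theorem mapZ_tprod (f : A.M →+ B.M) {k : ℕ} (m : Fin k → A.M) :
    mapZ f k (PiTensorProduct.tprod ℤ m) = PiTensorProduct.tprod ℤ (fun l => f (m l)) :=
  PiTensorProduct.map_tprod _ _

theorem balRel_le_comap_mapZ (f : Hom A B) (k : ℕ) :
    balRel A.R A.M k ≤ (balRel B.R B.M k).comap (mapZ f.addHom k) := by
  refine (AddSubgroup.closure_le _).2 ?_
  rintro x ⟨m, i, j, r, h, rfl⟩
  refine AddSubgroup.subset_closure ⟨fun l => f.addHom (m l), i, j, f.ringHom r, h, ?_⟩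
  have key : ∀ (a : Fin k) (y : A.M), (fun l => f.addHom (Function.update m a y l)) =
      Function.update (fun l => f.addHom (m l)) a (f.addHom y) := by
    intro a y
    funext l
    exact Function.apply_update (fun _ z => f.addHom z) m a y l
  rw [map_sub, mapZ_tprod, mapZ_tprod, key, key, f.map_left, f.map_right]

/-- The map `f ⊗ ⋯ ⊗ f` from `M^{⊗_R k}` to `M'^{⊗_{R'} k}`. -/
def Tens.map (f : Hom A B) (k : ℕ) : Tens A.R A.M k →+ Tens B.R B.M k :=
  QuotientAddGroup.map _ _ (mapZ f.addHom k) (balRel_le_comap_mapZ f k)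

/-- The product of the maps `Tens.map f (p ^ i)`. -/
def Tuple.map (f : Hom A B) {p n : ℕ} (m : Tuple A.R A.M p n) : Tuple B.R B.M p n :=
  fun i => Tens.map f _ (m i)

end Functoriality

/-- `(R; M)` is free: `R` is the free (associative unital) ring on a set and `M` is a free
`R`-bimodule, that is, a free module over the enveloping ring `R ⊗ Rᵐᵒᵖ`. -/
def IsFree (A : Bimod.{u, v}) : Prop :=
  (∃ X : Type u, Nonempty (FreeAlgebra ℤ X ≃+* A.R)) ∧
    letI : Module (A.R ⊗[ℤ] A.Rᵐᵒᵖ) A.M := TensorProduct.Algebra.module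
    Module.Free (A.R ⊗[ℤ] A.Rᵐᵒᵖ) A.M

/-- `e` exhibits its target as the coequaliser, in the category of sets, of `f` and `g`. -/
def IsSetCoequalizer {α : Type*} {β : Type*} {γ : Type*} (f g : α → β) (e : β → γ) : Prop :=
  (∀ z, e (f z) = e (g z)) ∧ Function.Surjective e ∧
    ∀ x y, e x = e y → Relation.EqvGen (fun a b => ∃ z, f z = a ∧ g z = b) x y

set_option linter.checkUnivs false in
/-- A free resolution of `(R; M)`: a reflexive coequaliser diagram `T ⇉ S → (R; M)` of bimodules
with `S` and `T` free. Reflexive coequalisers of bimodules are computed on the underlying pairs of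
sets. -/
structure FreeResolution (A : Bimod.{u, v}) where
  T : Bimod.{u₁, v₁}
  S : Bimod.{u₂, v₂}
  f : Hom T S
  g : Hom T S
  sec : Hom S T
  ε : Hom S A
  free_T : IsFree T
  free_S : IsFree S
  f_sec_ring : ∀ x, f.ringHom (sec.ringHom x) = x
  f_sec_add : ∀ x, f.addHom (sec.addHom x) = x
  g_sec_ring : ∀ x, g.ringHom (sec.ringHom x) = x
  g_sec_add : ∀ x, g.addHom (sec.addHom x) = x
  coeq_ring : IsSetCoequalizer f.ringHom g.ringHom ε.ringHom
  coeq_add : IsSetCoequalizer f.addHom g.addHom ε.addHom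

/-! ## Existence of free resolutions -/

section Existence

/-- The enveloping ring of a ring. -/
abbrev Env (S : Type u) [Ring S] : Type u := S ⊗[ℤ] Sᵐᵒᵖ

/-- The free `S`-bimodule on a set. -/
def FreeMod (S : Type u) [Ring S] (Y : Type v) : Type (max u v) := Y →₀ Env S

section FreeMod

variable (S : Type u) [Ring S] (Y : Type v)

instance : AddCommGroup (FreeMod S Y) := inferInstanceAs (AddCommGroup (Y →₀ Env S))

instance : Module (Env S) (FreeMod S Y) := inferInstanceAs (Module (Env S) (Y →₀ Env S))

instance : Module.Free (Env S) (FreeMod S Y) :=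
  inferInstanceAs (Module.Free (Env S) (Y →₀ Env S))

instance : Module S (FreeMod S Y) :=
  Module.compHom _ (Algebra.TensorProduct.includeLeftRingHom : S →+* Env S)

instance : Module Sᵐᵒᵖ (FreeMod S Y) :=
  Module.compHom _ (Algebra.TensorProduct.includeRight : Sᵐᵒᵖ →ₐ[ℤ] Env S).toRingHom

variable {S Y}

theorem FreeMod.smul_left (a : S) (m : FreeMod S Y) :
    a • m = (a ⊗ₜ[ℤ] (1 : Sᵐᵒᵖ) : Env S) • m := rfl

theorem FreeMod.smul_right (b : Sᵐᵒᵖ) (m : FreeMod S Y) :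
    b • m = ((1 : S) ⊗ₜ[ℤ] b : Env S) • m := rfl

theorem FreeMod.smul_smul' (a : S) (b : Sᵐᵒᵖ) (m : FreeMod S Y) :
    a • b • m = (a ⊗ₜ[ℤ] b : Env S) • m := by
  rw [smul_left, smul_right, smul_smul]
  simp

instance : SMulCommClass S Sᵐᵒᵖ (FreeMod S Y) := ⟨fun a b m => by
  rw [FreeMod.smul_smul', FreeMod.smul_right, FreeMod.smul_left, smul_smul]
  simp⟩

end FreeMod

/-- The free `S`-bimodule on a set, as an object of the category of bimodules. -/
abbrev freeBimod (S : Type u) [Ring S] (Y : Type v) : Bimod.{u, max u v} := ⟨S, FreeMod S Y⟩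

variable {S : Type u} [Ring S] {X : Type u} {Y : Type v}

/-- The basis of the free bimodule. -/
def gen (S : Type u) [Ring S] (y : Y) : FreeMod S Y := Finsupp.single y (1 : Env S)

theorem isFree_freeBimod (h : ∃ X : Type u, Nonempty (FreeAlgebra ℤ X ≃+* S)) (Y : Type v) :
    IsFree (freeBimod S Y) := by
  refine ⟨h, ?_⟩
  have h : (TensorProduct.Algebra.module : Module (S ⊗[ℤ] Sᵐᵒᵖ) (FreeMod S Y)) =
      (inferInstance : Module (Env S) (FreeMod S Y)) := by
    refine Module.ext' _ _ fun e m => ?_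
    induction e using TensorProduct.induction_on with
    | zero =>
      exact (TensorProduct.Algebra.module.zero_smul m).trans (zero_smul (Env S) m).symm
    | tmul a b =>
      exact (TensorProduct.Algebra.smul_def a b m).trans (FreeMod.smul_smul' a b m)
    | add e e' h h' =>
      exact (TensorProduct.Algebra.module.add_smul e e' m).trans
        ((congrArg₂ (· + ·) h h').trans (add_smul (e : Env S) e' m).symm)
  change @Module.Free (S ⊗[ℤ] Sᵐᵒᵖ) (FreeMod S Y) _ _ TensorProduct.Algebra.module
  rw [h]
  infer_instance

theorem freeBimod_ext {A : Bimod.{u₁, v₁}} {f g : Hom (freeBimod S Y) A}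
    (hr : f.ringHom = g.ringHom) (h2 : ∀ y, f.addHom (gen S y) = g.addHom (gen S y)) :
    f.addHom = g.addHom := by
  refine Finsupp.addHom_ext (f := f.addHom) (g := g.addHom) fun y e => ?_
  induction e using TensorProduct.induction_on with
  | zero => rw [Finsupp.single_zero]; exact f.addHom.map_zero.trans g.addHom.map_zero.symm
  | tmul a b =>
    have : (Finsupp.single y (a ⊗ₜ[ℤ] b : Env S) : Y →₀ Env S) =
        (a • b • gen S y : FreeMod S Y) := by
      rw [FreeMod.smul_smul']
      refine Eq.trans ?_ (Finsupp.smul_single (a ⊗ₜ[ℤ] b : Env S) y (1 : Env S)).symm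
      rw [smul_eq_mul, mul_one]
    rw [this]
    have hf := (f.map_left a (b • gen S y)).trans
      (congrArg _ (f.map_right (MulOpposite.unop b) (gen S y)))
    have hg := (g.map_left a (b • gen S y)).trans
      (congrArg _ (g.map_right (MulOpposite.unop b) (gen S y)))
    rw [hr, h2] at hf
    exact hf.trans hg.symm
  | add e e' h h' =>
    rw [Finsupp.single_add]
    exact (f.addHom.map_add _ _).trans
      ((congrArg₂ (· + ·) h h').trans (g.addHom.map_add _ _).symm)

theorem exists_lift {A : Bimod.{u₁, v₁}} (α : S →+* A.R) (ψ : Y → A.M) :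
    ∃ f : Hom (freeBimod S Y) A, f.ringHom = α ∧ ∀ y, f.addHom (gen S y) = ψ y := by
  let _ : Module S A.M := Module.compHom _ α
  let _ : Module Sᵐᵒᵖ A.M := Module.compHom _ α.op
  have _ : SMulCommClass S Sᵐᵒᵖ A.M := ⟨fun a b m => smul_comm (α a) (α.op b) m⟩
  let _ : Module (Env S) A.M := TensorProduct.Algebra.module
  let L : FreeMod S Y →ₗ[Env S] A.M := Finsupp.linearCombination (Env S) ψ
  refine ⟨⟨α, L.toAddMonoidHom, fun r m => ?_, fun r m => ?_⟩, rfl, fun y => ?_⟩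
  · refine (L.map_smul (r ⊗ₜ[ℤ] (1 : Sᵐᵒᵖ) : Env S) m).trans
      ((TensorProduct.Algebra.smul_def _ _ _).trans ?_)
    rw [one_smul]; rfl
  · refine (L.map_smul ((1 : S) ⊗ₜ[ℤ] (MulOpposite.op r : Sᵐᵒᵖ) : Env S) m).trans
      ((TensorProduct.Algebra.smul_def _ _ _).trans ?_)
    rw [one_smul]; rfl
  · exact (Finsupp.linearCombination_single _ _ _).trans (one_smul _ _)

theorem freeRing_ext {B : Type u₁} [Ring B] {f g : FreeAlgebra ℤ X →+* B}
    (h : ∀ x, f (FreeAlgebra.ι ℤ x) = g (FreeAlgebra.ι ℤ x)) : f = g := by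
  have : f.toIntAlgHom = g.toIntAlgHom := FreeAlgebra.hom_ext (funext h)
  ext x
  exact DFunLike.congr_fun this x

theorem exists_freeRing_lift {B : Type u₁} [Ring B] (φ : X → B) :
    ∃ f : FreeAlgebra ℤ X →+* B, ∀ x, f (FreeAlgebra.ι ℤ x) = φ x :=
  ⟨(FreeAlgebra.lift ℤ φ).toRingHom, fun x => FreeAlgebra.lift_ι_apply φ x⟩

/-- The composite of two morphisms. -/
def Hom.comp {A : Bimod.{u, v}} {B : Bimod.{u₁, v₁}} {C : Bimod.{u₂, v₂}} (k : Hom B C)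
    (h : Hom A B) : Hom A C :=
  ⟨k.ringHom.comp h.ringHom, k.addHom.comp h.addHom,
    fun r m => by simp [h.map_left, k.map_left], fun r m => by simp [h.map_right, k.map_right]⟩

/-- Every bimodule has a free resolution. -/
theorem FreeResolution.exists (A : Bimod.{u, v}) :
    Nonempty (FreeResolution.{u, v, u, max u v, u, max u v} A) := by
  obtain ⟨εr, hεr⟩ := exists_freeRing_lift (X := A.R) (B := A.R) id
  obtain ⟨ε, rfl, hε⟩ := exists_lift (S := FreeAlgebra ℤ A.R) (A := A) εr (id : A.M → A.M)
  let S := freeBimod (FreeAlgebra ℤ A.R) A.M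
  let X' := {x : S.R × S.R // ε.ringHom x.1 = ε.ringHom x.2}
  let Y' := {x : S.M × S.M // ε.addHom x.1 = ε.addHom x.2}
  obtain ⟨fr, hfr⟩ := exists_freeRing_lift (B := S.R) (fun x : X' => x.1.1)
  obtain ⟨gr, hgr⟩ := exists_freeRing_lift (B := S.R) (fun x : X' => x.1.2)
  obtain ⟨tr, htr⟩ := exists_freeRing_lift (B := FreeAlgebra ℤ X')
    (fun x : A.R => FreeAlgebra.ι ℤ ⟨(FreeAlgebra.ι ℤ x, FreeAlgebra.ι ℤ x), rfl⟩)
  obtain ⟨f, rfl, hf⟩ := exists_lift (A := S) fr (fun y : Y' => y.1.1)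
  obtain ⟨g, rfl, hg⟩ := exists_lift (A := S) gr (fun y : Y' => y.1.2)
  obtain ⟨t, rfl, ht⟩ := exists_lift (A := freeBimod (FreeAlgebra ℤ X') Y') tr
    (fun y : A.M => gen (FreeAlgebra ℤ X') ⟨(gen (FreeAlgebra ℤ A.R) y,
      gen (FreeAlgebra ℤ A.R) y), rfl⟩)
  let idS : Hom S S := ⟨RingHom.id _, AddMonoidHom.id _, fun _ _ => rfl, fun _ _ => rfl⟩
  have hft1 : (f.comp t).ringHom = idS.ringHom :=
    freeRing_ext fun x => (congrArg f.ringHom (htr x)).trans (hfr _)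
  have hft2 := freeBimod_ext hft1 fun y => (congrArg f.addHom (ht y)).trans (hf _)
  have hgt1 : (g.comp t).ringHom = idS.ringHom :=
    freeRing_ext fun x => (congrArg g.ringHom (htr x)).trans (hgr _)
  have hgt2 := freeBimod_ext hgt1 fun y => (congrArg g.addHom (ht y)).trans (hg _)
  have hfg1 : (ε.comp f).ringHom = (ε.comp g).ringHom :=
    freeRing_ext fun x => (congrArg ε.ringHom (hfr x)).trans
      (x.2.trans (congrArg ε.ringHom (hgr x)).symm)
  have hfg2 := freeBimod_ext hfg1 fun y => (congrArg ε.addHom (hf y)).trans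
      (y.2.trans (congrArg ε.addHom (hg y)).symm)
  exact ⟨{
    T := freeBimod (FreeAlgebra ℤ X') Y'
    S := S
    f := f
    g := g
    sec := t
    ε := ε
    free_T := isFree_freeBimod ⟨_, ⟨RingEquiv.refl _⟩⟩ _
    free_S := isFree_freeBimod ⟨_, ⟨RingEquiv.refl _⟩⟩ _
    f_sec_ring := fun x => DFunLike.congr_fun hft1 x
    f_sec_add := fun x => DFunLike.congr_fun hft2 x
    g_sec_ring := fun x => DFunLike.congr_fun hgt1 x
    g_sec_add := fun x => DFunLike.congr_fun hgt2 x
    coeq_ring := ⟨fun z => DFunLike.congr_fun hfg1 z, fun x => ⟨_, hεr x⟩, fun x y h =>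
      Relation.EqvGen.rel _ _ ⟨FreeAlgebra.ι ℤ ⟨(x, y), h⟩, hfr _, hgr _⟩⟩
    coeq_add := ⟨fun z => DFunLike.congr_fun hfg2 z, fun x => ⟨_, hε x⟩, fun x y h =>
      Relation.EqvGen.rel _ _ ⟨gen (FreeAlgebra ℤ X') ⟨(x, y), h⟩, hf _, hg _⟩⟩ }⟩

end Existence

/-! ## Witt vectors with coefficients -/

section Witt

variable {A : Bimod.{u, v}} (ρ : FreeResolution.{u, v, u₁, v₁, u₂, v₂} A) (p n : ℕ)

/-- The relation on `∏_{i<n} M^{⊗_R p^i}` attached to a free resolution. -/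
def wittRel (a b : Tuple A.R A.M p n) : Prop :=
  ∃ (q u : Tuple ρ.S.R ρ.S.M p n) (z : Tuple ρ.T.R ρ.T.M p n),
    Tuple.map ρ.ε q = a ∧ Tuple.map ρ.ε u = b ∧
    ghost q = ghost (Tuple.map ρ.f z) ∧ ghost u = ghost (Tuple.map ρ.g z)

/-- The set `W_{n,p}(R; M)`: the quotient of `∏_{i<n} M^{⊗_R p^i}` by the equivalence relation
generated by `wittRel`. -/
def Witt : Type v := Quot (wittRel ρ p n)

variable {p n}

/-- The class of a tuple in `W_{n,p}(R; M)`. -/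
def Witt.mk (m : Tuple A.R A.M p n) : Witt ρ p n := Quot.mk _ m

/-- The class of `(0, …, 0, x, 0, …, 0)`, with `x` in position `i`, in `W_{n,p}(R; M)`. This is
`V^i τ(x)` for the Teichmüller map `τ(x) = (x, 0, …, 0)` and the iterated Verschiebung `V^i`, which
shifts a tuple by `i` places. -/
def Witt.single (i : Fin n) (x : Tens A.R A.M (p ^ (i : ℕ))) : Witt ρ p n :=
  Witt.mk ρ (Pi.single i x)

/-- The abelian group structure of `W_{n,p}(R; M)`: the sum of the images of two tuples `q`, `u`
of the free bimodule of the resolution is the image of a tuple `v` with `w(v) = w(q) + w(u)`,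
where `w` is the ghost map. Since every class is the image of such a tuple, this condition
determines the group structure. -/
def IsWittGroup (G : AddCommGroup (Witt ρ p n)) : Prop :=
  letI := G
  ∀ q u : Tuple ρ.S.R ρ.S.M p n, ∃ v : Tuple ρ.S.R ρ.S.M p n, ghost v = ghost q + ghost u ∧
    Witt.mk ρ (Tuple.map ρ.ε q) + Witt.mk ρ (Tuple.map ρ.ε u) = Witt.mk ρ (Tuple.map ρ.ε v)

end Witt

/-- A ring as a bimodule over itself. -/
abbrev Bimod.self (R : Type u) [Ring R] : Bimod.{u, u} := ⟨R, R⟩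

/-- A module over a commutative ring as a bimodule with `m r = r m`. -/
abbrev Bimod.ofModule (R : Type u) (M : Type v) [CommRing R] [AddCommGroup M] [Module R M] :
    Bimod.{u, v} :=
  letI : Module Rᵐᵒᵖ M := Module.compHom M ((RingHom.id R).fromOpposite fun _ _ => mul_comm _ _)
  { R := R, M := M, smulComm := ⟨fun r s m => smul_comm r s.unop m⟩ }

/-- The abelian group `R / [R, R]`, where `[R, R]` is generated by the elements `r s - s r`. -/
abbrev Comm (R : Type u) [Ring R] : Type u :=
  R ⧸ AddSubgroup.closure {x : R | ∃ r s : R, x = r * s - s * r}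

end WittCoeff

end

open WittCoeff

noncomputable section

namespace WittCoeff

/-! ## The tensor ring -/

section TensorRing

variable (M : Type v) [AddCommGroup M]

/-! Write `gvec i x` for the ghost vector of the tuple with x in place i and 0 elsewhere, and
`ghostFil i` for the group generated by all `gvec l x` with l ≥ i. The ghost map is a sum of such
vectors, but `gvec i` is not additive. The basic fact, `gvec_add_sub_mem`, is that it is additive
modulo `ghostFil (i + 1)`: in the expansion of (x + y)^(p^(j-i)), a rotation orbit of words of
period p^s with s ≥ 1 sums to the contribution of one tensor in place i + s. Removing one place at a
time, every element of `ghostFil 0` is a ghost vector (`exists_ghost_eq`), so the ghost vectors form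
a group.

For a free resolution T ⇉ S → A, the tensor powers of A are still reflexive coequalisers of those of
T and S (`FreeResolution.exists_tens_of_eq`). Hence the ghost map of S identifies the Witt vectors
of A with the ghost vectors of S modulo the differences of the two images of ghost vectors of T
(`Witt.toGhost_injective`, `Witt.equivGhost`); this also supplies the group structure.

The resulting group has a finite filtration by position, `Witt.fil`. Its i-th graded piece is an
additive quotient of the tensor power of degree p^i, and `Witt.single_mem_fil_succ_iff` identifies
it with the coinvariants modulo the kernel of V^i. The point is that a ghost vector of S whose
components 0, …, i vanish lies in `ghostFil (i + 1)`: the norm of C_{p^i} is multiplication by p^i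
on coinvariants, and those of S have no p-power torsion, since they embed in a free abelian group on
cyclic words (`IsFree.coinv_torsion_free`). A sum of maps that are bijective on the graded pieces is
bijective (`bijective_sum_of_filtration`), which is the general statement.

If the coinvariants of A itself have no p-power torsion, the ghost map of A shows that V^i is
injective (`Witt.versch_injective`). The special cases follow by computing coinvariants: they are
R/[R, R] for M = R, and finitely supported R-valued functions on cyclic words in a basis for M free
over a commutative ring. A sum of Teichmüller terms over a basis expansion differs from the class of
a single tensor only by the next filtration step, so the same argument applies to it. -/

/-- The tensor ring of an abelian group, as the direct sum of its tensor powers. -/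
abbrev TRing : Type v := DirectSum ℕ fun i => ⨂[ℤ]^i M

variable {M}

/-- The inclusion of the tensor power with `k` factors into the tensor ring. -/
abbrev hom (k : ℕ) : (⨂[ℤ]^k M) →+ TRing M := DirectSum.of (fun i => ⨂[ℤ]^i M) k

/-- All degrees live in one ring here, so `powZ` becomes an honest power and the casts between equal
degrees disappear. -/
theorem hom_mul {k l : ℕ} (x : ⨂[ℤ]^k M) (y : ⨂[ℤ]^l M) :
    hom k x * hom l y = hom (k + l) (tmulZ x y) :=
  DirectSum.of_mul_of (A := fun i => ⨂[ℤ]^i M) x y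

theorem hom_cast {k l : ℕ} (h : k = l) (x : ⨂[ℤ]^k M) :
    hom l (TensorPower.cast ℤ M h x) = hom k x := by
  subst h
  rw [TensorPower.cast_refl]; rfl

theorem hom_powZ {k l : ℕ} (N : ℕ) (h : N * k = l) (x : ⨂[ℤ]^k M) :
    hom l (powZ N h x) = hom k x ^ N := by
  rw [DirectSum.ofPow]
  exact hom_cast h _

theorem hom_injective (k : ℕ) : Function.Injective (hom (M := M) k) := DirectSum.of_injective k

/-- The elementary tensor `f 0 ⊗ ⋯ ⊗ f (k - 1)` in the tensor ring. -/
def etens (k : ℕ) (f : ℕ → M) : TRing M := hom k (PiTensorProduct.tprod ℤ fun l : Fin k => f l)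

/-- Reading the factors off a sequence on ℕ makes concatenation a shift of the index, with no
identification of `Fin` types. -/
theorem etens_add (k l : ℕ) (f : ℕ → M) :
    etens (k + l) f = etens k f * etens l (fun x => f (x + k)) := by
  rw [etens, etens, etens, hom_mul, tmulZ_tprod]
  congr 2
  funext t
  refine Fin.addCases (fun s => ?_) (fun s => ?_) t
  · simp
  · simp [add_comm]

theorem etens_zero (f : ℕ → M) : etens 0 f = 1 := by
  refine congrArg (hom 0) (congrArg _ ?_)
  exact Subsingleton.elim _ _

theorem etens_mul_of_periodic {k : ℕ} {f : ℕ → M} (h : Function.Periodic f k) (N : ℕ) :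
    etens (N * k) f = etens k f ^ N := by
  induction N with
  | zero => rw [Nat.zero_mul, pow_zero, etens_zero]
  | succ N ih =>
    rw [Nat.succ_mul, etens_add, ih, pow_succ]
    congr 2
    funext x
    exact h.nat_mul N x

end TensorRing

/-! ### Products and powers in the cyclic tensor power. -/

section Cyclic

variable (R : Type u) {M : Type v} [Ring R] [AddCommGroup M] [Module R M] [Module Rᵐᵒᵖ M]

/-- The projection of the tensor ring to the cyclic tensor power with `k` factors. -/
def cycComp (k : ℕ) : TRing M →+ Cyc R M k :=
  (QuotientAddGroup.mk' (cycRel R M k)).comp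
    (DirectSum.component ℤ ℕ (fun i => ⨂[ℤ]^i M) k).toAddMonoidHom

theorem cycComp_hom (k : ℕ) (x : ⨂[ℤ]^k M) :
    cycComp R k (hom k x) = QuotientAddGroup.mk' (cycRel R M k) x :=
  congrArg (QuotientAddGroup.mk' (cycRel R M k)) (DirectSum.of_eq_same (β := fun i => ⨂[ℤ]^i M) k x)

theorem toCyc_mk (k : ℕ) (x : ⨂[ℤ]^k M) :
    Tens.toCyc R M k (QuotientAddGroup.mk' (balRel R M k) x) = cycComp R k (hom k x) :=
  (cycComp_hom R k x).symm

theorem pow_mk {k l : ℕ} (N : ℕ) (h : N * k = l) (x : ⨂[ℤ]^k M) :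
    Tens.pow R N h (QuotientAddGroup.mk' (balRel R M k) x) =
      QuotientAddGroup.mk' (balRel R M l) (powZ N h x) := rfl

theorem toCyc_pow_mk {k l : ℕ} (N : ℕ) (h : N * k = l) (x : ⨂[ℤ]^k M) :
    Tens.toCyc R M l (Tens.pow R N h (QuotientAddGroup.mk' (balRel R M k) x)) =
      cycComp R l (hom k x ^ N) := by
  rw [pow_mk, toCyc_mk, hom_powZ]

/-- Periodicity hides the wrap from the last index to 0, so rotation is simply the successor. -/
theorem apply_finRotate_of_periodic {κ : Type*} {k : ℕ} {f : ℕ → κ} (h : Function.Periodic f k)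
    (l : Fin k) : f (finRotate k l) = f (l + 1) := by
  cases k with
  | zero => exact l.elim0
  | succ k =>
    rcases Nat.lt_or_eq_of_le (Nat.le_of_lt_succ l.2) with h' | h'
    · rw [coe_finRotate_of_ne_last (fun e => by simp [e] at h')]
    · obtain rfl : l = Fin.last k := Fin.ext h'
      rw [finRotate_last]
      simpa using (h 0).symm

/-- Rotation moves the factor in place l to place l + 1 and thereby undoes the shift of the
sequence. -/
theorem rot_cycComp_etens {k : ℕ} {f : ℕ → M} (h : Function.Periodic f k) :
    Cyc.rot R M k (cycComp R k (etens k fun x => f (x + 1))) = cycComp R k (etens k f) := by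
  rw [etens, etens, cycComp_hom, cycComp_hom]
  refine congrArg (QuotientAddGroup.mk' (cycRel R M k)) ((rotZ_tprod M _).trans ?_)
  congr 1
  funext l
  obtain ⟨l, rfl⟩ := (finRotate k).surjective l
  rw [Equiv.symm_apply_apply, apply_finRotate_of_periodic h]

theorem rot_iterate_cycComp_etens {k : ℕ} (t : ℕ) {f : ℕ → M} (h : Function.Periodic f k) :
    (Cyc.rot R M k)^[t] (cycComp R k (etens k fun x => f (x + t))) = cycComp R k (etens k f) := by
  induction t with
  | zero => rfl
  | succ t ih =>
    rw [Function.iterate_succ_apply]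
    have := rot_cycComp_etens R (k := k) (f := fun x => f (x + t)) (fun x => by
      have := h (x + t); rwa [add_right_comm] at this)
    rw [← ih, ← this]
    simp only [add_assoc, add_comm 1 t]

/-- If a periodic sequence spells a followed by b, its shift by k spells b followed by a. -/
theorem rot_iterate_cycComp_mul_tprod {k l n : ℕ} (h : k + l = n) (a : Fin k → M) (b : Fin l → M) :
    (Cyc.rot R M n)^[k] (cycComp R n (hom l (PiTensorProduct.tprod ℤ b) *
        hom k (PiTensorProduct.tprod ℤ a))) =
      cycComp R n (hom k (PiTensorProduct.tprod ℤ a) * hom l (PiTensorProduct.tprod ℤ b)) := by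
  subst h
  -- With no factors there are no residues to index by, and both tensors are empty.
  rcases Nat.eq_zero_or_pos (k + l) with h0 | h0
  · obtain ⟨rfl, rfl⟩ : k = 0 ∧ l = 0 := by omega
    rw [Function.iterate_zero_apply, Subsingleton.elim a b]
  let f : ℕ → M := fun x => Fin.append a b ⟨x % (k + l), Nat.mod_lt _ h0⟩
  have hf : Function.Periodic f (k + l) := fun x => by simp [f]
  have ha : hom k (PiTensorProduct.tprod ℤ a) = etens k f := by
    unfold etens
    congr 2
    funext x
    have : (x : ℕ) % (k + l) = x := Nat.mod_eq_of_lt (by omega)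
    exact ((congrArg (Fin.append a b) (Fin.ext this :
      (⟨(x : ℕ) % (k + l), Nat.mod_lt _ h0⟩ : Fin (k + l)) = Fin.castAdd l x)).trans
        (Fin.append_left a b x)).symm
  have hb : hom l (PiTensorProduct.tprod ℤ b) = etens l (fun x => f (x + k)) := by
    unfold etens
    congr 2
    funext x
    have : ((x : ℕ) + k) % (k + l) = k + x := by
      rw [Nat.mod_eq_of_lt (by omega), add_comm]
    exact ((congrArg (Fin.append a b) (Fin.ext this :
      (⟨((x : ℕ) + k) % (k + l), Nat.mod_lt _ h0⟩ : Fin (k + l)) = Fin.natAdd k x)).trans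
        (Fin.append_right a b x)).symm
  have ha' : etens k f = etens k (fun x => f (x + l + k)) := by
    congr 1; funext x; rw [add_assoc, add_comm l k]; exact (hf x).symm
  rw [ha, hb, ← etens_add, ha', ← etens_add l k (fun x => f (x + k)), add_comm l k]
  exact rot_iterate_cycComp_etens R k hf

theorem rot_iterate_cycComp_mul {k l n : ℕ} (h : k + l = n) (x : ⨂[ℤ]^k M) (y : ⨂[ℤ]^l M) :
    (Cyc.rot R M n)^[k] (cycComp R n (hom l y * hom k x)) = cycComp R n (hom k x * hom l y) := by
  induction x using PiTensorProduct.induction_on with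
  | smul_tprod c a =>
    induction y using PiTensorProduct.induction_on with
    | smul_tprod d b =>
      simp only [map_zsmul, smul_mul_assoc, mul_smul_comm, iterate_map_zsmul]
      rw [rot_iterate_cycComp_mul_tprod R h, smul_comm]
    | add y z hy hz => simp only [map_add, add_mul, mul_add, iterate_map_add, hy, hz]
  | add x z hx hz => simp only [map_add, add_mul, mul_add, iterate_map_add, hx, hz]

/-- Moving one factor x around the circle leaves x^N unchanged. This is the invariance under the
subgroup generated by rot^k that lets the transfer be computed on the coset representatives rot^t, t
< k. -/
theorem rot_iterate_cycComp_pow {k l : ℕ} (N : ℕ) (hN : 0 < N) (h : N * k = l) (x : ⨂[ℤ]^k M) :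
    (Cyc.rot R M l)^[k] (cycComp R l (hom k x ^ N)) = cycComp R l (hom k x ^ N) := by
  obtain ⟨N, rfl⟩ : ∃ N', N = N' + 1 := ⟨N - 1, by omega⟩
  have := rot_iterate_cycComp_mul R (k := k) (l := N * k) (n := l) (by rw [← h]; ring) x
    (powZ N rfl x)
  rwa [hom_powZ, ← pow_succ, ← pow_succ'] at this

end Cyclic

/-! ## Words -/

section Words

variable {S : Type*} [Semiring S]

/-- The product `a (c (N - 1)) ⋯ a (c 1) * a (c 0)`. -/
def word {κ : Type*} (a : κ → S) (c : ℕ → κ) : ℕ → S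
  | 0 => 1
  | N + 1 => a (c N) * word a c N

theorem word_add {κ : Type*} (a : κ → S) (c : ℕ → κ) (k l : ℕ) :
    word a c (k + l) = word a (fun x => c (x + k)) l * word a c k := by
  induction l with
  | zero => simp [word]
  | succ l ih =>
    rw [← add_assoc, word, ih, word, mul_assoc, add_comm l k]

theorem word_congr {κ : Type*} (a : κ → S) {c d : ℕ → κ} {N : ℕ} (h : ∀ x < N, c x = d x) :
    word a c N = word a d N := by
  induction N with
  | zero => rfl
  | succ N ih => rw [word, word, h N N.lt_succ_self, ih fun x hx => h x (by omega)]

theorem word_mul_of_periodic {κ : Type*} (a : κ → S) {c : ℕ → κ} {k : ℕ}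
    (h : Function.Periodic c k) (N : ℕ) : word a c (N * k) = word a c k ^ N := by
  induction N with
  | zero => rw [Nat.zero_mul, pow_zero]; rfl
  | succ N ih =>
    rw [Nat.succ_mul, add_comm, word_add, pow_succ, ← ih]
    congr 2
    funext x
    exact h x

theorem word_const {κ : Type*} (a : κ → S) (i : κ) (N : ℕ) : word a (fun _ => i) N = a i ^ N := by
  induction N with
  | zero => exact (pow_zero _).symm
  | succ N ih => rw [word, ih, pow_succ']

end Words

section Words

variable {S : Type*} [Semiring S] {κ : Type*}

/-- The periodic extension of a word with `N` letters. -/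
def perExt {N : ℕ} (hN : 0 < N) (c : Fin N → κ) : ℕ → κ := fun x => c ⟨x % N, Nat.mod_lt _ hN⟩

theorem perExt_of_lt {N : ℕ} (hN : 0 < N) (c : Fin N → κ) {x : ℕ} (h : x < N) :
    perExt hN c x = c ⟨x, h⟩ := by
  simp only [perExt, Nat.mod_eq_of_lt h]

theorem perExt_periodic {N : ℕ} (hN : 0 < N) (c : Fin N → κ) :
    Function.Periodic (perExt hN c) N := fun x => by simp [perExt]

theorem perExt_injective {N : ℕ} (hN : 0 < N) :
    Function.Injective (perExt hN : (Fin N → κ) → ℕ → κ) := fun c d h => by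
  funext x
  have := congrFun h x
  rwa [perExt_of_lt hN _ x.2, perExt_of_lt hN _ x.2] at this

theorem exists_perExt {N : ℕ} (hN : 0 < N) {c : ℕ → κ} (h : Function.Periodic c N) :
    perExt hN (fun l : Fin N => c l) = c := by
  funext x
  exact h.map_mod_nat x

variable [Fintype κ]

open Classical in
/-- The finite set of `N`-periodic infinite words. -/
def perWords (κ : Type*) [Fintype κ] {N : ℕ} (hN : 0 < N) : Finset (ℕ → κ) :=
  Finset.univ.image (perExt hN)

theorem mem_perWords {N : ℕ} (hN : 0 < N) {c : ℕ → κ} :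
    c ∈ perWords κ hN ↔ Function.Periodic c N := by
  classical
  rw [perWords, Finset.mem_image]
  constructor
  · rintro ⟨d, -, rfl⟩
    exact perExt_periodic hN d
  · exact fun h => ⟨_, Finset.mem_univ _, exists_perExt hN h⟩

/-- The extension `e` of finite words is arbitrary because `word` reads only the first N letters.
The induction starts at length 0, where a periodic extension does not exist. -/
theorem sum_pow_eq_sum_fin_word (a : κ → S) (N : ℕ) (e : ∀ N : ℕ, (Fin N → κ) → ℕ → κ)
    (he : ∀ (N : ℕ) (c : Fin N → κ) (x : ℕ) (h : x < N), e N c x = c ⟨x, h⟩) :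
    (∑ i, a i) ^ N = ∑ c : Fin N → κ, word a (e N c) N := by
  induction N with
  | zero => rw [pow_zero]; simp [word]
  | succ N ih =>
    rw [← (Fin.snocEquiv fun _ : Fin (N + 1) => κ).sum_comp, Fintype.sum_prod_type, pow_succ', ih,
      Finset.sum_mul]
    refine Finset.sum_congr rfl fun i _ => ?_
    rw [Finset.mul_sum]
    refine Finset.sum_congr rfl fun c _ => ?_
    rw [word, he (N + 1) _ N N.lt_succ_self]
    congr 1
    · change a i = a (Fin.snoc (α := fun _ => κ) c i (Fin.last N))
      rw [Fin.snoc_last]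
    · refine word_congr a fun x hx => ?_
      rw [he N c x hx, he (N + 1) _ x (by omega)]
      change _ = Fin.snoc (α := fun _ => κ) c i (Fin.castSucc ⟨x, hx⟩)
      rw [Fin.snoc_castSucc]

theorem sum_pow_eq_sum_word (a : κ → S) {N : ℕ} (hN : 0 < N) :
    (∑ i, a i) ^ N = ∑ c ∈ perWords κ hN, word a c N := by
  classical
  rw [perWords, Finset.sum_image fun c _ d _ h => perExt_injective hN h]
  -- Extending words of every length needs a default letter; without letters both sides vanish, as N
  -- > 0.
  rcases isEmpty_or_nonempty κ with hκ | ⟨⟨i₀⟩⟩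
  · have : IsEmpty (Fin N → κ) := ⟨fun c => hκ.elim (c ⟨0, hN⟩)⟩
    simp [hN.ne']
  rw [sum_pow_eq_sum_fin_word a N (fun N c x => if h : x < N then c ⟨x, h⟩ else i₀)
    fun N c x h => dif_pos h]
  refine Finset.sum_congr rfl fun c _ => word_congr a fun x hx => ?_
  rw [dif_pos hx, perExt_of_lt hN c hx]

end Words

/-! ## Sums over orbits -/

/-- Strong induction on P, removing the orbit of one point at a time. -/
theorem sum_mem_of_sum_orbit_mem {α : Type*} {B : Type*} [AddCommGroup B] (σ : α → α) (F : α → B)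
    (K : AddSubgroup B) (P : Finset α) (hσ : ∀ c ∈ P, σ c ∈ P)
    (hper : ∀ c ∈ P, c ∈ Function.periodicPts σ)
    (h : ∀ c ∈ P, ∑ t ∈ Finset.range (Function.minimalPeriod σ c), F (σ^[t] c) ∈ K) :
    ∑ c ∈ P, F c ∈ K := by
  classical
  induction P using Finset.strongInduction with
  | H P ih =>
    rcases P.eq_empty_or_nonempty with rfl | ⟨c, hc⟩
    · rw [Finset.sum_empty]; exact zero_mem _
    set d := Function.minimalPeriod σ c with hd
    have hd0 : 0 < d := Function.minimalPeriod_pos_of_mem_periodicPts (hper c hc)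
    set O : Finset α := (Finset.range d).image fun t => σ^[t] c with hO
    have memO : ∀ t, σ^[t] c ∈ O := fun t => Finset.mem_image.2 ⟨t % d,
      Finset.mem_range.2 (Nat.mod_lt _ hd0), Function.iterate_mod_minimalPeriod_eq⟩
    have hOP : O ⊆ P := by
      intro x hx
      obtain ⟨t, -, rfl⟩ := Finset.mem_image.1 hx
      clear hx
      induction t with
      | zero => exact hc
      | succ t iht => rw [Function.iterate_succ_apply']; exact hσ _ iht
    have hsum : ∑ x ∈ O, F x ∈ K := by
      rw [hO, Finset.sum_image]
      · exact h c hc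
      · intro s hs t ht hst
        exact Function.iterate_injOn_Iio_minimalPeriod (Finset.mem_range.1 hs)
          (Finset.mem_range.1 ht) hst
    rw [← Finset.sum_sdiff hOP]
    refine add_mem (ih _ ?_ ?_ ?_ ?_) hsum
    · refine Finset.ssubset_iff_subset_ne.2 ⟨Finset.sdiff_subset, fun e => ?_⟩
      have : c ∈ P \ O := by rw [e]; exact hc
      exact (Finset.mem_sdiff.1 this).2 (memO 0)
    · intro x hx
      obtain ⟨hxP, hxO⟩ := Finset.mem_sdiff.1 hx
      refine Finset.mem_sdiff.2 ⟨hσ x hxP, fun hσx => hxO ?_⟩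
      obtain ⟨t, -, ht⟩ := Finset.mem_image.1 hσx
      have hx0 := Function.minimalPeriod_pos_of_mem_periodicPts (hper x hxP)
      -- On periodic points σ is inverted by its iterate of order one less than the period; hence a
      -- point outside the orbit cannot be mapped into it.
      have : σ^[Function.minimalPeriod σ x - 1] (σ x) = x := by
        rw [← Function.iterate_succ_apply, Nat.succ_eq_add_one, Nat.sub_add_cancel hx0]
        exact Function.isPeriodicPt_minimalPeriod σ x
      rw [← this, ← ht, ← Function.iterate_add_apply]
      exact memO _
    · exact fun x hx => hper x (Finset.mem_sdiff.1 hx).1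
    · exact fun x hx => h x (Finset.mem_sdiff.1 hx).1

/-- With a = p^i and b = p^s this splits a transfer into its first p^i rotations and the translates
of these by multiples of p^i. -/
theorem sum_range_mul_eq {B : Type*} [AddCommMonoid B] (f : ℕ → B) (a b : ℕ) :
    ∑ t ∈ Finset.range (a * b), f t =
      ∑ s ∈ Finset.range b, ∑ t ∈ Finset.range a, f (t + a * s) := by
  induction b with
  | zero => simp
  | succ b ih =>
    rw [Nat.mul_succ, Finset.sum_range_add, ih, Finset.sum_range_succ]
    simp only [add_comm]

/-- The shift of an infinite word. -/
def shift {κ : Type*} (c : ℕ → κ) : ℕ → κ := fun x => c (x + 1)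

theorem shift_iterate {κ : Type*} (t : ℕ) (c : ℕ → κ) : shift^[t] c = fun x => c (x + t) := by
  induction t with
  | zero => rfl
  | succ t ih =>
    rw [Function.iterate_succ_apply', ih]
    funext x
    simp only [shift]
    congr 1
    omega

theorem isPeriodicPt_shift {κ : Type*} {N : ℕ} {c : ℕ → κ} :
    Function.IsPeriodicPt shift N c ↔ Function.Periodic c N := by
  rw [Function.IsPeriodicPt, Function.IsFixedPt, shift_iterate]
  exact funext_iff

theorem Periodic.shift_iterate {κ : Type*} {N : ℕ} {c : ℕ → κ} (h : Function.Periodic c N) (t : ℕ) :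
    Function.Periodic (shift^[t] c) N := by
  rw [WittCoeff.shift_iterate]
  intro x
  have := h (x + t)
  rwa [add_right_comm] at this

/-! ## The components of the ghost map -/

section Ghost

variable (R : Type u) {M : Type v} [Ring R] [AddCommGroup M] [Module R M] [Module Rᵐᵒᵖ M]

theorem exists_hom_eq_word {κ : Type*} {k : ℕ} (ξ : κ → ⨂[ℤ]^k M) (c : ℕ → κ) {N l : ℕ}
    (h : N * k = l) : ∃ ω : ⨂[ℤ]^l M, hom l ω = word (fun i => hom k (ξ i)) c N := by
  subst h
  induction N with
  | zero =>
    obtain h : 0 = 0 * k := (Nat.zero_mul k).symm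
    refine ⟨TensorPower.cast ℤ M h (GradedMonoid.GOne.one (A := fun i => ⨂[ℤ]^i M)), ?_⟩
    rw [hom_cast]; rfl
  | succ N ih =>
    obtain ⟨ω, hω⟩ := ih
    refine ⟨TensorPower.cast ℤ M (by rw [Nat.succ_mul, add_comm]) (tmulZ (ξ (c N)) ω), ?_⟩
    rw [hom_cast, ← hom_mul, hω]; rfl

/-- A letter is a tensor with k factors, so shifting by one letter takes the rightmost letter to the
left end, which is a rotation by k places. -/
theorem cycComp_word_shift {κ : Type*} {k l N : ℕ} (hN : 0 < N) (h : N * k = l)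
    (ξ : κ → ⨂[ℤ]^k M) {c : ℕ → κ} (hc : Function.Periodic c N) :
    cycComp R l (word (fun i => hom k (ξ i)) (shift c) N) =
      (Cyc.rot R M l)^[k] (cycComp R l (word (fun i => hom k (ξ i)) c N)) := by
  obtain ⟨N, rfl⟩ : ∃ N', N = N' + 1 := ⟨N - 1, by omega⟩
  obtain ⟨ω, hω⟩ := exists_hom_eq_word ξ (shift c) (N := N) rfl
  have e : shift c N = c 0 := by simpa [shift] using hc 0
  have e2 : word (fun i => hom k (ξ i)) c (N + 1) =
      word (fun i => hom k (ξ i)) (shift c) N * hom k (ξ (c 0)) := by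
    rw [add_comm N 1, word_add]
    congr 1
    exact mul_one _
  rw [e2, word, e, ← hω]
  exact (rot_iterate_cycComp_mul R (by rw [← h]; ring) _ _).symm

theorem cycComp_word_shift_iterate {κ : Type*} {k l N : ℕ} (hN : 0 < N) (h : N * k = l)
    (ξ : κ → ⨂[ℤ]^k M) {c : ℕ → κ} (hc : Function.Periodic c N) (t : ℕ) :
    cycComp R l (word (fun i => hom k (ξ i)) (shift^[t] c) N) =
      (Cyc.rot R M l)^[k * t] (cycComp R l (word (fun i => hom k (ξ i)) c N)) := by
  induction t with
  | zero => rfl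
  | succ t ih =>
    rw [Function.iterate_succ_apply', cycComp_word_shift R hN h ξ (Periodic.shift_iterate hc t), ih,
      ← Function.iterate_add_apply, Nat.mul_succ, add_comm k]

variable (M) in
/-- The target of the ghost map. -/
abbrev GhostTarget (p n : ℕ) : Type v := ∀ j : Fin n, Cyc R M (p ^ (j : ℕ))

variable {R}

/-- The contribution of the entry in position `i` to the ghost map. -/
def gvec (p n i : ℕ) (x : Tens R M (p ^ i)) : GhostTarget R M p n := fun j =>
  if h : i ≤ j then
    ∑ t ∈ Finset.range (p ^ i), (Cyc.rot R M (p ^ (j : ℕ)))^[t]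
      (Tens.toCyc R M _ (Tens.pow R (p ^ ((j : ℕ) - i)) (pow_sub_mul_pow' h) x))
  else 0

theorem ghost_eq_sum {p n : ℕ} (m : Tuple R M p n) : ghost m = ∑ i : Fin n, gvec p n i (m i) := by
  funext j
  rw [Finset.sum_apply]
  rfl

theorem gvec_mk (p n i : ℕ) (ξ : ⨂[ℤ]^(p ^ i) M) (j : Fin n) :
    gvec p n i (QuotientAddGroup.mk' (balRel R M _) ξ) j =
      if i ≤ j then ∑ t ∈ Finset.range (p ^ i), (Cyc.rot R M (p ^ (j : ℕ)))^[t]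
        (cycComp R _ (hom _ ξ ^ p ^ ((j : ℕ) - i))) else 0 := by
  unfold gvec
  split_ifs with h
  · simp only [toCyc_pow_mk]
  · rfl

theorem gvec_zero {p : ℕ} (hp : 0 < p) (n i : ℕ) :
    gvec p n i (0 : Tens R M (p ^ i)) = 0 := by
  have := fun j => gvec_mk (R := R) (M := M) p n i 0 j
  rw [map_zero, map_zero] at this
  funext j
  rw [this, zero_pow (pow_pos hp _).ne', map_zero]
  simp

theorem gvec_eq_zero_of_le {p n i : ℕ} (h : n ≤ i) (x : Tens R M (p ^ i)) : gvec p n i x = 0 := by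
  funext j
  exact dif_neg (by have := j.2; omega)

variable (R M) in
/-- The subgroup generated by the contributions to the ghost map of the positions `≥ i`. -/
def ghostFil (p n i : ℕ) : AddSubgroup (GhostTarget R M p n) :=
  AddSubgroup.closure {g | ∃ (l : ℕ) (x : Tens R M (p ^ l)), i ≤ l ∧ g = gvec p n l x}

theorem gvec_mem_ghostFil {p n i l : ℕ} (h : i ≤ l) (x : Tens R M (p ^ l)) :
    gvec p n l x ∈ ghostFil R M p n i := AddSubgroup.subset_closure ⟨l, x, h, rfl⟩

theorem ghostFil_anti {p n i l : ℕ} (h : i ≤ l) : ghostFil R M p n l ≤ ghostFil R M p n i :=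
  AddSubgroup.closure_mono fun _ ⟨k, x, hk, hx⟩ => ⟨k, x, h.trans hk, hx⟩

/-- The two constant words in the expansion of (ξ + η)^(p^(j-i)) give the contributions of x and y.
Every other rotation orbit has length p^s with s ≥ 1 and contributes exactly `gvec (i + s) ω`, for
one and the same ω in all components j. -/
theorem gvec_add_sub_mem {p : ℕ} [hp : Fact p.Prime] (n i : ℕ) (x y : Tens R M (p ^ i)) :
    gvec p n i (x + y) - gvec p n i x - gvec p n i y ∈ ghostFil R M p n (i + 1) := by
  classical
  have hpos : ∀ m, 0 < p ^ m := fun m => pow_pos hp.out.pos m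
  obtain ⟨ξ, rfl⟩ := QuotientAddGroup.mk'_surjective _ x
  obtain ⟨η, rfl⟩ := QuotientAddGroup.mk'_surjective _ y
  let ζ : Bool → ⨂[ℤ]^(p ^ i) M := fun b => cond b ξ η
  let a : Bool → TRing M := fun b => hom (p ^ i) (ζ b)
  -- All components are indexed by one set, the words of period p^n; a word counts in component j
  -- only if p^(j-i) is already a period.
  let F : (ℕ → Bool) → GhostTarget R M p n := fun c j =>
    if i ≤ j ∧ Function.Periodic c (p ^ ((j : ℕ) - i)) then
      ∑ t ∈ Finset.range (p ^ i), (Cyc.rot R M (p ^ (j : ℕ)))^[t]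
        (cycComp R _ (word a c (p ^ ((j : ℕ) - i)))) else 0
  have hconst : ∀ b, F (fun _ => b) = gvec p n i (QuotientAddGroup.mk' (balRel R M _) (ζ b)) := by
    intro b
    funext j
    rw [gvec_mk]
    simp only [F, word_const]
    have : Function.Periodic (fun _ : ℕ => b) (p ^ ((j : ℕ) - i)) := fun _ => rfl
    simp only [this, and_true, a]
  have htotal : gvec p n i (QuotientAddGroup.mk' (balRel R M _) ξ +
      QuotientAddGroup.mk' (balRel R M _) η) = ∑ c ∈ perWords Bool (hpos n), F c := by
    rw [← map_add]
    funext j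
    rw [gvec_mk, Finset.sum_apply]
    by_cases h : i ≤ j
    · have hsum : hom (p ^ i) (ξ + η) = ∑ b, a b := by
        rw [map_add, Fintype.sum_bool]; rfl
      rw [if_pos h, hsum, sum_pow_eq_sum_word a (hpos _)]
      simp only [F, h, true_and]
      rw [← Finset.sum_filter]
      have hfil : (perWords Bool (hpos n)).filter
          (fun c => Function.Periodic c (p ^ ((j : ℕ) - i))) = perWords Bool (hpos (j - i)) := by
        ext c
        rw [Finset.mem_filter, mem_perWords, mem_perWords]
        refine ⟨fun h => h.2, fun h => ⟨?_, h⟩⟩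
        obtain ⟨e, he⟩ := pow_dvd_pow p (show (j : ℕ) - i ≤ n by have := j.2; omega)
        rw [he, mul_comm]
        exact h.nat_mul e
      rw [hfil, Finset.sum_comm]
      refine Finset.sum_congr rfl fun t _ => ?_
      rw [map_sum]
      exact map_sum (AddMonoidHom.mk' ((Cyc.rot R M (p ^ (j : ℕ)))^[t])
        (iterate_map_add _ _)) _ _
    · rw [if_neg h]
      exact (Finset.sum_eq_zero fun c _ => if_neg fun h' => h h'.1).symm
  have hsub : ({fun _ => true, fun _ => false} : Finset (ℕ → Bool)) ⊆ perWords Bool (hpos n) := by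
    intro c hc
    rw [mem_perWords]
    rcases Finset.mem_insert.1 hc with rfl | hc
    · exact fun _ => rfl
    · rw [Finset.mem_singleton.1 hc]; exact fun _ => rfl
  have hne : (fun _ => true : ℕ → Bool) ≠ fun _ => false := fun h => by simpa using congrFun h 0
  rw [htotal, ← Finset.sum_sdiff hsub, Finset.sum_pair hne, hconst, hconst]
  have habel : ∀ s g h : GhostTarget R M p n, s + (g + h) - g - h = s := fun s g h => by abel
  rw [show ζ true = ξ from rfl, show ζ false = η from rfl, habel]
  -- The constant words are the fixed points of the shift.
  have hnc : ∀ {c : ℕ → Bool}, c ∈ perWords Bool (hpos n) \ {fun _ => true, fun _ => false} ↔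
      Function.Periodic c (p ^ n) ∧ ¬ shift c = c := by
    intro c
    rw [Finset.mem_sdiff, mem_perWords]
    refine and_congr_right fun _ => not_congr ?_
    rw [Finset.mem_insert, Finset.mem_singleton]
    constructor
    · rintro (rfl | rfl) <;> rfl
    · intro h
      have h0 : ∀ x, c x = c 0 := fun x => by
        induction x with
        | zero => rfl
        | succ x ih => rw [← ih]; exact congrFun h x
      cases hb : c 0 with
      | true => exact Or.inl (funext fun x => (h0 x).trans hb)
      | false => exact Or.inr (funext fun x => (h0 x).trans hb)
  refine sum_mem_of_sum_orbit_mem shift F _ _ ?_ ?_ ?_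
  · intro c hc
    rw [hnc] at hc ⊢
    -- If the shifted word were fixed, shifting on around the whole period would show that the word
    -- itself is fixed.
    refine ⟨Periodic.shift_iterate hc.1 1, fun h => hc.2 ?_⟩
    have h1 : ∀ t, shift^[t] (shift c) = shift c := fun t => Function.iterate_fixed h t
    have h2 : shift^[p ^ n] c = c := isPeriodicPt_shift.2 hc.1
    obtain ⟨q, hq⟩ : ∃ q, p ^ n = q + 1 := ⟨p ^ n - 1, by have := hpos n; omega⟩
    rw [hq, Function.iterate_succ_apply, h1] at h2
    exact h2
  · exact fun c hc => ⟨p ^ n, hpos n, isPeriodicPt_shift.2 (hnc.1 hc).1⟩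
  · intro c hc
    rw [hnc] at hc
    obtain ⟨s, -, hs⟩ := (Nat.dvd_prime_pow hp.out).1
      (Function.IsPeriodicPt.minimalPeriod_dvd (isPeriodicPt_shift.2 hc.1))
    have hs0 : 1 ≤ s := by
      by_contra h
      have : s = 0 := by omega
      rw [this, pow_zero, Function.minimalPeriod_eq_one_iff_isFixedPt] at hs
      exact hc.2 hs
    have hcs : Function.Periodic c (p ^ s) :=
      isPeriodicPt_shift.1 (hs ▸ Function.isPeriodicPt_minimalPeriod shift c)
    -- The tensor ω is one minimal period of the word.
    obtain ⟨ω, hω⟩ := exists_hom_eq_word ζ c (N := p ^ s) (l := p ^ (i + s))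
      (by rw [pow_add, mul_comm])
    -- A shift by t letters is a rotation by p^i t places, so the p^s shifts and the p^i rotations
    -- in `F` together run over the p^(i+s) rotations of the transfer for place i + s.
    have key : ∑ t ∈ Finset.range (p ^ s), F (shift^[t] c) =
        gvec p n (i + s) (QuotientAddGroup.mk' (balRel R M _) ω) := by
      funext j
      rw [Finset.sum_apply, gvec_mk, hω]
      by_cases hj : i + s ≤ j
      · have hij : i ≤ j := by omega
        have hsplit : p ^ ((j : ℕ) - i) = p ^ ((j : ℕ) - (i + s)) * p ^ s := by
          rw [← pow_add]; congr 1; omega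
        have hcj : Function.Periodic c (p ^ ((j : ℕ) - i)) := by
          rw [hsplit]; exact hcs.nat_mul _
        rw [if_pos hj, pow_add p i s, sum_range_mul_eq]
        refine Finset.sum_congr rfl fun t _ => ?_
        rw [show F (shift^[t] c) j = _ from if_pos ⟨hij, Periodic.shift_iterate hcj t⟩]
        refine Finset.sum_congr rfl fun t' _ => ?_
        rw [cycComp_word_shift_iterate R (hpos _) (pow_sub_mul_pow' hij) ζ hcj,
          ← Function.iterate_add_apply, hsplit, word_mul_of_periodic _ hcs]
      · rw [if_neg hj]
        refine Finset.sum_eq_zero fun t _ => if_neg ?_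
        -- For j < i + s the minimal period p^s does not divide p^(j-i), so both sides are 0.
        rintro ⟨hij, hper⟩
        have h1 : Function.IsPeriodicPt shift (p ^ ((j : ℕ) - i)) (shift^[t] c) :=
          isPeriodicPt_shift.2 hper
        have h2 := Function.IsPeriodicPt.minimalPeriod_dvd h1
        rw [Function.minimalPeriod_apply_iterate
          ⟨p ^ n, hpos n, isPeriodicPt_shift.2 hc.1⟩, hs,
          Nat.pow_dvd_pow_iff_le_right hp.out.one_lt] at h2
        omega
    rw [hs, key]
    exact gvec_mem_ghostFil (by omega) _

end Ghost

/-! ### Moving scalars and rotating inside powers of elementary tensors. -/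

section Slide

variable (R : Type u) {M : Type v} [Ring R] [AddCommGroup M] [Module R M] [Module Rᵐᵒᵖ M]

/-- The class of an elementary tensor in the cyclic tensor power. -/
def cycElem {k : ℕ} (m : Fin k → M) : Cyc R M k :=
  QuotientAddGroup.mk' (cycRel R M k) (PiTensorProduct.tprod ℤ m)

theorem cycElem_update {k : ℕ} (m : Fin k → M) {i j : Fin k} (h : finRotate k i = j) (r : R) :
    cycElem R (Function.update m i (MulOpposite.op r • m i)) =
      cycElem R (Function.update m j (r • m j)) := by
  rw [← sub_eq_zero, cycElem, cycElem, ← map_sub]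
  exact (QuotientAddGroup.eq_zero_iff _).2 (AddSubgroup.subset_closure ⟨m, i, j, r, h, rfl⟩)

variable {R}

theorem cycElem_smul [SMulCommClass R Rᵐᵒᵖ M] {k : ℕ} (r : Fin k → R) (m : Fin k → M) :
    cycElem R (fun l => r l • m l) =
      cycElem R (fun l => MulOpposite.op (r (finRotate k l)) • m l) := by
  classical
  -- J is the set of places whose left scalar has already been passed to the right of the preceding
  -- factor; each insertion uses one relation.
  have main : ∀ J : Finset (Fin k), cycElem R (fun l => r l • m l) =
      cycElem R (fun l => MulOpposite.op (if finRotate k l ∈ J then r (finRotate k l) else 1) •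
        (if l ∈ J then 1 else r l) • m l) := by
    intro J
    induction J using Finset.induction_on with
    | empty => simp
    | insert j J hj ih =>
      rw [ih]
      obtain ⟨i, rfl⟩ := (finRotate k).surjective j
      let m' : Fin k → M := fun l =>
        MulOpposite.op (if finRotate k l ∈ J then r (finRotate k l) else 1) •
        (if l ∈ insert (finRotate k i) J then 1 else r l) • m l
      have := cycElem_update R m' (i := i) rfl (r (finRotate k i))
      refine (Eq.trans ?_ this.symm).trans ?_
      · congr 1
        funext l
        by_cases hl : l = finRotate k i
        · subst hl
          rw [Function.update_self]
          simp only [m', hj, Finset.mem_insert_self, if_true, if_false, one_smul]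
          exact (smul_comm _ _ _).symm
        · rw [Function.update_of_ne hl]
          simp only [m', Finset.mem_insert, hl, false_or]
      · congr 1
        funext l
        by_cases hl : l = i
        · subst hl
          rw [Function.update_self]
          simp only [m', hj, Finset.mem_insert_self, if_true, if_false, MulOpposite.op_one,
            one_smul]
        · rw [Function.update_of_ne hl]
          have : finRotate k l ≠ finRotate k i := fun e => hl ((finRotate k).injective e)
          simp only [m', Finset.mem_insert, this, false_or]
  simpa using main Finset.univ

theorem hom_tprod_eq_etens {k : ℕ} (hk : 0 < k) (m : Fin k → M) :
    hom k (PiTensorProduct.tprod ℤ m) = etens k (perExt hk m) := by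
  unfold etens
  congr 2
  funext l
  rw [perExt_of_lt hk m l.2]

theorem hom_tprod_pow {k : ℕ} (hk : 0 < k) (m : Fin k → M) (N : ℕ) :
    hom k (PiTensorProduct.tprod ℤ m) ^ N = etens (N * k) (perExt hk m) := by
  rw [hom_tprod_eq_etens hk, etens_mul_of_periodic (perExt_periodic hk m)]

theorem perExt_succ {κ : Type*} {k : ℕ} (hk : 0 < k) (r : Fin k → κ) (x : ℕ) :
    perExt hk r (x + 1) = perExt hk (fun l => r (finRotate k l)) x := by
  have hx : x % k < k := Nat.mod_lt _ hk
  rw [← (perExt_periodic hk (fun l => r (finRotate k l))).map_mod_nat x, perExt_of_lt hk _ hx]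
  have := apply_finRotate_of_periodic (perExt_periodic hk r) ⟨x % k, hx⟩
  rw [perExt_of_lt hk r (Fin.is_lt _)] at this
  rw [show (r (finRotate k ⟨x % k, hx⟩)) = _ from this, ← (perExt_periodic hk r).map_mod_nat (x + 1),
    ← (perExt_periodic hk r).map_mod_nat (x % k + 1)]
  simp

/-- The N copies must be treated simultaneously: the last scalar of one copy passes to the first
factor of the next. Taking a whole family of scalars makes the extension to N k places periodic, so
`cycElem_smul` moves everything at once. -/
theorem cycComp_pow_smul [SMulCommClass R Rᵐᵒᵖ M] {k l : ℕ} (hk : 0 < k) (N : ℕ) (h : N * k = l)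
    (r : Fin k → R) (m : Fin k → M) :
    cycComp R l (hom k (PiTensorProduct.tprod ℤ fun x => r x • m x) ^ N) =
      cycComp R l (hom k (PiTensorProduct.tprod ℤ
        fun x => MulOpposite.op (r (finRotate k x)) • m x) ^ N) := by
  subst h
  rw [hom_tprod_pow hk, hom_tprod_pow hk, etens, etens, cycComp_hom, cycComp_hom]
  refine (cycElem_smul (fun x : Fin (N * k) => perExt hk r x) (fun x => perExt hk m x)).trans ?_
  unfold cycElem
  congr 2
  funext x
  rw [apply_finRotate_of_periodic (k := N * k) ((perExt_periodic hk r).nat_mul N), perExt_succ]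
  rfl

theorem cycComp_pow_rotZ {k l : ℕ} (hk : 0 < k) (N : ℕ) (h : N * k = l) (m : Fin k → M) :
    cycComp R l (hom k (rotZ M k (PiTensorProduct.tprod ℤ m)) ^ N) =
      Cyc.rot R M l (cycComp R l (hom k (PiTensorProduct.tprod ℤ m) ^ N)) := by
  subst h
  rw [rotZ_tprod, hom_tprod_pow hk, hom_tprod_pow hk,
    ← rot_cycComp_etens R (k := N * k) ((perExt_periodic hk _).nat_mul N)]
  simp only [perExt_succ, Equiv.symm_apply_apply]

end Slide

/-! ### The filtration of ghost vectors by position. -/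

section Ghost

variable {R : Type u} {M : Type v} [Ring R] [AddCommGroup M] [Module R M] [Module Rᵐᵒᵖ M]

/-- Rotating x shifts the summation range of the transfer by one, and the power of x is fixed by
rot^(p^i). -/
theorem gvec_rotZ {p : ℕ} (hp : 0 < p) (n i : ℕ) (m : Fin (p ^ i) → M) :
    gvec p n i (QuotientAddGroup.mk' (balRel R M _) (rotZ M _ (PiTensorProduct.tprod ℤ m))) =
      gvec p n i (elem R m) := by
  funext j
  rw [elem, gvec_mk, gvec_mk]
  split_ifs with h
  · rw [cycComp_pow_rotZ (pow_pos hp i) _ (pow_sub_mul_pow' h)]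
    set w := cycComp R (p ^ (j : ℕ)) (hom (p ^ i) (PiTensorProduct.tprod ℤ m) ^ p ^ ((j : ℕ) - i))
    have hw : (Cyc.rot R M (p ^ (j : ℕ)))^[p ^ i] w = w :=
      rot_iterate_cycComp_pow R _ (pow_pos hp _) (pow_sub_mul_pow' h) _
    -- The sum with one extra term is evaluated by splitting off its last term and, next, its first;
    -- the two terms agree by `hw`.
    have h1 := Finset.sum_range_succ (fun t => (Cyc.rot R M (p ^ (j : ℕ)))^[t] w) (p ^ i)
    rw [Finset.sum_range_succ', hw] at h1
    simpa using h1
  · rfl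

theorem gvec_update [SMulCommClass R Rᵐᵒᵖ M] {p : ℕ} (hp : 0 < p) (n i : ℕ) (m : Fin (p ^ i) → M) {a b : Fin (p ^ i)}
    (h : finRotate _ a = b) (r : R) :
    gvec p n i (elem R (Function.update m a (MulOpposite.op r • m a))) =
      gvec p n i (elem R (Function.update m b (r • m b))) := by
  have ha : Function.update m a (MulOpposite.op r • m a) = fun l =>
      MulOpposite.op (if finRotate _ l = b then r else 1) • m l := by
    funext l
    by_cases hl : l = a
    · subst hl; rw [Function.update_self, if_pos h]
    · rw [Function.update_of_ne hl, if_neg fun e => hl ((finRotate _).injective (e.trans h.symm)),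
        MulOpposite.op_one, one_smul]
  have hb : Function.update m b (r • m b) = fun l => (if l = b then r else 1) • m l := by
    funext l
    by_cases hl : l = b
    · subst hl; rw [Function.update_self, if_pos rfl]
    · rw [Function.update_of_ne hl, if_neg hl, one_smul]
  rw [ha, hb]
  funext j
  rw [elem, elem, gvec_mk, gvec_mk]
  split_ifs with h
  · rw [cycComp_pow_smul (pow_pos hp i) _ (pow_sub_mul_pow' h)]
  · rfl

theorem tens_toCoinv_eq_zero {k : ℕ} {ξ : ⨂[ℤ]^k M}
    (h : Tens.toCoinv R M k (QuotientAddGroup.mk' (balRel R M k) ξ) = 0) :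
    ∃ ξ' : ⨂[ℤ]^k M, ξ - (rotZ M k ξ' - ξ') ∈ cycRel R M k := by
  have h1 : QuotientAddGroup.mk' (cycRel R M k) ξ ∈
      (Cyc.rot R M k - AddMonoidHom.id _).range := (QuotientAddGroup.eq_zero_iff _).1 h
  obtain ⟨y, hy⟩ := h1
  obtain ⟨ξ', rfl⟩ := QuotientAddGroup.mk'_surjective _ y
  refine ⟨ξ', (QuotientAddGroup.eq_zero_iff _).1 ?_⟩
  have : QuotientAddGroup.mk' (cycRel R M k) (rotZ M k ξ' - ξ') =
      QuotientAddGroup.mk' (cycRel R M k) ξ := by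
    rw [map_sub]; exact hy
  change QuotientAddGroup.mk' (cycRel R M k) (ξ - (rotZ M k ξ' - ξ')) = 0
  rw [map_sub, this, sub_self]

variable (R M) in
/-- The class of the contribution of an entry in position `i`, modulo those of later positions. -/
def gvecHom (p : ℕ) [Fact p.Prime] (n i : ℕ) :
    Tens R M (p ^ i) →+ GhostTarget R M p n ⧸ ghostFil R M p n (i + 1) :=
  AddMonoidHom.mk' (fun x => QuotientAddGroup.mk' _ (gvec p n i x)) fun x y => by
    rw [← map_add, ← sub_eq_zero, ← map_sub, ← sub_sub]
    exact (QuotientAddGroup.eq_zero_iff _).2 (gvec_add_sub_mem n i x y)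

/-- On elementary tensors `gvec` respects the cyclic relations and rotation exactly, but it is
additive only modulo the next step. So the argument runs through the homomorphism `gvecHom`. -/
theorem gvec_mem_of_toCoinv_eq_zero [SMulCommClass R Rᵐᵒᵖ M] {p : ℕ} [hp : Fact p.Prime] (n i : ℕ) {x : Tens R M (p ^ i)}
    (hx : Tens.toCoinv R M _ x = 0) : gvec p n i x ∈ ghostFil R M p n (i + 1) := by
  obtain ⟨ξ, rfl⟩ := QuotientAddGroup.mk'_surjective _ x
  obtain ⟨ξ', hξ⟩ := tens_toCoinv_eq_zero hx
  let ψ := (gvecHom R M p n i).comp (QuotientAddGroup.mk' (balRel R M _))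
  have hrel : cycRel R M (p ^ i) ≤ ψ.ker := by
    refine (AddSubgroup.closure_le _).2 ?_
    rintro _ ⟨m, a, b, r, h, rfl⟩
    change ψ _ = 0
    rw [map_sub, sub_eq_zero]
    exact congrArg (QuotientAddGroup.mk' _) (gvec_update hp.out.pos n i m h r)
  have hrot : ∀ ζ, ψ (rotZ M _ ζ) = ψ ζ := fun ζ => by
    induction ζ using PiTensorProduct.induction_on with
    | smul_tprod c m =>
      rw [map_zsmul, map_zsmul, map_zsmul]
      congr 1
      exact congrArg (QuotientAddGroup.mk' _) (gvec_rotZ hp.out.pos n i m)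
    | add x y hx hy => rw [map_add, map_add, map_add, hx, hy]
  have h1 : ψ (ξ - (rotZ M _ ξ' - ξ')) = 0 := hrel hξ
  rw [map_sub, map_sub, hrot, sub_self, sub_zero] at h1
  exact (QuotientAddGroup.eq_zero_iff _).1 h1

/-- The range of `gvecHom` is a subgroup, and the generators in later positions have class zero. -/
theorem exists_sub_gvec_mem {p : ℕ} [hp : Fact p.Prime] {n i : ℕ} {g : GhostTarget R M p n}
    (hg : g ∈ ghostFil R M p n i) :
    ∃ x : Tens R M (p ^ i), g - gvec p n i x ∈ ghostFil R M p n (i + 1) := by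
  suffices QuotientAddGroup.mk' (ghostFil R M p n (i + 1)) g ∈ (gvecHom R M p n i).range by
    obtain ⟨x, hx⟩ := this
    refine ⟨x, (QuotientAddGroup.eq_zero_iff _).1 ?_⟩
    exact (map_sub (QuotientAddGroup.mk' (ghostFil R M p n (i + 1))) _ _).trans
      (sub_eq_zero.2 hx.symm)
  suffices ghostFil R M p n i ≤ ((gvecHom R M p n i).range).comap (QuotientAddGroup.mk' _) from
    this hg
  refine (AddSubgroup.closure_le _).2 ?_
  rintro _ ⟨l, x, hl, rfl⟩
  rcases eq_or_lt_of_le hl with rfl | hl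
  · exact ⟨x, rfl⟩
  · have : QuotientAddGroup.mk' (ghostFil R M p n (i + 1)) (gvec p n l x) = 0 :=
      (QuotientAddGroup.eq_zero_iff _).2 (gvec_mem_ghostFil hl x)
    change QuotientAddGroup.mk' (ghostFil R M p n (i + 1)) (gvec p n l x) ∈ (gvecHom R M p n i).range
    rw [this]
    exact zero_mem _

theorem ghostFil_eq_bot {p n i : ℕ} (h : n ≤ i) : ghostFil R M p n i = ⊥ := by
  rw [eq_bot_iff]
  refine (AddSubgroup.closure_le _).2 ?_
  rintro _ ⟨l, x, hl, rfl⟩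
  exact gvec_eq_zero_of_le (h.trans hl) x

theorem ghost_update {p : ℕ} (hp : 0 < p) {n : ℕ} (m : Tuple R M p n) (i : Fin n) (hi : m i = 0)
    (x : Tens R M (p ^ (i : ℕ))) :
    ghost (Function.update m i x) = ghost m + gvec p n i x := by
  rw [ghost_eq_sum, ghost_eq_sum]
  have h1 : (fun l : Fin n => gvec p n l (Function.update m i x l)) =
      Function.update (fun l : Fin n => gvec p n l (m l)) i (gvec p n i x) := by
    funext l
    exact Function.apply_update (fun (l : Fin n) y => gvec p n l y) m i x l
  rw [h1, Finset.sum_update_of_mem (Finset.mem_univ i), add_comm, add_left_inj,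
    ← Finset.sum_sdiff (Finset.subset_univ {i}), Finset.sum_singleton, hi, gvec_zero hp, add_zero]

theorem ghost_zero {p : ℕ} (hp : 0 < p) {n : ℕ} : ghost (0 : Tuple R M p n) = 0 := by
  rw [ghost_eq_sum]
  exact Finset.sum_eq_zero fun i _ => gvec_zero hp n i

theorem ghost_single {p : ℕ} (hp : 0 < p) {n : ℕ} (i : Fin n) (x : Tens R M (p ^ (i : ℕ))) :
    ghost (Pi.single i x : Tuple R M p n) = gvec p n i x := by
  have := ghost_update hp (0 : Tuple R M p n) i rfl x
  rwa [ghost_zero hp, zero_add] at this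

/-- Peeling off one position at a time. In particular the image of the ghost map is a subgroup, on
which sums and differences of ghost vectors can be realised by tuples. -/
theorem exists_ghost_eq {p : ℕ} [hp : Fact p.Prime] {n i : ℕ} {g : GhostTarget R M p n}
    (hg : g ∈ ghostFil R M p n i) :
    ∃ m : Tuple R M p n, (∀ l : Fin n, (l : ℕ) < i → m l = 0) ∧ ghost m = g := by
  -- The induction is on the distance from i to n, beyond which the filtration is zero.
  obtain ⟨d, hd⟩ : ∃ d, n ≤ i + d := ⟨n, Nat.le_add_left n i⟩
  induction d generalizing i g with
  | zero =>
    rw [ghostFil_eq_bot (by omega)] at hg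
    exact ⟨0, fun _ _ => rfl, by rw [ghost_zero hp.out.pos, AddSubgroup.mem_bot.1 hg]⟩
  | succ d ih =>
    obtain ⟨x, hx⟩ := exists_sub_gvec_mem hg
    obtain ⟨m, hm, hgm⟩ := ih hx (by omega)
    by_cases hi : i < n
    · refine ⟨Function.update m ⟨i, hi⟩ x, fun l hl => ?_, ?_⟩
      · rw [Function.update_of_ne (fun e => by rw [e] at hl; exact lt_irrefl _ hl)]
        exact hm l (by omega)
      · rw [ghost_update hp.out.pos m ⟨i, hi⟩ (hm _ (Nat.lt_succ_self i)), hgm, sub_add_cancel]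
    · rw [gvec_eq_zero_of_le (by omega), sub_zero] at hgm
      exact ⟨m, fun l hl => hm l (by omega), hgm⟩

theorem ghost_mem_ghostFil {p : ℕ} (hp : 0 < p) {n i : ℕ} {m : Tuple R M p n}
    (hm : ∀ l : Fin n, (l : ℕ) < i → m l = 0) : ghost m ∈ ghostFil R M p n i := by
  rw [ghost_eq_sum]
  refine sum_mem fun l _ => ?_
  by_cases hl : (l : ℕ) < i
  · rw [hm l hl, gvec_zero hp]; exact zero_mem _
  · exact gvec_mem_ghostFil (not_lt.1 hl) _

theorem apply_eq_zero_of_mem_ghostFil {p n i : ℕ} {g : GhostTarget R M p n}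
    (hg : g ∈ ghostFil R M p n i) (j : Fin n) (hj : (j : ℕ) < i) : g j = 0 := by
  suffices ghostFil R M p n i ≤ (Pi.evalAddMonoidHom (fun j : Fin n => Cyc R M (p ^ (j : ℕ))) j).ker
    from this hg
  refine (AddSubgroup.closure_le _).2 ?_
  rintro _ ⟨l, x, hl, rfl⟩
  exact dif_neg (by omega)

theorem gvec_apply_self (p n : ℕ) (i : Fin n) (x : Tens R M (p ^ (i : ℕ))) :
    gvec p n i x i = ∑ t ∈ Finset.range (p ^ (i : ℕ)), (Cyc.rot R M (p ^ (i : ℕ)))^[t]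
      (Tens.toCyc R M _ x) := by
  obtain ⟨ξ, rfl⟩ := QuotientAddGroup.mk'_surjective _ x
  rw [gvec_mk, if_pos le_rfl]
  simp only [Nat.sub_self, pow_zero, pow_one, toCyc_mk]

theorem coinv_mk_rot_iterate {k : ℕ} (t : ℕ) (y : Cyc R M k) :
    (QuotientAddGroup.mk' _ ((Cyc.rot R M k)^[t] y) : Coinv R M k) = QuotientAddGroup.mk' _ y := by
  induction t with
  | zero => rfl
  | succ t ih =>
    rw [Function.iterate_succ_apply', ← ih, ← sub_eq_zero, ← map_sub]
    exact (QuotientAddGroup.eq_zero_iff _).2 ⟨(Cyc.rot R M k)^[t] y, rfl⟩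

/-- The component in place i is the norm of x under C_{p^i}, whose class in the coinvariants is p^i
times that of x. -/
theorem toCoinv_eq_zero_of_gvec_apply_self {p n : ℕ}
    (htf : ∀ (i : ℕ) (x : Coinv R M (p ^ i)), p ^ i • x = 0 → x = 0) (i : Fin n)
    {x : Tens R M (p ^ (i : ℕ))} (hx : gvec p n i x i = 0) : Tens.toCoinv R M _ x = 0 := by
  apply htf i
  rw [gvec_apply_self] at hx
  have := congrArg (QuotientAddGroup.mk' (Cyc.rot R M (p ^ (i : ℕ)) - AddMonoidHom.id _).range) hx
  rw [map_sum, map_zero] at this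
  simp only [coinv_mk_rot_iterate, Finset.sum_const, Finset.card_range] at this
  exact this

/-- A converse to `apply_eq_zero_of_mem_ghostFil`. The leading term of g is a vanishing norm, hence
comes from a tensor that is zero in the torsion-free coinvariants, and such a term belongs to the
next step. -/
theorem mem_ghostFil_of_apply_eq_zero [SMulCommClass R Rᵐᵒᵖ M] {p : ℕ} [hp : Fact p.Prime] {n : ℕ}
    (htf : ∀ (i : ℕ) (x : Coinv R M (p ^ i)), p ^ i • x = 0 → x = 0) (i : ℕ)
    {g : GhostTarget R M p n} (hg : g ∈ ghostFil R M p n 0)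
    (h : ∀ j : Fin n, (j : ℕ) < i → g j = 0) : g ∈ ghostFil R M p n i := by
  induction i with
  | zero => exact hg
  | succ i ih =>
    have hi := ih fun j hj => h j (by omega)
    obtain ⟨x, hx⟩ := exists_sub_gvec_mem hi
    have hgx : gvec p n i x ∈ ghostFil R M p n (i + 1) := by
      by_cases hin : i < n
      · refine gvec_mem_of_toCoinv_eq_zero n i
          (toCoinv_eq_zero_of_gvec_apply_self htf ⟨i, hin⟩ ?_)
        have := apply_eq_zero_of_mem_ghostFil hx ⟨i, hin⟩ (Nat.lt_succ_self i)
        rw [Pi.sub_apply, h _ (Nat.lt_succ_self i), zero_sub, neg_eq_zero] at this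
        exact this
      · rw [gvec_eq_zero_of_le (by omega)]; exact zero_mem _
    simpa using add_mem hx hgx

end Ghost

/-! ## Functoriality of the ghost map -/

section Functoriality

variable {A : Bimod.{u, v}} {B : Bimod.{u₁, v₁}}

theorem smul_tmulZ_smul {M : Type w} [AddCommGroup M] {k l : ℕ} (c d : ℤ) (x : ⨂[ℤ]^k M)
    (y : ⨂[ℤ]^l M) : tmulZ (c • x) (d • y) = c • d • tmulZ x y := by
  simp only [tmulZ_eq, map_smul, LinearMap.smul_apply]
  exact smul_comm _ _ _

theorem tmulZ_add {M : Type w} [AddCommGroup M] {k l : ℕ} (x : ⨂[ℤ]^k M) (y z : ⨂[ℤ]^l M) :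
    tmulZ x (y + z) = tmulZ x y + tmulZ x z := by
  simp only [tmulZ_eq, map_add]

theorem add_tmulZ {M : Type w} [AddCommGroup M] {k l : ℕ} (x z : ⨂[ℤ]^k M) (y : ⨂[ℤ]^l M) :
    tmulZ (x + z) y = tmulZ x y + tmulZ z y := by
  simp only [tmulZ_eq, map_add, LinearMap.add_apply]

theorem mapZ_tmulZ (f : A.M →+ B.M) {k l : ℕ} (x : ⨂[ℤ]^k A.M) (y : ⨂[ℤ]^l A.M) :
    mapZ f (k + l) (tmulZ x y) = tmulZ (mapZ f k x) (mapZ f l y) := by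
  induction x using PiTensorProduct.induction_on with
  | smul_tprod c a =>
    induction y using PiTensorProduct.induction_on with
    | smul_tprod d b =>
      rw [smul_tmulZ_smul, map_zsmul, map_zsmul, map_zsmul, map_zsmul, smul_tmulZ_smul,
        tmulZ_tprod, mapZ_tprod, mapZ_tprod, mapZ_tprod, tmulZ_tprod]
      congr 4
      funext t
      refine Fin.addCases (fun s => ?_) (fun s => ?_) t <;> simp
    | add y z hy hz => rw [tmulZ_add, map_add, map_add, tmulZ_add, hy, hz]
  | add x z hx hz => rw [add_tmulZ, map_add, map_add, add_tmulZ, hx, hz]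

/-- The ring homomorphism between tensor rings induced by an additive map. -/
def mapTRing (f : A.M →+ B.M) : TRing A.M →+* TRing B.M :=
  DirectSum.toSemiring (fun k => (hom k).comp (mapZ f k))
    (by
      refine (congrArg (hom 0) (mapZ_tprod f _)).trans ?_
      exact congrArg (hom 0) (congrArg _ (Subsingleton.elim _ _)))
    (fun {k l} x y => by
      change hom (k + l) (mapZ f (k + l) (tmulZ x y)) = hom k (mapZ f k x) * hom l (mapZ f l y)
      rw [mapZ_tmulZ, hom_mul])

theorem mapTRing_hom (f : A.M →+ B.M) (k : ℕ) (x : ⨂[ℤ]^k A.M) :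
    mapTRing f (hom k x) = hom k (mapZ f k x) :=
  DirectSum.toAddMonoid_of _ _ _

/-- Compared in the tensor ring, where the induced map is a ring homomorphism. -/
theorem mapZ_powZ (f : A.M →+ B.M) {k l : ℕ} (N : ℕ) (h : N * k = l) (x : ⨂[ℤ]^k A.M) :
    mapZ f l (powZ N h x) = powZ N h (mapZ f k x) := by
  apply hom_injective
  rw [← mapTRing_hom, hom_powZ, map_pow, mapTRing_hom, hom_powZ]

theorem mapZ_rotZ (f : A.M →+ B.M) (k : ℕ) (x : ⨂[ℤ]^k A.M) :
    mapZ f k (rotZ A.M k x) = rotZ B.M k (mapZ f k x) := by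
  induction x using PiTensorProduct.induction_on with
  | smul_tprod c a => simp only [map_zsmul, rotZ_tprod, mapZ_tprod]
  | add x y hx hy => simp only [map_add, hx, hy]

theorem mapZ_update_sub (f : Hom A B) {k : ℕ} (m : Fin k → A.M) (i j : Fin k) (r : A.R) :
    mapZ f.addHom k (PiTensorProduct.tprod ℤ (Function.update m i (MulOpposite.op r • m i)) -
      PiTensorProduct.tprod ℤ (Function.update m j (r • m j))) =
    PiTensorProduct.tprod ℤ (Function.update (fun l => f.addHom (m l)) i
        (MulOpposite.op (f.ringHom r) • f.addHom (m i))) -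
      PiTensorProduct.tprod ℤ (Function.update (fun l => f.addHom (m l)) j
        (f.ringHom r • f.addHom (m j))) := by
  have key : ∀ (a : Fin k) (y : A.M), (fun l => f.addHom (Function.update m a y l)) =
      Function.update (fun l => f.addHom (m l)) a (f.addHom y) := by
    intro a y
    funext l
    exact Function.apply_update (fun _ z => f.addHom z) m a y l
  rw [map_sub, mapZ_tprod, mapZ_tprod, key, key, f.map_left, f.map_right]

theorem cycRel_le_comap_mapZ (f : Hom A B) (k : ℕ) :
    cycRel A.R A.M k ≤ (cycRel B.R B.M k).comap (mapZ f.addHom k) := by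
  refine (AddSubgroup.closure_le _).2 ?_
  rintro x ⟨m, i, j, r, h, rfl⟩
  exact AddSubgroup.subset_closure ⟨fun l => f.addHom (m l), i, j, f.ringHom r, h,
    mapZ_update_sub f m i j r⟩

/-- The map induced on cyclic tensor powers. -/
def Cyc.map (f : Hom A B) (k : ℕ) : Cyc A.R A.M k →+ Cyc B.R B.M k :=
  QuotientAddGroup.map _ _ (mapZ f.addHom k) (cycRel_le_comap_mapZ f k)

theorem Cyc.map_rot (f : Hom A B) (k : ℕ) (y : Cyc A.R A.M k) :
    Cyc.map f k (Cyc.rot A.R A.M k y) = Cyc.rot B.R B.M k (Cyc.map f k y) := by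
  obtain ⟨ξ, rfl⟩ := QuotientAddGroup.mk'_surjective _ y
  exact congrArg (QuotientAddGroup.mk' (cycRel B.R B.M k)) (mapZ_rotZ f.addHom k ξ)

theorem Cyc.map_rot_iterate (f : Hom A B) (k t : ℕ) (y : Cyc A.R A.M k) :
    Cyc.map f k ((Cyc.rot A.R A.M k)^[t] y) = (Cyc.rot B.R B.M k)^[t] (Cyc.map f k y) :=
  (Function.Semiconj.iterate_right (f := Cyc.map f k) (Cyc.map_rot f k) t) y

theorem Cyc.map_toCyc_pow (f : Hom A B) {k l : ℕ} (N : ℕ) (h : N * k = l) (x : A.tens k) :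
    Cyc.map f l (Tens.toCyc A.R A.M l (Tens.pow A.R N h x)) =
      Tens.toCyc B.R B.M l (Tens.pow B.R N h (Tens.map f k x)) := by
  obtain ⟨ξ, rfl⟩ := QuotientAddGroup.mk'_surjective _ x
  exact congrArg (QuotientAddGroup.mk' (cycRel B.R B.M l)) (mapZ_powZ f.addHom N h ξ)

theorem Tens.map_elem (f : Hom A B) {k : ℕ} (m : Fin k → A.M) :
    Tens.map f k (elem A.R m) = elem B.R fun l => f.addHom (m l) :=
  congrArg (QuotientAddGroup.mk' (balRel B.R B.M k)) (mapZ_tprod f.addHom m)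

/-- The map induced on the targets of the ghost maps. -/
def GhostTarget.map (f : Hom A B) (p n : ℕ) : GhostTarget A.R A.M p n →+ GhostTarget B.R B.M p n :=
  AddMonoidHom.mk' (fun g j => Cyc.map f _ (g j)) fun _ _ => funext fun _ => map_add _ _ _

theorem GhostTarget.map_gvec (f : Hom A B) (p n i : ℕ) (x : A.tens (p ^ i)) :
    GhostTarget.map f p n (gvec p n i x) = gvec p n i (Tens.map f _ x) := by
  funext j
  change Cyc.map f _ (gvec p n i x j) = _
  unfold gvec
  split_ifs with h
  · simp only [map_sum, Cyc.map_rot_iterate, Cyc.map_toCyc_pow]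
  · exact map_zero _

theorem GhostTarget.map_ghost (f : Hom A B) {p n : ℕ} (m : Tuple A.R A.M p n) :
    GhostTarget.map f p n (ghost m) = ghost (Tuple.map f m) := by
  rw [ghost_eq_sum, ghost_eq_sum, map_sum]
  exact Finset.sum_congr rfl fun i _ => GhostTarget.map_gvec f p n i (m i)

theorem GhostTarget.map_mem_ghostFil (f : Hom A B) {p n i : ℕ} {g : GhostTarget A.R A.M p n}
    (hg : g ∈ ghostFil A.R A.M p n i) : GhostTarget.map f p n g ∈ ghostFil B.R B.M p n i := by
  suffices ghostFil A.R A.M p n i ≤ (ghostFil B.R B.M p n i).comap (GhostTarget.map f p n) from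
    this hg
  refine (AddSubgroup.closure_le _).2 ?_
  rintro _ ⟨l, x, hl, rfl⟩
  change GhostTarget.map f p n (gvec p n l x) ∈ ghostFil B.R B.M p n i
  rw [GhostTarget.map_gvec]
  exact gvec_mem_ghostFil hl _

end Functoriality

/-! ### Truncation of ghost vectors. -/

section Truncation

variable (R : Type u) (M : Type v) [Ring R] [AddCommGroup M] [Module R M] [Module Rᵐᵒᵖ M]

/-- The restriction to the first components of the target of the ghost map. -/
def GhostTarget.trunc (p : ℕ) {n N : ℕ} (h : n ≤ N) :
    GhostTarget R M p N →+ GhostTarget R M p n :=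
  AddMonoidHom.mk' (fun g j => g (Fin.castLE h j)) fun _ _ => rfl

/-- Generators truncate to generators with the same position and entry, as the position l is not
bounded by the length. The equality also lets ghost vectors be lifted to greater length. -/
theorem ghostFil_map_trunc (p : ℕ) {n N : ℕ} (h : n ≤ N) (i : ℕ) :
    (ghostFil R M p N i).map (GhostTarget.trunc R M p h) = ghostFil R M p n i := by
  rw [ghostFil, AddMonoidHom.map_closure, ghostFil]
  congr 1
  ext g
  constructor
  · rintro ⟨_, ⟨l, x, hl, rfl⟩, rfl⟩
    exact ⟨l, x, hl, rfl⟩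
  · rintro ⟨l, x, hl, rfl⟩
    exact ⟨_, ⟨l, x, hl, rfl⟩, rfl⟩

end Truncation

/-! ## Tensor powers of a free resolution -/

section Resolution

variable {A : Bimod.{u, v}} (ρ : FreeResolution.{u, v, u₁, v₁, u₂, v₂} A)

/-- A reflexive relation that is a subgroup is already an equivalence relation, through the Mal'cev
operation a + b - c; no generated closure is needed. -/
theorem FreeResolution.exists_of_eq {x y : ρ.S.M} (h : ρ.ε.addHom x = ρ.ε.addHom y) :
    ∃ z, ρ.f.addHom z = x ∧ ρ.g.addHom z = y := by
  have h' := ρ.coeq_add.2.2 x y h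
  clear h
  induction h' with
  | rel x y h => exact h
  | refl x => exact ⟨ρ.sec.addHom x, ρ.f_sec_add x, ρ.g_sec_add x⟩
  | symm x y _ ih =>
    obtain ⟨z, rfl, rfl⟩ := ih
    refine ⟨ρ.sec.addHom (ρ.f.addHom z) + ρ.sec.addHom (ρ.g.addHom z) - z, ?_, ?_⟩
    · rw [map_sub, map_add, ρ.f_sec_add, ρ.f_sec_add]; abel
    · rw [map_sub, map_add, ρ.g_sec_add, ρ.g_sec_add]; abel
  | trans x y z _ _ ih1 ih2 =>
    obtain ⟨a, rfl, ha⟩ := ih1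
    obtain ⟨b, hb, rfl⟩ := ih2
    refine ⟨a + b - ρ.sec.addHom y, ?_, ?_⟩
    · rw [map_sub, map_add, ρ.f_sec_add, hb, add_sub_cancel_right]
    · rw [map_sub, map_add, ρ.g_sec_add, ha, add_sub_cancel_left]

theorem FreeResolution.mapZ_ε_surjective (k : ℕ) : Function.Surjective (mapZ ρ.ε.addHom k) := by
  intro y
  induction y using PiTensorProduct.induction_on with
  | smul_tprod c a =>
    choose b hb using fun l => ρ.coeq_add.2.1 (a l)
    refine ⟨c • PiTensorProduct.tprod ℤ b, ?_⟩
    rw [map_zsmul, mapZ_tprod]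
    simp only [hb]
  | add x y hx hy =>
    obtain ⟨x', rfl⟩ := hx
    obtain ⟨y', rfl⟩ := hy
    exact ⟨x' + y', map_add _ _ _⟩

theorem FreeResolution.tens_map_ε_surjective (k : ℕ) : Function.Surjective (Tens.map ρ.ε k) := by
  intro y
  obtain ⟨η, rfl⟩ := QuotientAddGroup.mk'_surjective _ y
  obtain ⟨ξ, rfl⟩ := ρ.mapZ_ε_surjective k η
  exact ⟨QuotientAddGroup.mk' _ ξ, rfl⟩

theorem FreeResolution.tens_map_ε_f {k : ℕ} (z : ρ.T.tens k) :
    Tens.map ρ.ε k (Tens.map ρ.f k z) = Tens.map ρ.ε k (Tens.map ρ.g k z) := by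
  obtain ⟨ζ, rfl⟩ := QuotientAddGroup.mk'_surjective _ z
  induction ζ using PiTensorProduct.induction_on with
  | smul_tprod c a =>
    simp only [map_zsmul]
    congr 1
    change Tens.map ρ.ε k (Tens.map ρ.f k (elem _ a)) = Tens.map ρ.ε k (Tens.map ρ.g k (elem _ a))
    simp only [Tens.map_elem]
    congr 1
    funext l
    exact ρ.coeq_add.1 (a l)
  | add x y hx hy => simp only [map_add, hx, hy]

theorem FreeResolution.tens_map_f_sec {k : ℕ} (z : ρ.S.tens k) :
    Tens.map ρ.f k (Tens.map ρ.sec k z) = z := by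
  obtain ⟨ζ, rfl⟩ := QuotientAddGroup.mk'_surjective _ z
  induction ζ using PiTensorProduct.induction_on with
  | smul_tprod c a =>
    simp only [map_zsmul]
    congr 1
    change Tens.map ρ.f k (Tens.map ρ.sec k (elem _ a)) = elem _ a
    simp only [Tens.map_elem, ρ.f_sec_add]
  | add x y hx hy => simp only [map_add, hx, hy]

theorem FreeResolution.tens_map_g_sec {k : ℕ} (z : ρ.S.tens k) :
    Tens.map ρ.g k (Tens.map ρ.sec k z) = z := by
  obtain ⟨ζ, rfl⟩ := QuotientAddGroup.mk'_surjective _ z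
  induction ζ using PiTensorProduct.induction_on with
  | smul_tprod c a =>
    simp only [map_zsmul]
    congr 1
    change Tens.map ρ.g k (Tens.map ρ.sec k (elem _ a)) = elem _ a
    simp only [Tens.map_elem, ρ.g_sec_add]
  | add x y hx hy => simp only [map_add, hx, hy]

/-- The subgroup of differences of the two images of a tensor. -/
def FreeResolution.tensDiff (k : ℕ) : AddSubgroup (ρ.S.tens k) :=
  (Tens.map ρ.f k - Tens.map ρ.g k).range

/-- The class of a tensor of lifts is independent of the lifts. This is what makes the set-theoretic
`lift` multilinear modulo `tensDiff`. -/
theorem FreeResolution.mk_elem_eq {k : ℕ} {q q' : Fin k → ρ.S.M}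
    (h : ∀ l, ρ.ε.addHom (q l) = ρ.ε.addHom (q' l)) :
    (QuotientAddGroup.mk' (ρ.tensDiff k) (elem ρ.S.R q)) =
      QuotientAddGroup.mk' (ρ.tensDiff k) (elem ρ.S.R q') := by
  choose z hf hg using fun l => ρ.exists_of_eq (h l)
  rw [← sub_eq_zero, ← map_sub]
  refine (QuotientAddGroup.eq_zero_iff _).2 ⟨elem ρ.T.R z, ?_⟩
  rw [AddMonoidHom.sub_apply, Tens.map_elem, Tens.map_elem]
  simp only [hf, hg]

/-- A lift of an element along the augmentation of a free resolution. -/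
def FreeResolution.lift (x : A.M) : ρ.S.M := Function.surjInv ρ.coeq_add.2.1 x

theorem FreeResolution.ε_lift (x : A.M) : ρ.ε.addHom (ρ.lift x) = x :=
  Function.surjInv_eq ρ.coeq_add.2.1 x

/-- A retraction of the augmentation on tensor powers, modulo differences. -/
def FreeResolution.liftMultilinear (k : ℕ) :
    MultilinearMap ℤ (fun _ : Fin k => A.M) (ρ.S.tens k ⧸ ρ.tensDiff k) where
  toFun m := QuotientAddGroup.mk' (ρ.tensDiff k) (elem ρ.S.R fun l => ρ.lift (m l))
  map_update_add' {dec} m i x y := by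
    obtain rfl : dec = instDecidableEqFin k := Subsingleton.elim _ _
    -- In the updated place the chosen lift may be replaced by any preimage, in particular by a sum
    -- of preimages.
    have h : ∀ z, QuotientAddGroup.mk' (ρ.tensDiff k)
        (elem ρ.S.R fun l => ρ.lift (Function.update m i (ρ.ε.addHom z) l)) =
        QuotientAddGroup.mk' (ρ.tensDiff k)
          (elem ρ.S.R (Function.update (fun l => ρ.lift (m l)) i z)) := fun z => by
      refine ρ.mk_elem_eq fun l => ?_
      by_cases hl : l = i
      · subst hl; simp [ρ.ε_lift]
      · simp [hl]
    obtain ⟨x, rfl⟩ := ρ.coeq_add.2.1 x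
    obtain ⟨y, rfl⟩ := ρ.coeq_add.2.1 y
    rw [← map_add, h, h, h, ← map_add]
    congr 1
    rw [elem, MultilinearMap.map_update_add, map_add]
    rfl
  map_update_smul' {dec} m i c x := by
    obtain rfl : dec = instDecidableEqFin k := Subsingleton.elim _ _
    have h : ∀ z, QuotientAddGroup.mk' (ρ.tensDiff k)
        (elem ρ.S.R fun l => ρ.lift (Function.update m i (ρ.ε.addHom z) l)) =
        QuotientAddGroup.mk' (ρ.tensDiff k)
          (elem ρ.S.R (Function.update (fun l => ρ.lift (m l)) i z)) := fun z => by
      refine ρ.mk_elem_eq fun l => ?_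
      by_cases hl : l = i
      · subst hl; simp [ρ.ε_lift]
      · simp [hl]
    obtain ⟨x, rfl⟩ := ρ.coeq_add.2.1 x
    rw [← map_zsmul, h, h, ← map_zsmul]
    congr 1
    rw [elem, MultilinearMap.map_update_smul, map_zsmul]
    rfl

theorem elem_update {R : Type u} {M : Type v} [Ring R] [AddCommGroup M] [Module R M]
    [Module Rᵐᵒᵖ M] {k : ℕ} (m : Fin k → M) {i j : Fin k} (h : (i : ℕ) + 1 = j) (r : R) :
    elem R (Function.update m i (MulOpposite.op r • m i)) =
      elem R (Function.update m j (r • m j)) := by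
  rw [← sub_eq_zero, elem, elem, ← map_sub]
  exact (QuotientAddGroup.eq_zero_iff _).2 (AddSubgroup.subset_closure ⟨m, i, j, r, h, rfl⟩)

/-- Tensor powers preserve the reflexive coequaliser. Lifting the factors gives a map L from tensors
of A to tensors of S modulo `tensDiff`; composed with ε it is the quotient map, so tensors with
equal image differ by an element of `tensDiff`. -/
theorem FreeResolution.exists_tens_of_eq {k : ℕ} {q u : ρ.S.tens k}
    (h : Tens.map ρ.ε k q = Tens.map ρ.ε k u) :
    ∃ z, Tens.map ρ.f k z = q ∧ Tens.map ρ.g k z = u := by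
  let L : (⨂[ℤ]^k A.M) →+ ρ.S.tens k ⧸ ρ.tensDiff k :=
    (PiTensorProduct.lift (ρ.liftMultilinear k)).toAddMonoidHom
  have hL : ∀ m : Fin k → ρ.S.M, L (PiTensorProduct.tprod ℤ fun l => ρ.ε.addHom (m l)) =
      QuotientAddGroup.mk' (ρ.tensDiff k) (elem ρ.S.R m) := fun m =>
    (PiTensorProduct.lift.tprod _).trans (ρ.mk_elem_eq fun l => ρ.ε_lift _)
  have hrel : balRel A.R A.M k ≤ L.ker := by
    refine (AddSubgroup.closure_le _).2 ?_
    rintro _ ⟨m, i, j, r, hij, rfl⟩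
    change L _ = 0
    choose m' hm' using fun l => ρ.coeq_add.2.1 (m l)
    obtain ⟨r, rfl⟩ := ρ.coeq_ring.2.1 r
    obtain rfl : (fun l => ρ.ε.addHom (m' l)) = m := funext hm'
    rw [← mapZ_update_sub ρ.ε m' i j r, map_sub, mapZ_tprod, mapZ_tprod, map_sub, hL, hL,
      elem_update m' hij, sub_self]
  have hret : ∀ x : ρ.S.tens k, QuotientAddGroup.lift (balRel A.R A.M k) L hrel (Tens.map ρ.ε k x) =
      QuotientAddGroup.mk' (ρ.tensDiff k) x := fun x => by
    obtain ⟨ξ, rfl⟩ := QuotientAddGroup.mk'_surjective _ x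
    induction ξ using PiTensorProduct.induction_on with
    | smul_tprod c a =>
      simp only [map_zsmul]
      congr 1
      change QuotientAddGroup.lift (balRel A.R A.M k) L hrel (Tens.map ρ.ε k (elem _ a)) =
        QuotientAddGroup.mk' (ρ.tensDiff k) (elem _ a)
      rw [Tens.map_elem, ← hL]
      rfl
    | add x y hx hy => simp only [map_add, hx, hy]
  have hqu : QuotientAddGroup.mk' (ρ.tensDiff k) (q - u) = 0 := by
    rw [map_sub, ← hret, ← hret, h, sub_self]
  obtain ⟨z, hz⟩ := (QuotientAddGroup.eq_zero_iff _).1 hqu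
  rw [AddMonoidHom.sub_apply] at hz
  -- Here z only satisfies f z - g z = q - u; the degenerate terms correct g z to u without changing
  -- the difference.
  refine ⟨Tens.map ρ.sec k u + z - Tens.map ρ.sec k (Tens.map ρ.g k z), ?_, ?_⟩
  · rw [map_sub, map_add, ρ.tens_map_f_sec, ρ.tens_map_f_sec, add_sub_assoc, hz]; abel
  · rw [map_sub, map_add, ρ.tens_map_g_sec, ρ.tens_map_g_sec, add_sub_cancel_right]

/-- Right exactness: scalars and factors lift along ε, hence so do the cyclic relations and the
rotation differences. -/
theorem FreeResolution.exists_toCoinv_eq_zero {k : ℕ} {x : A.tens k} (hx : A.proj k x = 0) :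
    ∃ x' : ρ.S.tens k, ρ.S.proj k x' = 0 ∧ Tens.map ρ.ε k x' = x := by
  obtain ⟨ξ, rfl⟩ := QuotientAddGroup.mk'_surjective _ x
  obtain ⟨ζ, hζ⟩ := tens_toCoinv_eq_zero hx
  obtain ⟨ζ', rfl⟩ := ρ.mapZ_ε_surjective k ζ
  have hrel : cycRel A.R A.M k ≤ (cycRel ρ.S.R ρ.S.M k).map (mapZ ρ.ε.addHom k) := by
    refine (AddSubgroup.closure_le _).2 ?_
    rintro _ ⟨m, i, j, r, hij, rfl⟩
    choose m' hm' using fun l => ρ.coeq_add.2.1 (m l)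
    obtain ⟨r, rfl⟩ := ρ.coeq_ring.2.1 r
    obtain rfl : (fun l => ρ.ε.addHom (m' l)) = m := funext hm'
    exact ⟨_, AddSubgroup.subset_closure ⟨m', i, j, r, hij, rfl⟩, mapZ_update_sub ρ.ε m' i j r⟩
  obtain ⟨θ, hθ, hθ'⟩ := hrel hζ
  refine ⟨QuotientAddGroup.mk' _ (θ + (rotZ ρ.S.M k ζ' - ζ')), ?_, ?_⟩
  · refine (QuotientAddGroup.eq_zero_iff _).2 ⟨QuotientAddGroup.mk' _ ζ', ?_⟩
    have h1 : QuotientAddGroup.mk' (cycRel ρ.S.R ρ.S.M k) θ = 0 :=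
      (QuotientAddGroup.eq_zero_iff _).2 hθ
    have h2 : Tens.toCyc ρ.S.R ρ.S.M k (QuotientAddGroup.mk' _ (θ + (rotZ ρ.S.M k ζ' - ζ'))) =
        QuotientAddGroup.mk' (cycRel ρ.S.R ρ.S.M k) (θ + (rotZ ρ.S.M k ζ' - ζ')) := rfl
    rw [h2, map_add, h1, zero_add, map_sub]
    rfl
  · refine congrArg (QuotientAddGroup.mk' (balRel A.R A.M k))
      (show mapZ ρ.ε.addHom k (θ + (rotZ ρ.S.M k ζ' - ζ')) = ξ from ?_)
    rw [map_add, map_sub, mapZ_rotZ]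
    have : mapZ ρ.ε.addHom k θ = _ := hθ'
    rw [this]
    abel

end Resolution

/-! ## The group structure on Witt vectors with coefficients -/

section Witt

variable {A : Bimod.{u, v}} (ρ : FreeResolution.{u, v, u₁, v₁, u₂, v₂} A)

theorem FreeResolution.tuple_map_ε_surjective (p n : ℕ) :
    Function.Surjective (Tuple.map ρ.ε : Tuple ρ.S.R ρ.S.M p n → Tuple A.R A.M p n) := fun a => by
  choose q hq using fun i : Fin n => ρ.tens_map_ε_surjective _ (a i)
  exact ⟨q, funext hq⟩

/-- The differences of the images under `f` and `g` of the ghost vectors of `T`. -/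
def FreeResolution.ghostDiff (p n : ℕ) : AddSubgroup (GhostTarget ρ.S.R ρ.S.M p n) :=
  (ghostFil ρ.T.R ρ.T.M p n 0).map (GhostTarget.map ρ.f p n - GhostTarget.map ρ.g p n)

theorem FreeResolution.ghost_sub_mem {p : ℕ} (hp : 0 < p) {n : ℕ} (z : Tuple ρ.T.R ρ.T.M p n) :
    ghost (Tuple.map ρ.f z) - ghost (Tuple.map ρ.g z) ∈ ρ.ghostDiff p n :=
  ⟨ghost z, ghost_mem_ghostFil hp fun _ h => absurd h (Nat.not_lt_zero _), by
    rw [AddMonoidHom.sub_apply, GhostTarget.map_ghost, GhostTarget.map_ghost]⟩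

theorem FreeResolution.ghost_sub_mem_of_eq {p : ℕ} (hp : 0 < p) {n : ℕ}
    {q u : Tuple ρ.S.R ρ.S.M p n} (h : Tuple.map ρ.ε q = Tuple.map ρ.ε u) :
    ghost q - ghost u ∈ ρ.ghostDiff p n := by
  choose z hf hg using fun i => ρ.exists_tens_of_eq (congrFun h i)
  have := ρ.ghost_sub_mem hp (n := n) z
  rwa [show Tuple.map ρ.f z = q from funext hf, show Tuple.map ρ.g z = u from funext hg] at this

theorem Witt.exists_mk {p n : ℕ} (x : Witt ρ p n) :
    ∃ q : Tuple ρ.S.R ρ.S.M p n, Witt.mk ρ (Tuple.map ρ.ε q) = x := by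
  obtain ⟨a, rfl⟩ := Quot.exists_rep x
  obtain ⟨q, rfl⟩ := ρ.tuple_map_ε_surjective p n a
  exact ⟨q, rfl⟩

variable (p : ℕ) [hp : Fact p.Prime] (n : ℕ)

/-- The ghost map of `S`, as a map on the Witt vectors of `A`. -/
def Witt.toGhost : Witt ρ p n → GhostTarget ρ.S.R ρ.S.M p n ⧸ ρ.ghostDiff p n :=
  Quot.lift (fun a => QuotientAddGroup.mk' _
    (ghost (Function.surjInv (ρ.tuple_map_ε_surjective p n) a))) (by
    -- Modulo `ghostDiff` the ghost vector does not depend on the chosen lift of a tuple of A.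
    have key : ∀ q : Tuple ρ.S.R ρ.S.M p n, QuotientAddGroup.mk' (ρ.ghostDiff p n)
        (ghost (Function.surjInv (ρ.tuple_map_ε_surjective p n) (Tuple.map ρ.ε q))) =
        QuotientAddGroup.mk' (ρ.ghostDiff p n) (ghost q) := fun q => by
      rw [← sub_eq_zero, ← map_sub]
      exact (QuotientAddGroup.eq_zero_iff _).2
        (ρ.ghost_sub_mem_of_eq hp.out.pos (Function.surjInv_eq _ _))
    rintro _ _ ⟨q, u, z, rfl, rfl, hq, hu⟩
    rw [key, key, hq, hu, ← sub_eq_zero, ← map_sub]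
    exact (QuotientAddGroup.eq_zero_iff _).2 (ρ.ghost_sub_mem hp.out.pos z))

variable {p n}

theorem Witt.toGhost_mk (q : Tuple ρ.S.R ρ.S.M p n) :
    Witt.toGhost ρ p n (Witt.mk ρ (Tuple.map ρ.ε q)) =
      QuotientAddGroup.mk' (ρ.ghostDiff p n) (ghost q) := by
  change QuotientAddGroup.mk' (ρ.ghostDiff p n) _ = _
  rw [← sub_eq_zero, ← map_sub]
  exact (QuotientAddGroup.eq_zero_iff _).2
    (ρ.ghost_sub_mem_of_eq hp.out.pos (Function.surjInv_eq _ _))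

/-- Two classes with the same image are related by a single instance of `wittRel`, since ghost
vectors of T can be added and subtracted. -/
theorem Witt.toGhost_injective : Function.Injective (Witt.toGhost ρ p n) := by
  intro x y h
  obtain ⟨q, rfl⟩ := Witt.exists_mk ρ x
  obtain ⟨u, rfl⟩ := Witt.exists_mk ρ y
  rw [Witt.toGhost_mk, Witt.toGhost_mk, ← sub_eq_zero, ← map_sub] at h
  obtain ⟨t, ht, htu⟩ := (QuotientAddGroup.eq_zero_iff _).1 h
  have hsec : ∀ a : Tuple ρ.S.R ρ.S.M p n, GhostTarget.map ρ.f p n (ghost (Tuple.map ρ.sec a)) =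
      ghost a ∧ GhostTarget.map ρ.g p n (ghost (Tuple.map ρ.sec a)) = ghost a := fun a => by
    rw [GhostTarget.map_ghost, GhostTarget.map_ghost]
    exact ⟨congrArg _ (funext fun i => ρ.tens_map_f_sec (a i)),
      congrArg _ (funext fun i => ρ.tens_map_g_sec (a i))⟩
  obtain ⟨z, -, rfl⟩ := exists_ghost_eq ht
  have hmem : ∀ a : Tuple ρ.T.R ρ.T.M p n, ghost a ∈ ghostFil ρ.T.R ρ.T.M p n 0 := fun a =>
    ghost_mem_ghostFil hp.out.pos fun _ h => absurd h (Nat.not_lt_zero _)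
  -- The vector w(z) + w(sec u) - w(sec (g z)) maps to w(q) under f and to w(u) under g.
  obtain ⟨z', -, hz'⟩ := exists_ghost_eq (sub_mem (add_mem (hmem z) (hmem (Tuple.map ρ.sec u)))
    (hmem (Tuple.map ρ.sec (Tuple.map ρ.g z))))
  refine Quot.sound ⟨q, u, z', rfl, rfl, ?_, ?_⟩
  · rw [← GhostTarget.map_ghost, hz', map_sub, map_add, (hsec _).1, (hsec _).1,
      ← GhostTarget.map_ghost ρ.g]
    rw [AddMonoidHom.sub_apply] at htu
    rw [add_sub_right_comm, htu, sub_add_cancel]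
  · rw [← GhostTarget.map_ghost, hz', map_sub, map_add, (hsec _).2, (hsec _).2,
      ← GhostTarget.map_ghost ρ.g, add_sub_cancel_left]

variable (p n) in
/-- The Witt vectors as a subgroup of a quotient of the target of the ghost map of `S`. -/
def Witt.equivGhost : Witt ρ p n ≃
    ↥((ghostFil ρ.S.R ρ.S.M p n 0).map (QuotientAddGroup.mk' (ρ.ghostDiff p n))) :=
  Equiv.ofBijective (fun x => ⟨Witt.toGhost ρ p n x, by
      obtain ⟨q, rfl⟩ := Witt.exists_mk ρ x
      rw [Witt.toGhost_mk]
      exact ⟨_, ghost_mem_ghostFil hp.out.pos fun _ h => absurd h (Nat.not_lt_zero _), rfl⟩⟩)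
    ⟨fun x y h => Witt.toGhost_injective ρ (congrArg Subtype.val h), by
      rintro ⟨_, g, hg, rfl⟩
      obtain ⟨q, -, rfl⟩ := exists_ghost_eq hg
      exact ⟨Witt.mk ρ (Tuple.map ρ.ε q), Subtype.ext (Witt.toGhost_mk ρ q)⟩⟩

instance Witt.addCommGroup : AddCommGroup (Witt ρ p n) := (Witt.equivGhost ρ p n).addCommGroup

variable (p n) in
/-- The ghost map of `S`, as a homomorphism on the Witt vectors of `A`. -/
def Witt.ghostHom : Witt ρ p n →+ GhostTarget ρ.S.R ρ.S.M p n ⧸ ρ.ghostDiff p n :=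
  AddMonoidHom.mk' (Witt.toGhost ρ p n) fun x y =>
    congrArg Subtype.val ((Witt.equivGhost ρ p n).addEquiv.map_add x y)

theorem Witt.ghostHom_mk (q : Tuple ρ.S.R ρ.S.M p n) :
    Witt.ghostHom ρ p n (Witt.mk ρ (Tuple.map ρ.ε q)) =
      QuotientAddGroup.mk' (ρ.ghostDiff p n) (ghost q) := Witt.toGhost_mk ρ q

theorem Witt.ghostHom_injective : Function.Injective (Witt.ghostHom ρ p n) :=
  Witt.toGhost_injective ρ

theorem Witt.isWittGroup : IsWittGroup ρ (Witt.addCommGroup ρ : AddCommGroup (Witt ρ p n)) := by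
  intro q u
  have hmem : ∀ a : Tuple ρ.S.R ρ.S.M p n, ghost a ∈ ghostFil ρ.S.R ρ.S.M p n 0 := fun a =>
    ghost_mem_ghostFil hp.out.pos fun _ h => absurd h (Nat.not_lt_zero _)
  obtain ⟨v, -, hv⟩ := exists_ghost_eq (add_mem (hmem q) (hmem u))
  refine ⟨v, hv, Witt.ghostHom_injective ρ ?_⟩
  rw [map_add, Witt.ghostHom_mk, Witt.ghostHom_mk, Witt.ghostHom_mk, hv, map_add]

theorem Witt.ghostHom_single (i : Fin n) (q : ρ.S.tens (p ^ (i : ℕ))) :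
    Witt.ghostHom ρ p n (Witt.single ρ i (Tens.map ρ.ε _ q)) =
      QuotientAddGroup.mk' (ρ.ghostDiff p n) (gvec p n i q) := by
  rw [← ghost_single hp.out.pos, ← Witt.ghostHom_mk]
  refine congrArg (fun m => Witt.ghostHom ρ p n (Witt.mk ρ m)) (funext fun l => ?_)
  exact (Pi.apply_single (fun (l : Fin n) => Tens.map ρ.ε (p ^ (l : ℕ))) (fun l => map_zero _)
    i q l).symm

/-- The ghost map is additive over positions, so classes of tuples become sums in the filtered
group. -/
theorem Witt.mk_eq_sum (m : Tuple A.R A.M p n) : Witt.mk ρ m = ∑ i, Witt.single ρ i (m i) := by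
  obtain ⟨q, rfl⟩ := ρ.tuple_map_ε_surjective p n m
  apply Witt.ghostHom_injective
  rw [Witt.ghostHom_mk, map_sum, ghost_eq_sum, map_sum]
  exact Finset.sum_congr rfl fun i _ => (Witt.ghostHom_single ρ i (q i)).symm

variable (p n) in
/-- The classes of the tuples which vanish in the positions `< i`. -/
def Witt.fil (i : ℕ) : AddSubgroup (Witt ρ p n) :=
  ((ghostFil ρ.S.R ρ.S.M p n i).map (QuotientAddGroup.mk' (ρ.ghostDiff p n))).comap
    (Witt.ghostHom ρ p n)

theorem Witt.fil_anti {i l : ℕ} (h : i ≤ l) : Witt.fil ρ p n l ≤ Witt.fil ρ p n i :=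
  AddSubgroup.comap_mono (AddSubgroup.map_mono (ghostFil_anti h))

theorem Witt.fil_zero : Witt.fil ρ p n 0 = ⊤ := by
  rw [eq_top_iff]
  intro x _
  obtain ⟨q, rfl⟩ := Witt.exists_mk ρ x
  exact ⟨ghost q, ghost_mem_ghostFil hp.out.pos fun _ h => absurd h (Nat.not_lt_zero _),
    (Witt.ghostHom_mk ρ q).symm⟩

theorem Witt.fil_eq_bot {i : ℕ} (h : n ≤ i) : Witt.fil ρ p n i = ⊥ := by
  rw [eq_bot_iff]
  rintro x ⟨g, hg, hx⟩
  rw [ghostFil_eq_bot h] at hg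
  apply AddSubgroup.mem_bot.2
  apply Witt.ghostHom_injective
  rw [← hx, AddSubgroup.mem_bot.1 hg, map_zero, map_zero]

theorem Witt.single_mem_fil (i : Fin n) (x : A.tens (p ^ (i : ℕ))) :
    Witt.single ρ i x ∈ Witt.fil ρ p n i := by
  obtain ⟨q, rfl⟩ := ρ.tens_map_ε_surjective _ x
  exact ⟨gvec p n i q, gvec_mem_ghostFil le_rfl q, (Witt.ghostHom_single ρ i q).symm⟩

theorem Witt.single_add_sub_mem (i : Fin n) (x y : A.tens (p ^ (i : ℕ))) :
    Witt.single ρ i (x + y) - Witt.single ρ i x - Witt.single ρ i y ∈ Witt.fil ρ p n (i + 1) := by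
  obtain ⟨q, rfl⟩ := ρ.tens_map_ε_surjective _ x
  obtain ⟨u, rfl⟩ := ρ.tens_map_ε_surjective _ y
  refine ⟨_, gvec_add_sub_mem n i q u, ?_⟩
  rw [← map_add, map_sub, map_sub, map_sub, map_sub, Witt.ghostHom_single, Witt.ghostHom_single,
    Witt.ghostHom_single]

theorem Witt.single_sub_sub_mem (i : Fin n) (x y : A.tens (p ^ (i : ℕ))) :
    Witt.single ρ i x - Witt.single ρ i y - Witt.single ρ i (x - y) ∈
      Witt.fil ρ p n (i + 1) := by
  have := Witt.single_add_sub_mem ρ i (x - y) y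
  rwa [sub_add_cancel, sub_right_comm] at this

theorem Witt.exists_single_sub_mem (i : Fin n) {x : Witt ρ p n} (hx : x ∈ Witt.fil ρ p n i) :
    ∃ y : A.tens (p ^ (i : ℕ)), x - Witt.single ρ i y ∈ Witt.fil ρ p n (i + 1) := by
  obtain ⟨g, hg, hgx⟩ := hx
  obtain ⟨q, hq⟩ := exists_sub_gvec_mem hg
  refine ⟨Tens.map ρ.ε _ q, _, hq, ?_⟩
  rw [map_sub, map_sub, Witt.ghostHom_single, ← hgx]

/-- In the last position the error of additivity lies beyond the length. This makes the iterated
Verschiebung a homomorphism. -/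
theorem Witt.single_last_add (i : ℕ) (x y : A.tens (p ^ i)) :
    Witt.single ρ (p := p) (Fin.last i) (x + y) =
      Witt.single ρ (Fin.last i) x + Witt.single ρ (Fin.last i) y := by
  have := Witt.single_add_sub_mem ρ (p := p) (Fin.last i) x y
  rw [Witt.fil_eq_bot ρ (le_of_eq (by rw [Fin.val_last])), AddSubgroup.mem_bot, sub_sub] at this
  exact sub_eq_zero.1 this

theorem Witt.single_last_eq_zero (i : ℕ) {x : A.tens (p ^ i)} (hx : A.proj (p ^ i) x = 0) :
    Witt.single ρ (p := p) (Fin.last i) x = 0 := by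
  obtain ⟨q, hq, rfl⟩ := ρ.exists_toCoinv_eq_zero hx
  have h1 : gvec p (i + 1) i q = 0 := by
    have := gvec_mem_of_toCoinv_eq_zero (i + 1) i hq
    rwa [ghostFil_eq_bot le_rfl, AddSubgroup.mem_bot] at this
  apply Witt.ghostHom_injective
  refine (Witt.ghostHom_single ρ (Fin.last i) q).trans ?_
  rw [map_zero]
  exact (congrArg _ h1).trans (map_zero _)

theorem Bimod.proj_surjective (A : Bimod.{u, v}) (k : ℕ) : Function.Surjective (A.proj k) := by
  intro y
  obtain ⟨y, rfl⟩ := QuotientAddGroup.mk'_surjective _ y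
  obtain ⟨ξ, rfl⟩ := QuotientAddGroup.mk'_surjective _ y
  exact ⟨QuotientAddGroup.mk' _ ξ, rfl⟩

theorem Witt.ghostHom_single_last (i : ℕ) (q : ρ.S.tens (p ^ i)) :
    Witt.ghostHom ρ p (i + 1) (Witt.single ρ (Fin.last i) (Tens.map ρ.ε (p ^ i) q)) =
      QuotientAddGroup.mk' (ρ.ghostDiff p (i + 1)) (gvec p (i + 1) i q) :=
  Witt.ghostHom_single ρ (Fin.last i) q

variable (p) in
/-- The iterated Verschiebung. -/
def Witt.versch (i : ℕ) : A.coinv (p ^ i) →+ Witt ρ p (i + 1) :=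
  (A.proj (p ^ i)).liftOfSurjective (A.proj_surjective _)
    ⟨AddMonoidHom.mk' (fun x => Witt.single ρ (Fin.last i) x) (Witt.single_last_add ρ i),
      fun _ hx => Witt.single_last_eq_zero ρ i hx⟩

theorem Witt.versch_proj (i : ℕ) (x : A.tens (p ^ i)) :
    Witt.versch ρ p i (A.proj (p ^ i) x) = Witt.single ρ (Fin.last i) x :=
  AddMonoidHom.liftOfRightInverse_comp_apply _ _ _ _ _

/-- This identifies the graded pieces. Truncation to the first i + 1 components annihilates
`ghostFil (i + 1)`, which gives one direction; the other lifts the difference term back to length n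
and needs torsion-freeness to recognise the remainder as a member of `ghostFil (i + 1)`. -/
theorem Witt.single_mem_fil_succ_iff
    (htf : ∀ (i : ℕ) (x : Coinv ρ.S.R ρ.S.M (p ^ i)), p ^ i • x = 0 → x = 0) (i : Fin n)
    (x : A.tens (p ^ (i : ℕ))) :
    Witt.single ρ i x ∈ Witt.fil ρ p n (i + 1) ↔ Witt.versch ρ p i (A.proj _ x) = 0 := by
  obtain ⟨q, rfl⟩ := ρ.tens_map_ε_surjective _ x
  have hle : (i : ℕ) + 1 ≤ n := i.2
  have hcomm : ∀ t, GhostTarget.trunc ρ.S.R ρ.S.M p hle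
      ((GhostTarget.map ρ.f p n - GhostTarget.map ρ.g p n) t) =
      (GhostTarget.map ρ.f p (i + 1) - GhostTarget.map ρ.g p (i + 1))
        (GhostTarget.trunc ρ.T.R ρ.T.M p hle t) := fun t => rfl
  have hgvec : GhostTarget.trunc ρ.S.R ρ.S.M p hle (gvec p n i q) = gvec p (i + 1) i q := rfl
  have h0 : Witt.versch ρ p i (A.proj _ (Tens.map ρ.ε _ q)) = 0 ↔
      gvec p (i + 1) i q ∈ ρ.ghostDiff p (i + 1) := by
    rw [Witt.versch_proj, ← (Witt.ghostHom_injective ρ).eq_iff, map_zero,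
      Witt.ghostHom_single_last]
    exact QuotientAddGroup.eq_zero_iff _
  rw [h0]
  constructor
  · rintro ⟨g, hg, hgx⟩
    rw [Witt.ghostHom_single, ← sub_eq_zero, ← map_sub] at hgx
    obtain ⟨t, ht, htg⟩ := (QuotientAddGroup.eq_zero_iff _).1 hgx
    have h1 : GhostTarget.trunc ρ.S.R ρ.S.M p hle g = 0 := by
      have : GhostTarget.trunc ρ.S.R ρ.S.M p hle g ∈ ghostFil ρ.S.R ρ.S.M p (i + 1) (i + 1) := by
        rw [← ghostFil_map_trunc ρ.S.R ρ.S.M p hle]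
        exact ⟨g, hg, rfl⟩
      rwa [ghostFil_eq_bot le_rfl, AddSubgroup.mem_bot] at this
    rw [← neg_mem_iff]
    refine ⟨GhostTarget.trunc ρ.T.R ρ.T.M p hle t, ?_, ?_⟩
    · rw [← ghostFil_map_trunc ρ.T.R ρ.T.M p hle]
      exact ⟨t, ht, rfl⟩
    · rw [← hcomm, htg, map_sub, h1, zero_sub, hgvec]
  · rintro ⟨t, ht, htg⟩
    rw [← ghostFil_map_trunc ρ.T.R ρ.T.M p hle] at ht
    obtain ⟨t, ht, rfl⟩ := ht
    rw [← hcomm] at htg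
    -- Subtracting the lifted difference does not change the class and kills the components 0, …, i.
    refine ⟨gvec p n i q - (GhostTarget.map ρ.f p n - GhostTarget.map ρ.g p n) t, ?_, ?_⟩
    · refine mem_ghostFil_of_apply_eq_zero htf (i + 1) (sub_mem (gvec_mem_ghostFil (Nat.zero_le _) q)
        (sub_mem (GhostTarget.map_mem_ghostFil ρ.f ht) (GhostTarget.map_mem_ghostFil ρ.g ht))) ?_
      intro j hj
      have h1 : GhostTarget.trunc ρ.S.R ρ.S.M p hle
          (gvec p n i q - (GhostTarget.map ρ.f p n - GhostTarget.map ρ.g p n) t) = 0 := by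
        rw [map_sub, htg, hgvec, sub_self]
      exact congrFun h1 ⟨j, hj⟩
    · rw [map_sub, Witt.ghostHom_single]
      have : QuotientAddGroup.mk' (ρ.ghostDiff p n)
          ((GhostTarget.map ρ.f p n - GhostTarget.map ρ.g p n) t) = 0 :=
        (QuotientAddGroup.eq_zero_iff _).2 ⟨t, ht, rfl⟩
      rw [this, sub_zero]

end Witt

/-! ## Bijections onto filtered groups -/

section Filtered

/-- Coordinates are determined successively, the i-th one modulo step i + 1. The maps θ need not be
additive; only their values modulo the next step enter. -/
theorem bijective_sum_of_filtration {W : Type*} [AddCommGroup W] {n : ℕ} (Fil : ℕ → AddSubgroup W)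
    (anti : ∀ {i l}, i ≤ l → Fil l ≤ Fil i) (h0 : Fil 0 = ⊤) (hn : Fil n = ⊥) {X : Fin n → Type*}
    (θ : ∀ i, X i → W) (hmem : ∀ (i : Fin n) c, θ i c ∈ Fil i)
    (hinj : ∀ (i : Fin n) c c', θ i c - θ i c' ∈ Fil (i + 1) → c = c')
    (hsurj : ∀ (i : Fin n), ∀ x ∈ Fil i, ∃ c, x - θ i c ∈ Fil (i + 1)) :
    Function.Bijective fun c : ∀ i, X i => ∑ i, θ i (c i) := by
  classical
  constructor
  · intro c c' h
    have h' : ∑ l, (θ l (c l) - θ l (c' l)) = 0 := by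
      rw [Finset.sum_sub_distrib]; exact sub_eq_zero.2 h
    have main : ∀ k (hk : k < n), c ⟨k, hk⟩ = c' ⟨k, hk⟩ := by
      intro k
      induction k using Nat.strong_induction_on with
      | _ k ih =>
        intro hk
        apply hinj
        rw [← Finset.add_sum_erase _ _ (Finset.mem_univ (⟨k, hk⟩ : Fin n)),
          add_eq_zero_iff_eq_neg] at h'
        rw [h', neg_mem_iff]
        -- Earlier terms cancel by induction and later ones lie in the next step.
        refine sum_mem fun l hl => ?_
        have hlk : (l : ℕ) ≠ k := fun e => Finset.ne_of_mem_erase hl (Fin.ext e)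
        rcases lt_or_gt_of_ne hlk with hlt | hgt
        · rw [show c l = c' l from ih l hlt l.2, sub_self]
          exact zero_mem _
        · exact anti (Nat.succ_le_of_lt hgt) (sub_mem (hmem l _) (hmem l _))
    exact funext fun i => main i i.2
  · intro x
    -- An arbitrary family: the coordinates not yet determined need some value.
    choose c₀ _ using fun i : Fin n => hsurj i 0 (zero_mem _)
    have main : ∀ k ≤ n, ∃ c : ∀ i, X i,
        x - ∑ i ∈ Finset.univ.filter (fun i : Fin n => (i : ℕ) < k), θ i (c i) ∈ Fil k := by
      intro k
      induction k with
      | zero => exact fun _ => ⟨c₀, by rw [h0]; exact AddSubgroup.mem_top _⟩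
      | succ k ih =>
        intro hk
        obtain ⟨c, hc⟩ := ih (by omega)
        obtain ⟨d, hd⟩ := hsurj ⟨k, hk⟩ _ hc
        refine ⟨Function.update c ⟨k, hk⟩ d, ?_⟩
        have hfil : Finset.univ.filter (fun i : Fin n => (i : ℕ) < k + 1) =
            insert ⟨k, hk⟩ (Finset.univ.filter (fun i : Fin n => (i : ℕ) < k)) := by
          ext i
          simp only [Finset.mem_filter, Finset.mem_univ, true_and, Finset.mem_insert, Fin.ext_iff]
          omega
        rw [hfil, Finset.sum_insert (by simp), Function.update_self]
        have hsum : ∑ i ∈ Finset.univ.filter (fun i : Fin n => (i : ℕ) < k),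
            θ i (Function.update c ⟨k, hk⟩ d i) =
            ∑ i ∈ Finset.univ.filter (fun i : Fin n => (i : ℕ) < k), θ i (c i) := by
          refine Finset.sum_congr rfl fun i hi => ?_
          rw [Function.update_of_ne]
          rintro rfl
          simp at hi
        rw [hsum, add_comm (θ _ d), ← sub_sub]
        exact hd
    obtain ⟨c, hc⟩ := main n le_rfl
    refine ⟨c, ?_⟩
    rw [hn, AddSubgroup.mem_bot, sub_eq_zero, Finset.filter_true_of_mem fun i _ => i.2] at hc
    exact hc.symm

variable {A : Bimod.{u, v}} (ρ : FreeResolution.{u, v, u₁, v₁, u₂, v₂} A) {p : ℕ}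
  [hp : Fact p.Prime] {n : ℕ}

/-- The maps θ may differ from `Witt.single` of τ in later positions; this freedom covers the sums
of Teichmüller terms attached to a basis. -/
theorem Witt.bijective_sum
    (htf : ∀ (i : ℕ) (x : Coinv ρ.S.R ρ.S.M (p ^ i)), p ^ i • x = 0 → x = 0)
    {X : Fin n → Type*} (τ : ∀ i : Fin n, X i → A.tens (p ^ (i : ℕ)))
    (hτ : ∀ i : Fin n, Function.Bijective fun c =>
      QuotientAddGroup.mk' (Witt.versch ρ p i).ker (A.proj _ (τ i c)))
    (θ : ∀ i : Fin n, X i → Witt ρ p n)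
    (hθ : ∀ (i : Fin n) c, θ i c - Witt.single ρ i (τ i c) ∈ Witt.fil ρ p n (i + 1)) :
    Function.Bijective fun c : ∀ i, X i => ∑ i, θ i (c i) := by
  -- `Witt.single` is additive modulo the next step, so the criterion for one element extends to
  -- differences.
  have hdiff : ∀ (i : Fin n) (x y : A.tens (p ^ (i : ℕ))),
      Witt.single ρ i x - Witt.single ρ i y ∈ Witt.fil ρ p n (i + 1) ↔
      QuotientAddGroup.mk' (Witt.versch ρ p i).ker (A.proj _ x) =
        QuotientAddGroup.mk' (Witt.versch ρ p i).ker (A.proj _ y) := fun i x y => by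
    rw [← sub_eq_zero (a := QuotientAddGroup.mk' _ _), ← map_sub, ← map_sub,
      show QuotientAddGroup.mk' (Witt.versch ρ p i).ker (A.proj _ (x - y)) = 0 ↔
        Witt.versch ρ p i (A.proj _ (x - y)) = 0 from QuotientAddGroup.eq_zero_iff _,
      ← Witt.single_mem_fil_succ_iff ρ htf]
    have h := Witt.single_sub_sub_mem ρ i x y
    constructor
    · intro h'; simpa using sub_mem h' h
    · intro h'; simpa using add_mem h h'
  refine bijective_sum_of_filtration (Witt.fil ρ p n) (Witt.fil_anti ρ) (Witt.fil_zero ρ)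
    (Witt.fil_eq_bot ρ le_rfl) θ ?_ ?_ ?_
  · intro i c
    simpa using add_mem (Witt.fil_anti ρ (Nat.le_succ _) (hθ i c)) (Witt.single_mem_fil ρ i (τ i c))
  · intro i c c' h
    apply (hτ i).1
    apply (hdiff i _ _).1
    have := add_mem (sub_mem h (hθ i c)) (hθ i c')
    convert this using 1
    abel
  · intro i x hx
    obtain ⟨y, hy⟩ := Witt.exists_single_sub_mem ρ i hx
    obtain ⟨c, hc⟩ := (hτ i).2 (QuotientAddGroup.mk' (Witt.versch ρ p i).ker (A.proj _ y))
    refine ⟨c, ?_⟩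
    have := sub_mem (sub_mem hy ((hdiff i (τ i c) y).2 hc)) (hθ i c)
    convert this using 1
    abel

/-- The iterated Verschiebung is injective if the coinvariants have no `p`-torsion. -/
theorem Witt.versch_injective
    (htf : ∀ (i : ℕ) (x : A.coinv (p ^ i)), p ^ i • x = 0 → x = 0) (i : ℕ) :
    Function.Injective (Witt.versch ρ p i) := by
  rw [injective_iff_map_eq_zero]
  intro c hc
  obtain ⟨x, rfl⟩ := A.proj_surjective _ c
  obtain ⟨q, rfl⟩ := ρ.tens_map_ε_surjective _ x
  have h0 := congrArg (Witt.ghostHom ρ p (i + 1)) hc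
  rw [Witt.versch_proj, map_zero, Witt.ghostHom_single_last] at h0
  obtain ⟨t, ht, htq⟩ := (QuotientAddGroup.eq_zero_iff _).1 h0
  obtain ⟨z, -, rfl⟩ := exists_ghost_eq ht
  -- As ε equalises f and g, it kills the differences and leaves an equation between ghost vectors
  -- of A itself.
  have h1 : GhostTarget.map ρ.ε p (i + 1) (gvec p (i + 1) i q) = 0 := by
    rw [← htq, AddMonoidHom.sub_apply, map_sub, GhostTarget.map_ghost,
      GhostTarget.map_ghost, GhostTarget.map_ghost, GhostTarget.map_ghost, sub_eq_zero]
    exact congrArg _ (funext fun i => ρ.tens_map_ε_f (z i))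
  rw [GhostTarget.map_gvec] at h1
  exact toCoinv_eq_zero_of_gvec_apply_self htf (Fin.last i) (congrFun h1 (Fin.last i))

end Filtered

/-! ## Cyclic words -/

section CyclicWords

/-- Words with `k` letters, up to cyclic permutation. -/
def rotSetoid (κ : Type*) (k : ℕ) : Setoid (Fin k → κ) where
  r x y := ∃ t : ℕ, y = x ∘ (finRotate k)^[t]
  iseqv :=
    { refl := fun x => ⟨0, rfl⟩
      symm := by
        rintro x _ ⟨t, rfl⟩
        obtain ⟨s, hs⟩ : ∃ s : ℕ, (finRotate k)^[t + s] = id := by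
          -- This makes the total exponent a multiple of the order.
          refine ⟨(orderOf (finRotate k) - 1) * t, ?_⟩
          have h0 : 0 < orderOf (finRotate k) := orderOf_pos _
          rw [← Equiv.Perm.coe_pow, show t + (orderOf (finRotate k) - 1) * t =
            orderOf (finRotate k) * t by
              obtain ⟨d, hd⟩ : ∃ d, orderOf (finRotate k) = d + 1 := ⟨_, (Nat.succ_pred h0.ne').symm⟩
              rw [hd, Nat.add_sub_cancel]; ring,
            pow_mul, pow_orderOf_eq_one, one_pow]
          rfl
        refine ⟨s, ?_⟩
        rw [Function.comp_assoc, ← Function.iterate_add, hs, Function.comp_id]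
      trans := by
        rintro x _ _ ⟨t, rfl⟩ ⟨s, rfl⟩
        exact ⟨t + s, by rw [Function.comp_assoc, ← Function.iterate_add]⟩ }

/-- The set of cyclic words with `k` letters. -/
abbrev CycWord (κ : Type*) (k : ℕ) : Type _ := Quotient (rotSetoid κ k)

/-- The class of a word. -/
def CycWord.mk {κ : Type*} {k : ℕ} (x : Fin k → κ) : CycWord κ k := Quotient.mk (rotSetoid κ k) x

theorem CycWord.mk_rot {κ : Type*} {k : ℕ} (x : Fin k → κ) :
    CycWord.mk (fun l => x (finRotate k l)) = CycWord.mk x :=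
  (Quotient.sound (s := rotSetoid κ k) ⟨1, rfl⟩ : CycWord.mk x = _).symm

theorem eq_of_cycWord_eq {κ γ : Type*} {k : ℕ} (F : (Fin k → κ) → γ)
    (hF : ∀ x, F (fun l => x (finRotate k l)) = F x) {x y : Fin k → κ}
    (h : CycWord.mk x = CycWord.mk y) : F x = F y := by
  obtain ⟨t, rfl⟩ : ∃ t : ℕ, y = x ∘ (finRotate k)^[t] := Quotient.exact h
  clear h
  induction t with
  | zero => rfl
  | succ t ih => exact ih.trans (hF (x ∘ (finRotate k)^[t])).symm

end CyclicWords

/-! ### Maps out of the coinvariants, and torsion. -/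

section Coinv

theorem update_smul_eq {R : Type u} {M : Type v} [Ring R] [AddCommGroup M] [Module R M] {k : ℕ}
    (m : Fin k → M) (j : Fin k) (r : R) :
    Function.update m j (r • m j) = fun l => (if l = j then r else 1) • m l := by
  funext l
  by_cases hl : l = j
  · subst hl; rw [Function.update_self, if_pos rfl]
  · rw [Function.update_of_ne hl, if_neg hl, one_smul]

theorem update_op_smul_eq {R : Type u} {M : Type v} [Ring R] [AddCommGroup M] [Module Rᵐᵒᵖ M]
    {k : ℕ} (m : Fin k → M) {i j : Fin k} (h : finRotate k i = j) (r : R) :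
    Function.update m i (MulOpposite.op r • m i) =
      fun l => MulOpposite.op (if finRotate k l = j then r else 1) • m l := by
  funext l
  by_cases hl : l = i
  · subst hl; rw [Function.update_self, if_pos h]
  · rw [Function.update_of_ne hl, if_neg fun e => hl ((finRotate _).injective (e.trans h.symm)),
      MulOpposite.op_one, one_smul]

variable {R : Type u} {M : Type v} [Ring R] [AddCommGroup M] [Module R M] [Module Rᵐᵒᵖ M] {k : ℕ}

theorem toCoinv_rotZ (ξ : ⨂[ℤ]^k M) :
    Tens.toCoinv R M k (QuotientAddGroup.mk' _ (rotZ M k ξ)) =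
      Tens.toCoinv R M k (QuotientAddGroup.mk' _ ξ) :=
  coinv_mk_rot_iterate 1 (QuotientAddGroup.mk' (cycRel R M k) ξ)

theorem toCoinv_elem (m : Fin k → M) :
    Tens.toCoinv R M k (elem R m) = QuotientAddGroup.mk' _ (cycElem R m) := rfl

theorem toCoinv_elem_rot (m : Fin k → M) :
    Tens.toCoinv R M k (elem R fun l => m (finRotate k l)) = Tens.toCoinv R M k (elem R m) := by
  have := toCoinv_rotZ (R := R) (PiTensorProduct.tprod ℤ fun l => m (finRotate k l))
  rw [rotZ_tprod] at this
  simp only [Equiv.apply_symm_apply] at this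
  exact this.symm

/-- A homomorphism on the coinvariants, from a rotation-invariant homomorphism on the tensor power
over `ℤ` which respects the relations of the cyclic tensor power. -/
def coinvLift {N : Type*} [AddCommGroup N] (L : (⨂[ℤ]^k M) →+ N)
    (hrel : ∀ (m : Fin k → M) (i j : Fin k) (r : R), finRotate k i = j →
      L (PiTensorProduct.tprod ℤ (Function.update m i (MulOpposite.op r • m i))) =
        L (PiTensorProduct.tprod ℤ (Function.update m j (r • m j))))
    (hrot : ∀ m : Fin k → M, L (PiTensorProduct.tprod ℤ fun l => m ((finRotate k).symm l)) =
      L (PiTensorProduct.tprod ℤ m)) : Coinv R M k →+ N :=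
  QuotientAddGroup.lift _ (QuotientAddGroup.lift (cycRel R M k) L (by
      refine (AddSubgroup.closure_le _).2 ?_
      rintro _ ⟨m, i, j, r, h, rfl⟩
      change L _ = 0
      rw [map_sub, hrel m i j r h, sub_self])) (by
    rintro _ ⟨y, rfl⟩
    obtain ⟨ξ, rfl⟩ := QuotientAddGroup.mk'_surjective _ y
    change L (rotZ M k ξ - ξ) = 0
    rw [map_sub, sub_eq_zero]
    induction ξ using PiTensorProduct.induction_on with
    | smul_tprod c m => rw [map_zsmul, map_zsmul, map_zsmul, rotZ_tprod, hrot]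
    | add x y hx hy => rw [map_add, map_add, map_add, hx, hy])

theorem coinv_induction {P : Coinv R M k → Prop} (helem : ∀ m : Fin k → M, P
    (Tens.toCoinv R M k (elem R m))) (hadd : ∀ x y, P x → P y → P (x + y))
    (hsmul : ∀ (c : ℤ) x, P x → P (c • x)) (x : Coinv R M k) : P x := by
  obtain ⟨y, rfl⟩ := QuotientAddGroup.mk'_surjective _ x
  obtain ⟨ξ, rfl⟩ := QuotientAddGroup.mk'_surjective _ y
  induction ξ using PiTensorProduct.induction_on with
  | smul_tprod c m => rw [map_zsmul, map_zsmul]; exact hsmul c _ (helem m)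
  | add x y hx hy => rw [map_add, map_add]; exact hadd _ _ hx hy

theorem pow_torsion_free_of_injective {N N' : Type*} [AddCommGroup N] [AddCommGroup N'] {p : ℕ}
    (L : N →+ N') (hL : Function.Injective L) (h : ∀ (i : ℕ) (x : N'), p ^ i • x = 0 → x = 0)
    (i : ℕ) (x : N) (hx : p ^ i • x = 0) : x = 0 := by
  apply hL
  rw [map_zero]
  apply h i
  rw [← map_nsmul, hx, map_zero]

theorem pow_torsion_free_finsupp {N κ : Type*} [AddCommGroup N] {p : ℕ}
    (h : ∀ (i : ℕ) (x : N), p ^ i • x = 0 → x = 0) (i : ℕ) (x : κ →₀ N) (hx : p ^ i • x = 0) :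
    x = 0 := by
  ext a
  exact h i _ (DFunLike.congr_fun hx a)

end Coinv

/-! ## Coinvariants of a ring -/

section Self

variable {R : Type u} [Ring R]

theorem prod_ofFn_smul (m r : ℕ → R) (k : ℕ) :
    (List.ofFn fun l : Fin k => r l * m l).prod * r k =
      r 0 * (List.ofFn fun l : Fin k => m l * r (l + 1)).prod := by
  induction k with
  | zero => simp
  | succ k ih =>
    rw [List.ofFn_succ', List.ofFn_succ', List.concat_eq_append, List.concat_eq_append,
      List.prod_append, List.prod_append, List.prod_singleton, List.prod_singleton]
    simp only [Fin.val_castSucc, Fin.val_last]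
    rw [← mul_assoc, ih]
    simp only [mul_assoc]

/-- The class of the product of a word. -/
def prodComm (k : ℕ) : (⨂[ℤ]^k R) →+ Comm R :=
  (QuotientAddGroup.mk' _).comp
    (PiTensorProduct.lift (MultilinearMap.mkPiAlgebraFin ℤ k R)).toAddMonoidHom

theorem prodComm_tprod {k : ℕ} (m : Fin k → R) :
    prodComm k (PiTensorProduct.tprod ℤ m) = (QuotientAddGroup.mk (List.ofFn m).prod : Comm R) :=
  congrArg (QuotientAddGroup.mk' _) ((PiTensorProduct.lift.tprod _).trans rfl)

theorem comm_mul_comm (a b : R) :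
    (QuotientAddGroup.mk (a * b) : Comm R) = QuotientAddGroup.mk (b * a) := by
  rw [QuotientAddGroup.eq]
  exact AddSubgroup.subset_closure ⟨b, a, by abel⟩

/-- Moving r between neighbouring factors does not change the product in R. Across the seam it turns
P r into r P, and only there are commutators needed. -/
theorem prodComm_update {k : ℕ} (m : Fin k → R) (i j : Fin k) (r : R) (h : finRotate k i = j) :
    prodComm k (PiTensorProduct.tprod ℤ (Function.update m i (MulOpposite.op r • m i))) =
      prodComm k (PiTensorProduct.tprod ℤ (Function.update m j (r • m j))) := by
  rw [prodComm_tprod, prodComm_tprod, update_op_smul_eq m h, update_smul_eq]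
  have hk : 0 < k := i.pos
  let m' : ℕ → R := perExt hk m
  let r' : ℕ → R := perExt hk fun l => if l = j then r else 1
  have hm : ∀ l : Fin k, m l = m' l := fun l => (perExt_of_lt hk m l.2).symm
  have hr : ∀ l : Fin k, (if l = j then r else 1) = r' l := fun l =>
    (perExt_of_lt hk (fun l => if l = j then r else 1) l.2).symm
  have hr2 : ∀ l : Fin k, (if finRotate k l = j then r else 1) = r' (l + 1) := fun l =>
    (hr (finRotate k l)).trans (apply_finRotate_of_periodic (perExt_periodic hk _) l)
  have hL : (fun l => MulOpposite.op (if finRotate k l = j then r else 1) • m l) =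
      fun l : Fin k => m' l * r' (l + 1) := funext fun l => by
    rw [hr2, hm, op_smul_eq_mul]
  have hR : (fun l => (if l = j then r else 1) • m l) = fun l : Fin k => r' l * m' l :=
    funext fun l => by rw [hr, hm, smul_eq_mul]
  rw [hL, hR]
  have key := prod_ofFn_smul m' r' k
  have hper : r' k = r' 0 := by simpa using perExt_periodic hk (fun l => if l = j then r else 1) 0
  rw [hper] at key
  have hj : r' 0 = if (⟨0, hk⟩ : Fin k) = j then r else 1 := (hr ⟨0, hk⟩).symm
  -- The scalar crosses the seam exactly when it is received by the factor in place 0.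
  by_cases h0 : (⟨0, hk⟩ : Fin k) = j
  · rw [if_pos h0] at hj
    obtain ⟨k, rfl⟩ : ∃ k', k = k' + 1 := ⟨k - 1, by omega⟩
    have h1 : ∀ l, 0 < l → l < k + 1 → r' l = 1 := fun l hl hl' => by
      refine (hr ⟨l, hl'⟩).symm.trans (if_neg ?_)
      rw [← h0]
      intro e
      have := congrArg Fin.val e
      simp only at this
      omega
    have e1 : (List.ofFn fun l : Fin (k + 1) => m' l * r' (l + 1)).prod =
        (List.ofFn fun l : Fin (k + 1) => m' l).prod * r := by
      rw [List.ofFn_succ', List.ofFn_succ', List.concat_eq_append, List.concat_eq_append,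
        List.prod_append, List.prod_append, List.prod_singleton, List.prod_singleton]
      simp only [Fin.val_castSucc, Fin.val_last]
      rw [hper, hj, mul_assoc]
      congr 2
      refine congrArg List.ofFn (funext fun l : Fin k => ?_)
      rw [h1 _ (by omega) (by omega), mul_one]
    have e2 : (List.ofFn fun l : Fin (k + 1) => r' l * m' l).prod =
        r * (List.ofFn fun l : Fin (k + 1) => m' l).prod := by
      rw [List.ofFn_succ, List.ofFn_succ, List.prod_cons, List.prod_cons]
      simp only [Fin.val_zero, Fin.val_succ]
      rw [hj, mul_assoc]
      congr 3
      refine congrArg List.ofFn (funext fun l : Fin k => ?_)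
      rw [h1 _ (by omega) (by omega), one_mul]
    rw [e1, e2, comm_mul_comm]
  · rw [if_neg h0] at hj
    rw [hj, mul_one, one_mul] at key
    rw [key]

theorem prodComm_rot {k : ℕ} (m : Fin k → R) :
    prodComm k (PiTensorProduct.tprod ℤ fun l => m ((finRotate k).symm l)) =
      prodComm k (PiTensorProduct.tprod ℤ m) := by
  rw [prodComm_tprod, prodComm_tprod]
  cases k with
  | zero => rfl
  | succ k =>
    obtain ⟨m, rfl⟩ : ∃ m' : Fin (k + 1) → R, m = fun l => m' (finRotate (k + 1) l) :=
      ⟨fun l => m ((finRotate _).symm l), by simp⟩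
    simp only [Equiv.apply_symm_apply]
    rw [List.ofFn_succ, List.ofFn_succ' (fun l => m (finRotate (k + 1) l)),
      List.concat_eq_append, List.prod_append, List.prod_cons, List.prod_singleton, finRotate_last,
      comm_mul_comm]
    congr 3
    refine congrArg List.ofFn (funext fun l : Fin k => ?_)
    exact congrArg m (finRotate_of_succ rfl).symm

variable (R) in
/-- The coinvariants of `R`, as a bimodule over itself, map to `R / [R, R]` by multiplication. -/
def coinvToComm (k : ℕ) : (Bimod.self R).coinv k →+ Comm R :=
  coinvLift (R := R) (M := R) (prodComm k) prodComm_update prodComm_rot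

theorem smulElem_eq_elem_update (A : Bimod.{u, v}) {k : ℕ} (hk : 0 < k) (r : A.R)
    (m : Fin k → A.M) :
    smulElem A r m = elem A.R (Function.update m ⟨0, hk⟩ (r • m ⟨0, hk⟩)) := by
  unfold smulElem
  congr 1
  funext l
  by_cases hl : l = ⟨0, hk⟩
  · subst hl; rw [Function.update_self, if_pos rfl]
  · rw [Function.update_of_ne hl, if_neg fun e => hl (Fin.ext e)]

/-- The factors are moved to the left one place at a time, leaving 1 behind. -/
theorem elem_eq_smulElem_prod {k : ℕ} (hk : 0 < k) (m : Fin k → R) :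
    (elem R m : Tens R R k) = smulElem (Bimod.self R) (List.ofFn m).prod fun _ => (1 : R) := by
  -- T t is the product of the factors from place t on.
  let T : ℕ → R := fun t => ((List.ofFn m).drop t).prod
  have hT : ∀ l : Fin k, T l = m l * T (l + 1) := fun l => by
    have h : (l : ℕ) < (List.ofFn m).length := by simp
    simp only [T]
    rw [List.drop_eq_getElem_cons h, List.prod_cons, List.getElem_ofFn]
  have hTk : T k = 1 := by
    simp only [T]
    rw [List.drop_eq_nil_of_le (by simp), List.prod_nil]
  -- The intermediate tensor is m₀ ⊗ ⋯ ⊗ m_{t-1} ⊗ T t ⊗ 1 ⊗ ⋯ ⊗ 1; for t = k - 1 it is the original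
  -- one.
  have main : ∀ t < k, smulElem (Bimod.self R) (List.ofFn m).prod (fun _ : Fin k => (1 : R)) =
      (elem R fun l : Fin k => if (l : ℕ) < t then m l else if (l : ℕ) = t then T t else 1 :
        Tens R R k) := by
    intro t
    induction t with
    | zero =>
      intro _
      unfold smulElem
      congr 1
      funext l
      simp [T]
    | succ t ih =>
      intro ht
      rw [ih (by omega)]
      let m' : Fin k → R := fun l => if (l : ℕ) < t + 1 then m l else 1
      have := elem_update m' (i := ⟨t, by omega⟩) (j := ⟨t + 1, ht⟩) rfl (T (t + 1))
      refine (Eq.trans ?_ this).trans ?_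
      · congr 1
        funext l
        by_cases hl : l = ⟨t, by omega⟩
        · subst hl
          rw [Function.update_self]
          simp [m', hT ⟨t, by omega⟩]
        · rw [Function.update_of_ne hl]
          have : (l : ℕ) ≠ t := fun e => hl (Fin.ext e)
          simp only [m', this, if_false]
          congr 1
          exact propext ⟨fun h => by omega, fun h => by omega⟩
      · congr 1
        funext l
        by_cases hl : l = ⟨t + 1, ht⟩
        · subst hl
          rw [Function.update_self]
          simp [m']
        · rw [Function.update_of_ne hl]
          have : (l : ℕ) ≠ t + 1 := fun e => hl (Fin.ext e)
          simp [m', this]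
  rw [main (k - 1) (by omega)]
  congr 1
  funext l
  split_ifs with h1 h2
  · rfl
  · have : k - 1 = l := h2.symm
    rw [this, hT l, show (l : ℕ) + 1 = k by omega, hTk, mul_one]
  · omega

theorem coinvToComm_elem {k : ℕ} (m : Fin k → R) :
    coinvToComm R k ((Bimod.self R).proj k (elem R m)) = QuotientAddGroup.mk (List.ofFn m).prod :=
  prodComm_tprod m

theorem coinvToComm_smulElem {k : ℕ} (hk : 0 < k) (r : R) :
    coinvToComm R k ((Bimod.self R).proj k (smulElem (Bimod.self R) r fun _ => (1 : R))) =
      QuotientAddGroup.mk r := by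
  refine (coinvToComm_elem _).trans ?_
  obtain ⟨k, rfl⟩ : ∃ k', k = k' + 1 := ⟨k - 1, by omega⟩
  rw [List.ofFn_succ]
  simp

/-- The map from `R` to the coinvariants which sends `r` to the class of `r ⊗ 1 ⊗ ⋯ ⊗ 1`. -/
def toCoinvSelf {k : ℕ} (hk : 0 < k) : R →+ Coinv R R k :=
  AddMonoidHom.mk' (fun r => Tens.toCoinv R R k (smulElem (Bimod.self R) r fun _ => (1 : R)))
    fun a b => by
      rw [← map_add, smulElem_eq_elem_update _ hk, smulElem_eq_elem_update _ hk,
        smulElem_eq_elem_update _ hk, add_smul]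
      unfold elem
      rw [MultilinearMap.map_update_add, map_add]

theorem toCoinv_elem_eq_toCoinvSelf {k : ℕ} (hk : 0 < k) (m : Fin k → R) :
    Tens.toCoinv R R k (elem R m) = toCoinvSelf hk (List.ofFn m).prod :=
  congrArg (Tens.toCoinv R R k) (elem_eq_smulElem_prod hk m)

/-- In s ⊗ 1 ⊗ ⋯ ⊗ 1, a scalar r on the right of the last factor equals r on the left of the first;
the two products are s r and r s. -/
theorem toCoinvSelf_mul_comm {k : ℕ} (hk : 0 < k) (r s : R) :
    toCoinvSelf hk (r * s) = toCoinvSelf hk (s * r) := by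
  obtain ⟨k, rfl⟩ : ∃ k', k = k' + 1 := ⟨k - 1, by omega⟩
  let m : Fin (k + 1) → R := fun l => if l = 0 then s else 1
  have e1 : (List.ofFn (Function.update m 0 (r • m 0))).prod = r * s := by
    rw [List.ofFn_succ]
    simp [m]
  have e2 : (List.ofFn (Function.update m (Fin.last k) (MulOpposite.op r • m (Fin.last k)))).prod =
      s * r := by
    cases k with
    | zero => simp [m]
    | succ k =>
      rw [List.ofFn_succ', List.concat_eq_append, List.prod_append, List.prod_singleton,
        List.ofFn_succ]
      simp [m, Function.update_of_ne, Fin.castSucc_ne_last]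
  have h := congrArg (QuotientAddGroup.mk' (Cyc.rot R R (k + 1) - AddMonoidHom.id _).range)
    (cycElem_update R m (i := Fin.last k) (j := 0) finRotate_last r)
  rw [← toCoinv_elem, ← toCoinv_elem, toCoinv_elem_eq_toCoinvSelf hk,
    toCoinv_elem_eq_toCoinvSelf hk, e1, e2] at h
  exact h.symm

theorem coinvToComm_injective {k : ℕ} (hk : 0 < k) : Function.Injective (coinvToComm R k) := by
  have hP : AddSubgroup.closure {x : R | ∃ r s : R, x = r * s - s * r} ≤ (toCoinvSelf hk).ker := by
    refine (AddSubgroup.closure_le _).2 ?_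
    rintro _ ⟨r, s, rfl⟩
    change toCoinvSelf hk _ = 0
    rw [map_sub, sub_eq_zero, toCoinvSelf_mul_comm]
  have hret : ∀ x : Coinv R R k,
      QuotientAddGroup.lift _ (toCoinvSelf hk) hP (coinvToComm R k x) = x := fun x => by
    induction x using coinv_induction with
    | helem m =>
      refine (congrArg (QuotientAddGroup.lift _ (toCoinvSelf hk) hP)
        (coinvToComm_elem m)).trans ?_
      exact (toCoinv_elem_eq_toCoinvSelf hk m).symm
    | hadd x y hx hy => rw [map_add, map_add, hx, hy]
    | hsmul c x hx => rw [map_zsmul, map_zsmul, hx]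
  exact Function.LeftInverse.injective hret

theorem bijective_coinvToComm {k : ℕ} (hk : 0 < k) : Function.Bijective (coinvToComm R k) :=
  ⟨coinvToComm_injective hk, fun c => by
    obtain ⟨r, rfl⟩ := QuotientAddGroup.mk_surjective c
    exact ⟨_, coinvToComm_smulElem hk r⟩⟩

end Self

/-! ## Coinvariants of a free bimodule -/

section Free

variable {R : Type u} {M : Type v} [Ring R] [AddCommGroup M] [Module R M] [Module Rᵐᵒᵖ M]
  {F : Type*} [Monoid F] {Y : Type*}

/-- The homomorphism to the free abelian group on cyclic words which records the generators of a
free bimodule together with the ring elements between them. -/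
def freeCoord (bM : Module.Basis (F × F × Y) ℤ M) (k : ℕ) :
    (⨂[ℤ]^k M) →ₗ[ℤ] (CycWord (Y × F) k →₀ ℤ) :=
  (Basis.piTensorProduct fun _ : Fin k => bM).constr ℤ fun e => Finsupp.single
    (CycWord.mk fun l => ((e l).2.2, (e l).2.1 * (e (finRotate k l)).1)) (1 : ℤ)

theorem freeCoord_tprod (bM : Module.Basis (F × F × Y) ℤ M) {k : ℕ} (e : Fin k → F × F × Y) :
    freeCoord bM k (PiTensorProduct.tprod ℤ fun l => bM (e l)) = Finsupp.single
      (CycWord.mk fun l => ((e l).2.2, (e l).2.1 * (e (finRotate k l)).1)) 1 := by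
  rw [← Basis.piTensorProduct_apply (fun _ : Fin k => bM) e]
  exact Module.Basis.constr_basis _ _ _ _

theorem freeCoord_rot (bM : Module.Basis (F × F × Y) ℤ M) {k : ℕ} (m : Fin k → M) :
    freeCoord bM k (PiTensorProduct.tprod ℤ fun l => m ((finRotate k).symm l)) =
      freeCoord bM k (PiTensorProduct.tprod ℤ m) := by
  have : (freeCoord bM k).comp
      (PiTensorProduct.reindex ℤ (fun _ => M) (finRotate k)).toLinearMap = freeCoord bM k := by
    refine (Basis.piTensorProduct fun _ : Fin k => bM).ext fun e => ?_
    rw [Basis.piTensorProduct_apply, LinearMap.comp_apply]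
    refine (congrArg (freeCoord bM k) (rotZ_tprod M _)).trans ?_
    rw [freeCoord_tprod bM (fun l => e ((finRotate k).symm l)), freeCoord_tprod,
      ← CycWord.mk_rot]
    simp only [Equiv.symm_apply_apply]
  rw [← rotZ_tprod]
  exact DFunLike.congr_fun this (PiTensorProduct.tprod ℤ m)

variable [SMulCommClass R Rᵐᵒᵖ M] {bS : Module.Basis F ℤ R} {bM : Module.Basis (F × F × Y) ℤ M}
  {y : Y → M}

/-- On a basis tensor both sides insert r into the same gap between consecutive generators, so they
agree by associativity in F. -/
theorem freeCoord_smul (hmul : ∀ a b, bS (a * b) = bS a * bS b)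
    (hM : ∀ a c x, bM (a, c, x) = bS a • MulOpposite.op (bS c) • y x) {k : ℕ} (r : Fin k → F)
    (m : Fin k → M) :
    freeCoord bM k (PiTensorProduct.tprod ℤ
        fun l => MulOpposite.op (bS (r (finRotate k l))) • m l) =
      freeCoord bM k (PiTensorProduct.tprod ℤ fun l => bS (r l) • m l) := by
  let Lm : MultilinearMap ℤ (fun _ : Fin k => M) (CycWord (Y × F) k →₀ ℤ) :=
    (freeCoord bM k).compMultilinearMap (PiTensorProduct.tprod ℤ)
  have : Lm.compLinearMap (fun l =>
      (DistribSMul.toAddMonoidHom M (MulOpposite.op (bS (r (finRotate k l))))).toIntLinearMap) =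
      Lm.compLinearMap fun l => (DistribSMul.toAddMonoidHom M (bS (r l))).toIntLinearMap := by
    refine Module.Basis.ext_multilinear (fun _ => bM) fun e => ?_
    change freeCoord bM k (PiTensorProduct.tprod ℤ
        fun l => MulOpposite.op (bS (r (finRotate k l))) • bM (e l)) =
      freeCoord bM k (PiTensorProduct.tprod ℤ fun l => bS (r l) • bM (e l))
    have hl : ∀ l, bS (r l) • bM (e l) = bM (r l * (e l).1, (e l).2.1, (e l).2.2) := fun l => by
      rw [hM (r l * (e l).1), hmul, mul_smul, ← hM]
    have hr : ∀ l, MulOpposite.op (bS (r (finRotate k l))) • bM (e l) =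
        bM ((e l).1, (e l).2.1 * r (finRotate k l), (e l).2.2) := fun l => by
      rw [hM (e l).1 ((e l).2.1 * r (finRotate k l)), hmul, MulOpposite.op_mul, mul_smul,
        smul_comm (bS (e l).1), ← hM]
    simp only [hl, hr]
    rw [freeCoord_tprod bM fun l => ((e l).1, (e l).2.1 * r (finRotate k l), (e l).2.2),
      freeCoord_tprod bM fun l => (r l * (e l).1, (e l).2.1, (e l).2.2)]
    simp only [mul_assoc]
  exact DFunLike.congr_fun this m

/-- Both sides are additive in r, so r may be taken in the basis; since 1 is a basis element too,
`freeCoord_smul` applies with 1 in the other places. -/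
theorem freeCoord_update (h1 : bS 1 = 1) (hmul : ∀ a b, bS (a * b) = bS a * bS b)
    (hM : ∀ a c x, bM (a, c, x) = bS a • MulOpposite.op (bS c) • y x) {k : ℕ}
    (m : Fin k → M) (i j : Fin k) (r : R) (hij : finRotate k i = j) :
    freeCoord bM k (PiTensorProduct.tprod ℤ (Function.update m i (MulOpposite.op r • m i))) =
      freeCoord bM k (PiTensorProduct.tprod ℤ (Function.update m j (r • m j))) := by
  let f : R →+ (CycWord (Y × F) k →₀ ℤ) := AddMonoidHom.mk' (fun r => freeCoord bM k
    (PiTensorProduct.tprod ℤ (Function.update m i (MulOpposite.op r • m i)))) fun a b => by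
      rw [MulOpposite.op_add, add_smul, MultilinearMap.map_update_add, map_add]
  let g : R →+ (CycWord (Y × F) k →₀ ℤ) := AddMonoidHom.mk' (fun r => freeCoord bM k
    (PiTensorProduct.tprod ℤ (Function.update m j (r • m j)))) fun a b => by
      rw [add_smul, MultilinearMap.map_update_add, map_add]
  have : f.toIntLinearMap = g.toIntLinearMap := by
    refine bS.ext fun c => ?_
    change freeCoord bM k (PiTensorProduct.tprod ℤ
        (Function.update m i (MulOpposite.op (bS c) • m i))) =
      freeCoord bM k (PiTensorProduct.tprod ℤ (Function.update m j (bS c • m j)))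
    have hite : ∀ l, (if l = j then bS c else 1) = bS (if l = j then c else 1) := fun l => by
      split_ifs
      · rfl
      · exact h1.symm
    rw [update_op_smul_eq m hij, update_smul_eq]
    simp only [hite]
    exact freeCoord_smul hmul hM (fun l => if l = j then c else 1) m
  exact DFunLike.congr_fun this r

/-- Collecting the ring elements in the gaps gives coordinates L in a free abelian group. They are
injective because P, which rebuilds a tensor from its cyclic word, is a left inverse. -/
theorem coinv_torsion_free_of_basis (h1 : bS 1 = 1) (hmul : ∀ a b, bS (a * b) = bS a * bS b)
    (hM : ∀ a c x, bM (a, c, x) = bS a • MulOpposite.op (bS c) • y x) {p : ℕ} (hp : 0 < p) (k i : ℕ)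
    (x : Coinv R M k) (hx : p ^ i • x = 0) : x = 0 := by
  let L : Coinv R M k →+ (CycWord (Y × F) k →₀ ℤ) :=
    coinvLift (freeCoord bM k).toAddMonoidHom (freeCoord_update h1 hmul hM) (freeCoord_rot bM)
  let G : (Fin k → Y × F) → Coinv R M k := fun z =>
    Tens.toCoinv R M k (elem R fun l => MulOpposite.op (bS (z l).2) • y (z l).1)
  have hG : ∀ z, G (fun l => z (finRotate k l)) = G z := fun z =>
    toCoinv_elem_rot fun l => MulOpposite.op (bS (z l).2) • y (z l).1
  -- The choice of `o.out` is harmless, as G is invariant under rotation.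
  let P : (CycWord (Y × F) k →₀ ℤ) →+ Coinv R M k :=
    Finsupp.liftAddHom fun o => zmultiplesHom _ (G o.out)
  have hP : (P.comp (freeCoord bM k).toAddMonoidHom).toIntLinearMap =
      ((Tens.toCoinv R M k).comp (QuotientAddGroup.mk' (balRel R M k))).toIntLinearMap := by
    refine (Basis.piTensorProduct fun _ : Fin k => bM).ext fun e => ?_
    rw [Basis.piTensorProduct_apply]
    change P (freeCoord bM k (PiTensorProduct.tprod ℤ fun l => bM (e l))) =
      Tens.toCoinv R M k (elem R fun l => bM (e l))
    rw [freeCoord_tprod, Finsupp.liftAddHom_apply_single, zmultiplesHom_apply, one_smul,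
      toCoinv_elem]
    have : (fun l => bM (e l)) =
        fun l => bS (e l).1 • MulOpposite.op (bS (e l).2.1) • y (e l).2.2 :=
      funext fun l => hM _ _ _
    rw [this, cycElem_smul, ← toCoinv_elem]
    refine (eq_of_cycWord_eq G hG (Quotient.out_eq _)).trans ?_
    simp only [G, hmul, MulOpposite.op_mul, mul_smul]
  refine pow_torsion_free_of_injective L (Function.LeftInverse.injective (g := P) fun x => ?_)
    (pow_torsion_free_finsupp fun i x hx => ?_) i x hx
  · obtain ⟨x, rfl⟩ := QuotientAddGroup.mk'_surjective _ x
    obtain ⟨ξ, rfl⟩ := QuotientAddGroup.mk'_surjective _ x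
    exact DFunLike.congr_fun hP ξ
  · rw [nsmul_eq_mul] at hx
    exact (mul_eq_zero.1 hx).resolve_left (by exact_mod_cast (pow_pos hp i).ne')

/-- The basis of a module over a ring with given bases, as an abelian group. -/
def intBasisSmul {E : Type*} {N : Type*} {I J : Type*} [Ring E] [AddCommGroup N] [Module E N]
    (bE : Module.Basis I ℤ E) (bN : Module.Basis J E N) : Module.Basis (I × J) ℤ N :=
  bE.smulTower bN

theorem intBasisSmul_apply {E : Type*} {N : Type*} {I J : Type*} [Ring E] [AddCommGroup N]
    [Module E N] (bE : Module.Basis I ℤ E) (bN : Module.Basis J E N) (x : I × J) :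
    intBasisSmul bE bN x = bE x.1 • bN x.2 :=
  Module.Basis.smulTower_apply bE bN x

theorem basisFreeMonoid_apply (X : Type u) (a : FreeMonoid X) :
    FreeAlgebra.basisFreeMonoid ℤ X a =
      FreeAlgebra.equivMonoidAlgebraFreeMonoid.symm (MonoidAlgebra.of ℤ (FreeMonoid X) a) := by
  unfold FreeAlgebra.basisFreeMonoid
  simp

/-- The words form a multiplicative ℤ-basis of a free ring, and the elements a y c, with a, c words
and y a generator, a ℤ-basis of the free bimodule. -/
theorem IsFree.coinv_torsion_free {A : Bimod.{u, v}} (hA : IsFree A) {p : ℕ} (hp : 0 < p)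
    (k i : ℕ) (x : Coinv A.R A.M k) (hx : p ^ i • x = 0) : x = 0 := by
  obtain ⟨⟨X, ⟨e⟩⟩, hfree⟩ := hA
  let _ : Module (A.R ⊗[ℤ] A.Rᵐᵒᵖ) A.M := TensorProduct.Algebra.module
  have _ : Module.Free (A.R ⊗[ℤ] A.Rᵐᵒᵖ) A.M := hfree
  let bS : Module.Basis (FreeMonoid X) ℤ A.R :=
    (FreeAlgebra.basisFreeMonoid ℤ X).map e.toAddEquiv.toIntLinearEquiv
  have hbS : ∀ a, bS a = e (FreeAlgebra.equivMonoidAlgebraFreeMonoid.symm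
      (MonoidAlgebra.of ℤ (FreeMonoid X) a)) := fun a =>
    congrArg e (basisFreeMonoid_apply X a)
  let bE : Module.Basis (FreeMonoid X × FreeMonoid X) ℤ (A.R ⊗[ℤ] A.Rᵐᵒᵖ) :=
    bS.tensorProduct (bS.map MulOpposite.opAddEquiv.toIntLinearEquiv)
  let bY := Module.Free.chooseBasis (A.R ⊗[ℤ] A.Rᵐᵒᵖ) A.M
  let bM := (intBasisSmul bE bY).reindex (Equiv.prodAssoc _ _ _)
  refine coinv_torsion_free_of_basis (bS := bS) (bM := bM) (y := bY) ?_ ?_ ?_ hp k i x hx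
  · rw [hbS, map_one, map_one, map_one]
  · intro a b
    rw [hbS, hbS, hbS, map_mul, map_mul, map_mul]
  · intro a c x
    have : bM (a, c, x) = (bS a ⊗ₜ[ℤ] MulOpposite.op (bS c) : A.R ⊗[ℤ] A.Rᵐᵒᵖ) • bY x := by
      refine (Module.Basis.reindex_apply _ _ _).trans ((intBasisSmul_apply bE bY _).trans ?_)
      exact congrArg (· • bY x) (Module.Basis.tensorProduct_apply _ _ _ _)
    rw [this, TensorProduct.Algebra.smul_def]

end Free

/-! ## Modules over a commutative ring -/

section Central

/-- The maps are only additive in each variable, so the coefficients have to stay with the basis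
elements. -/
theorem multilinearMap_ext_smul_basis {R : Type*} {M : Type*} {N : Type*} {ι : Type*} [Ring R]
    [AddCommGroup M] [Module R M] [AddCommGroup N] (b : Module.Basis ι R M) {k : ℕ}
    {f g : MultilinearMap ℤ (fun _ : Fin k => M) N}
    (h : ∀ (a : Fin k → R) (x : Fin k → ι),
      f (fun l => a l • b (x l)) = g fun l => a l • b (x l)) : f = g := by
  classical
  ext m
  have hm : m = fun l => ∑ e ∈ (b.repr (m l)).support, b.repr (m l) e • b e :=
    funext fun l => (b.linearCombination_repr (m l)).symm
  rw [hm, MultilinearMap.map_sum_finset, MultilinearMap.map_sum_finset]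
  exact Finset.sum_congr rfl fun x _ => h (fun l => b.repr (m l) (x l)) x

variable {R : Type u} {M : Type v} [CommRing R] [AddCommGroup M] [Module R M] {k : ℕ}
  {ι : Type w}

/-- The `R`-multilinear map which sends a word in the basis elements to its cyclic word. -/
def cycCoord (b : Module.Basis ι R M) (k : ℕ) :
    MultilinearMap R (fun _ : Fin k => M) (CycWord ι k →₀ R) :=
  ((Basis.piTensorProduct fun _ : Fin k => b).constr R fun x : Fin k → ι =>
    Finsupp.single (CycWord.mk x) (1 : R)).compMultilinearMap (PiTensorProduct.tprod R)

theorem cycCoord_basis (b : Module.Basis ι R M) (x : Fin k → ι) :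
    cycCoord b k (fun l => b (x l)) = Finsupp.single (CycWord.mk x) 1 := by
  change Module.Basis.constr _ R _ (PiTensorProduct.tprod R fun l => b (x l)) = _
  rw [← Basis.piTensorProduct_apply (fun _ : Fin k => b) x]
  exact Module.Basis.constr_basis _ _ _ _

theorem cycCoord_rot (b : Module.Basis ι R M) (m : Fin k → M) :
    cycCoord b k (fun l => m ((finRotate k).symm l)) = cycCoord b k m := by
  have : (cycCoord b k).domDomCongr (finRotate k).symm = cycCoord b k := by
    refine Module.Basis.ext_multilinear (fun _ => b) fun x => ?_
    change cycCoord b k (fun l => b (x ((finRotate k).symm l))) = _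
    rw [cycCoord_basis b fun l => x ((finRotate k).symm l), cycCoord_basis, ← CycWord.mk_rot]
    simp only [Equiv.symm_apply_apply]
  exact DFunLike.congr_fun this m

theorem lift_cycCoord_tprod (b : Module.Basis ι R M) (m : Fin k → M) :
    (PiTensorProduct.lift ((cycCoord b k).restrictScalars ℤ)).toAddMonoidHom
      (PiTensorProduct.tprod ℤ m) = cycCoord b k m :=
  PiTensorProduct.lift.tprod _

variable [Module Rᵐᵒᵖ M] [IsCentralScalar R M]

variable (R M) in
/-- A module over a commutative ring with equal left and right actions, as a bimodule. -/
abbrev Bimod.ofCentral : Bimod.{u, v} := ⟨R, M⟩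

/-- With equal left and right actions, a scalar can travel from place to place through the balancing
relations. -/
theorem elem_update_smul (m : Fin k → M) (i j : Fin k) (r : R) :
    elem R (Function.update m i (r • m i)) = elem R (Function.update m j (r • m j)) := by
  have main : ∀ (i : ℕ) (hi : i < k), elem R (Function.update m ⟨i, hi⟩ (r • m ⟨i, hi⟩)) =
      elem R (Function.update m ⟨0, by omega⟩ (r • m ⟨0, by omega⟩)) := by
    intro i
    induction i with
    | zero => exact fun _ => rfl
    | succ i ih =>
      intro hi
      rw [← ih (by omega), ← elem_update m (i := ⟨i, by omega⟩) rfl r, op_smul_eq_smul]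
  exact (main i i.2).trans (main j j.2).symm

theorem smulElem_eq (r : R) (m : Fin k → M) (i : Fin k) :
    smulElem (Bimod.ofCentral R M) r m = elem R (Function.update m i (r • m i)) :=
  (smulElem_eq_elem_update (Bimod.ofCentral R M) i.pos r m).trans (elem_update_smul m _ i r)

theorem elem_smul (hk : 0 < k) (a : Fin k → R) (m : Fin k → M) :
    elem R (fun l => a l • m l) = smulElem (Bimod.ofCentral R M) (∏ l, a l) m := by
  have main : ∀ (s : Finset (Fin k)) (m : Fin k → M),
      elem R (fun l => (if l ∈ s then a l else 1) • m l) =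
        smulElem (Bimod.ofCentral R M) (∏ l ∈ s, a l) m := by
    intro s
    induction s using Finset.induction_on with
    | empty =>
      intro m
      rw [smulElem_eq _ m ⟨0, hk⟩, Finset.prod_empty, one_smul, Function.update_eq_self]
      simp
    | insert i s hi ih =>
      intro m
      have := ih (Function.update m i (a i • m i))
      rw [smulElem_eq _ _ i, Function.update_self, Function.update_idem, smul_smul,
        mul_comm] at this
      rw [smulElem_eq _ _ i, Finset.prod_insert hi, ← this]
      congr 1
      funext l
      by_cases hl : l = i
      · subst hl; simp [hi]
      · simp [hl]
  simpa using main Finset.univ m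

/-- The scalar is put where the rotation takes it, making the two tensors exact rotations of one
elementary tensor. This form also serves `Witt.single`, which is not additive. -/
theorem exists_smulElem_rot (hk : 0 < k) (a : R) (m : Fin k → M) :
    ∃ v : Fin k → M, smulElem (Bimod.ofCentral R M) a (fun l => m (finRotate k l)) = elem R v ∧
      smulElem (Bimod.ofCentral R M) a m =
        QuotientAddGroup.mk' (balRel R M k) (rotZ M k (PiTensorProduct.tprod ℤ v)) := by
  refine ⟨_, smulElem_eq a _ ⟨0, hk⟩, ?_⟩
  rw [rotZ_tprod, smulElem_eq a m (finRotate k ⟨0, hk⟩)]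
  change _ = elem R _
  congr 1
  funext l
  by_cases hl : l = finRotate k ⟨0, hk⟩
  · subst hl
    rw [Function.update_self, Equiv.symm_apply_apply, Function.update_self]
  · rw [Function.update_of_ne hl, Function.update_of_ne, Equiv.apply_symm_apply]
    exact fun e => hl ((Equiv.symm_apply_eq _).1 e)

theorem proj_smulElem_rot (hk : 0 < k) (a : R) (m : Fin k → M) :
    (Bimod.ofCentral R M).proj k (smulElem _ a fun l => m (finRotate k l)) =
      (Bimod.ofCentral R M).proj k (smulElem _ a m) := by
  obtain ⟨v, h1, h2⟩ := exists_smulElem_rot hk a m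
  rw [h1, h2]
  exact (toCoinv_rotZ _).symm

/-- The homomorphism `a ↦ a m₁ ⊗ m₂ ⊗ ⋯ ⊗ m_k`. -/
def smulElemHom (hk : 0 < k) (m : Fin k → M) : R →+ (Bimod.ofCentral R M).tens k :=
  AddMonoidHom.mk' (fun a => smulElem (Bimod.ofCentral R M) a m) fun a c => by
    rw [smulElem_eq _ m ⟨0, hk⟩, smulElem_eq _ m ⟨0, hk⟩, smulElem_eq _ m ⟨0, hk⟩, add_smul]
    unfold elem
    rw [MultilinearMap.map_update_add, map_add]

/-- The coordinates of an element of the coinvariants, with respect to a basis of the module. -/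
def coinvCoord (b : Module.Basis ι R M) (k : ℕ) : Coinv R M k →+ (CycWord ι k →₀ R) :=
  coinvLift (PiTensorProduct.lift ((cycCoord b k).restrictScalars ℤ)).toAddMonoidHom
    (fun m i j r _ => by
      rw [lift_cycCoord_tprod, lift_cycCoord_tprod, op_smul_eq_smul, MultilinearMap.map_update_smul,
        MultilinearMap.map_update_smul, Function.update_eq_self, Function.update_eq_self])
    (fun m => by rw [lift_cycCoord_tprod, lift_cycCoord_tprod, cycCoord_rot])

theorem coinvCoord_elem (b : Module.Basis ι R M) (m : Fin k → M) :
    coinvCoord b k (Tens.toCoinv R M k (elem R m)) = cycCoord b k m :=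
  lift_cycCoord_tprod b m

theorem coinvCoord_smulElem (hk : 0 < k) (b : Module.Basis ι R M) (a : R) (x : Fin k → ι) :
    coinvCoord b k ((Bimod.ofCentral R M).proj k (smulElem _ a fun l => b (x l))) =
      Finsupp.single (CycWord.mk x) a := by
  rw [smulElem_eq a (fun l => b (x l)) ⟨0, hk⟩]
  refine (coinvCoord_elem b _).trans ?_
  rw [MultilinearMap.map_update_smul, Function.update_eq_self, cycCoord_basis,
    Finsupp.smul_single, smul_eq_mul, mul_one]

/-- The tensor with given coordinates. -/
def tensOfCoord (hk : 0 < k) (b : Module.Basis ι R M) :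
    (CycWord ι k →₀ R) →+ (Bimod.ofCentral R M).tens k :=
  Finsupp.liftAddHom fun o => smulElemHom hk fun l => b (o.out l)

theorem tensOfCoord_apply (hk : 0 < k) (b : Module.Basis ι R M) (c : CycWord ι k →₀ R) :
    tensOfCoord hk b c = c.sum fun o a => smulElem (Bimod.ofCentral R M) a fun l => b (o.out l) :=
  Finsupp.liftAddHom_apply _ _

theorem proj_tensOfCoord_single (hk : 0 < k) (b : Module.Basis ι R M) (x : Fin k → ι) (a : R) :
    (Bimod.ofCentral R M).proj k (tensOfCoord hk b (Finsupp.single (CycWord.mk x) a)) =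
      (Bimod.ofCentral R M).proj k (smulElem _ a fun l => b (x l)) := by
  unfold tensOfCoord
  rw [Finsupp.liftAddHom_apply_single]
  exact eq_of_cycWord_eq
    (fun x : Fin k → ι => (Bimod.ofCentral R M).proj k (smulElem _ a fun l => b (x l)))
    (fun x => proj_smulElem_rot hk a fun l => b (x l)) (Quotient.out_eq _)

/-- Both an explicit section of the projection and the injectivity of the coordinates. -/
theorem proj_tensOfCoord_coinvCoord (hk : 0 < k) (b : Module.Basis ι R M)
    (c : (Bimod.ofCentral R M).coinv k) :
    (Bimod.ofCentral R M).proj k (tensOfCoord hk b (coinvCoord b k c)) = c := by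
  let P : (CycWord ι k →₀ R) →+ Coinv R M k :=
    ((Bimod.ofCentral R M).proj k).comp (tensOfCoord hk b)
  have h : (P.toIntLinearMap.compMultilinearMap ((cycCoord b k).restrictScalars ℤ) :
      MultilinearMap ℤ (fun _ : Fin k => M) (Coinv R M k)) =
      (((Tens.toCoinv R M k).comp (QuotientAddGroup.mk' (balRel R M k))).toIntLinearMap
        ).compMultilinearMap (PiTensorProduct.tprod ℤ) := by
    refine multilinearMap_ext_smul_basis b fun a x => ?_
    change P (cycCoord b k fun l => a l • b (x l)) =
      Tens.toCoinv R M k (elem R fun l => a l • b (x l))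
    rw [MultilinearMap.map_smul_univ, cycCoord_basis, Finsupp.smul_single, smul_eq_mul, mul_one,
      elem_smul hk]
    exact proj_tensOfCoord_single hk b x _
  induction c using coinv_induction with
  | helem m =>
    rw [coinvCoord_elem]
    exact DFunLike.congr_fun h m
  | hadd x y hx hy => rw [map_add, map_add, map_add, hx, hy]
  | hsmul c x hx => rw [map_zsmul, map_zsmul, map_zsmul, hx]

theorem coinv_torsion_free_of_central {p : ℕ} (b : Module.Basis ι R M) (hk : 0 < k)
    (h : ∀ (i : ℕ) (x : R), p ^ i • x = 0 → x = 0) (i : ℕ) (x : Coinv R M k)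
    (hx : p ^ i • x = 0) : x = 0 :=
  pow_torsion_free_of_injective (coinvCoord b k)
    (Function.LeftInverse.injective (g := fun c => (Bimod.ofCentral R M).proj k
      (tensOfCoord hk b c)) (proj_tensOfCoord_coinvCoord hk b))
    (pow_torsion_free_finsupp h) i x hx

end Central

/-- F need not be additive in the coefficient: injectivity of f on s keeps terms from colliding. -/
theorem finsupp_sum_sum_single {α κ N N' : Type*} [AddCommMonoid N] [AddCommMonoid N']
    (f : α → κ) (a : α → N) (F : κ → N → N') (hF : ∀ o, F o 0 = 0) (s : Finset α)
    (hs : Set.InjOn f s) :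
    (∑ x ∈ s, Finsupp.single (f x) (a x)).sum F = ∑ x ∈ s, F (f x) (a x) := by
  classical
  induction s using Finset.induction_on with
  | empty => rfl
  | insert x s hx ih =>
    rw [Finset.sum_insert hx, Finset.sum_insert hx, Finsupp.sum_add_index_of_disjoint,
      Finsupp.sum_single_index (hF _), ih (hs.mono (by simp))]
    rw [Finset.disjoint_left]
    intro o ho ho'
    obtain rfl := Finset.mem_singleton.1 (Finsupp.support_single_subset ho)
    obtain ⟨y, hy, hyo⟩ := Finset.mem_biUnion.1 (Finsupp.support_finsetSum ho')
    have hxy := Finset.mem_singleton.1 (Finsupp.support_single_subset hyo)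
    exact hx (hs (by simp) (by simp [hy]) hxy ▸ hy)

/-! ### From sections of the coinvariants to bijections onto Witt vectors. -/

section Witt

variable {A : Bimod.{u, v}} (ρ : FreeResolution.{u, v, u₁, v₁, u₂, v₂} A) {p : ℕ}
  [hp : Fact p.Prime] {n : ℕ}

theorem Witt.single_zero (i : Fin n) : Witt.single ρ (p := p) i 0 = 0 := by
  apply Witt.ghostHom_injective
  have h0 := Witt.ghostHom_mk ρ (p := p) (n := n) 0
  rw [ghost_zero hp.out.pos, map_zero] at h0
  rw [map_zero, ← h0]
  congr 1
  unfold Witt.single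
  rw [Pi.single_zero]
  exact congrArg _ (funext fun i => (map_zero (Tens.map ρ.ε _)).symm)

/-- An exact equality, not one modulo later positions: it is `gvec_rotZ` for a lift of the
elementary tensor to S. -/
theorem Witt.single_elem_eq_single_rotZ (i : Fin n) (m : Fin (p ^ (i : ℕ)) → A.M) :
    Witt.single ρ i (elem A.R m) = Witt.single ρ i
      (QuotientAddGroup.mk' (balRel A.R A.M _) (rotZ A.M _ (PiTensorProduct.tprod ℤ m))) := by
  obtain ⟨q, rfl⟩ : ∃ q : Fin (p ^ (i : ℕ)) → ρ.S.M, m = fun l => ρ.ε.addHom (q l) :=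
    ⟨fun l => ρ.lift (m l), funext fun l => (ρ.ε_lift (m l)).symm⟩
  have h := Tens.map_elem ρ.ε fun l => q ((finRotate (p ^ (i : ℕ))).symm l)
  rw [rotZ_tprod]
  change _ = Witt.single ρ i (elem A.R _)
  rw [← h, ← Tens.map_elem]
  apply Witt.ghostHom_injective
  rw [Witt.ghostHom_single, Witt.ghostHom_single, ← gvec_rotZ hp.out.pos, rotZ_tprod]
  rfl

theorem Witt.sum_single_sub_mem {α : Type*} (i : Fin n) (s : Finset α)
    (x : α → A.tens (p ^ (i : ℕ))) :
    ∑ j ∈ s, Witt.single ρ i (x j) - Witt.single ρ i (∑ j ∈ s, x j) ∈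
      Witt.fil ρ p n (i + 1) := by
  classical
  induction s using Finset.induction_on with
  | empty =>
    rw [Finset.sum_empty, Finset.sum_empty, Witt.single_zero, sub_zero]
    exact zero_mem _
  | insert j s hj ih =>
    rw [Finset.sum_insert hj, Finset.sum_insert hj]
    have := sub_mem ih (Witt.single_add_sub_mem ρ i (x j) (∑ j ∈ s, x j))
    convert this using 1
    abel

theorem Witt.bijective_mk_of_section
    (s : ∀ i : Fin n, A.coinv (p ^ (i : ℕ)) ⧸ (Witt.versch ρ p i).ker → A.tens (p ^ (i : ℕ)))
    (hs : ∀ (i : Fin n) c, QuotientAddGroup.mk' (Witt.versch ρ p i).ker (A.proj _ (s i c)) = c) :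
    Function.Bijective fun c : ∀ i : Fin n, A.coinv (p ^ (i : ℕ)) ⧸ (Witt.versch ρ p i).ker =>
      (Witt.mk ρ (fun i => s i (c i)) : Witt ρ p n) := by
  simp only [Witt.mk_eq_sum]
  refine Witt.bijective_sum ρ
    (fun i x hx => IsFree.coinv_torsion_free ρ.free_S hp.out.pos (p ^ i) i x hx) s
    (fun i => ?_) (fun i c => Witt.single ρ i (s i c))
    (fun i c => by rw [sub_self]; exact zero_mem _)
  simp only [hs]
  exact Function.bijective_id

theorem Witt.bijective_sum_of_torsion_free
    (htf : ∀ (i : ℕ) (x : A.coinv (p ^ i)), p ^ i • x = 0 → x = 0)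
    {X : Fin n → Type*} (τ : ∀ i : Fin n, X i → A.tens (p ^ (i : ℕ)))
    (hτ : ∀ i : Fin n, Function.Bijective fun c => A.proj _ (τ i c))
    (θ : ∀ i : Fin n, X i → Witt ρ p n)
    (hθ : ∀ (i : Fin n) c, θ i c - Witt.single ρ i (τ i c) ∈ Witt.fil ρ p n (i + 1)) :
    Function.Bijective fun c : ∀ i, X i => ∑ i, θ i (c i) := by
  refine Witt.bijective_sum ρ
    (fun i x hx => IsFree.coinv_torsion_free ρ.free_S hp.out.pos (p ^ i) i x hx) τ
    (fun i => ?_) θ hθ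
  refine Function.Bijective.comp ⟨?_, QuotientAddGroup.mk'_surjective _⟩ (hτ i)
  rw [injective_iff_map_eq_zero]
  exact fun x hx => (map_eq_zero_iff _ (Witt.versch_injective ρ htf i)).1
    ((QuotientAddGroup.eq_zero_iff _).1 hx)

theorem Witt.bijective_mk_of_torsion_free
    (htf : ∀ (i : ℕ) (x : A.coinv (p ^ i)), p ^ i • x = 0 → x = 0)
    {X : Fin n → Type*} (τ : ∀ i : Fin n, X i → A.tens (p ^ (i : ℕ)))
    (hτ : ∀ i : Fin n, Function.Bijective fun c => A.proj _ (τ i c)) :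
    Function.Bijective fun c : ∀ i, X i => (Witt.mk ρ (fun i => τ i (c i)) : Witt ρ p n) := by
  simp only [Witt.mk_eq_sum]
  exact Witt.bijective_sum_of_torsion_free ρ htf τ hτ (fun i c => Witt.single ρ i (τ i c))
    fun i c => by rw [sub_self]; exact zero_mem _

end Witt

/-! ### The case M = R. -/

section WittSelf

variable {R : Type u} [Ring R] (ρ : FreeResolution.{u, u, u₁, v₁, u₂, v₂} (Bimod.self R)) {p : ℕ}
  [hp : Fact p.Prime] {n : ℕ}

theorem Witt.bijective_mk_self (htf : ∀ (k : ℕ) (x : Comm R), p ^ k • x = 0 → x = 0)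
    (s : Comm R → R) (hs : ∀ c, (QuotientAddGroup.mk (s c) : Comm R) = c) :
    Function.Bijective fun c : Fin n → Comm R =>
      (Witt.mk ρ (fun i => smulElem (Bimod.self R) (s (c i)) (fun _ => (1 : R))) :
        Witt ρ p n) := by
  refine Witt.bijective_mk_of_torsion_free ρ (fun i x hx => pow_torsion_free_of_injective
    (coinvToComm R (p ^ i)) (coinvToComm_injective (pow_pos hp.out.pos i)) htf i x hx)
    (fun _ c => smulElem (Bimod.self R) (s c) fun _ => (1 : R)) fun i => ?_
  have hk : 0 < p ^ (i : ℕ) := pow_pos hp.out.pos _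
  rw [← (bijective_coinvToComm (R := R) hk).of_comp_iff']
  convert Function.bijective_id using 1
  funext c
  exact (coinvToComm_smulElem hk (s c)).trans (hs c)

end WittSelf

/-! ### Free modules over a commutative ring. -/

section WittCentral

variable {R : Type u} {M : Type v} [CommRing R] [AddCommGroup M] [Module R M] [Module Rᵐᵒᵖ M]
  [IsCentralScalar R M] (ρ : FreeResolution.{u, v, u₁, v₁, u₂, v₂} (Bimod.ofCentral R M)) {p : ℕ}
  [hp : Fact p.Prime] {n : ℕ} {ι : Type w} (b : Module.Basis ι R M)

/-- The sum of the iterated Verschiebungs of the Teichmüller elements of the terms of the expansion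
of an element of the coinvariants in a basis. -/
def Witt.teichSum (i : Fin n) (c : (Bimod.ofCentral R M).coinv (p ^ (i : ℕ))) : Witt ρ p n :=
  (coinvCoord b _ c).sum fun o a => Witt.single ρ i (smulElem _ a fun l => b (o.out l))

/-- By `Witt.sum_single_sub_mem`, a sum of Teichmüller terms agrees modulo later positions with
`Witt.single` of the sum of the tensors, which is a section of the projection. -/
theorem Witt.bijective_sum_teichSum (h : ∀ (i : ℕ) (x : R), p ^ i • x = 0 → x = 0) :
    Function.Bijective fun c : ∀ i : Fin n, (Bimod.ofCentral R M).coinv (p ^ (i : ℕ)) =>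
      ∑ i, Witt.teichSum ρ b i (c i) := by
  have hk : ∀ i : ℕ, 0 < p ^ i := fun i => pow_pos hp.out.pos _
  refine Witt.bijective_sum_of_torsion_free ρ
    (fun i => coinv_torsion_free_of_central b (hk i) h i)
    (fun i c => tensOfCoord (hk i) b (coinvCoord b _ c)) (fun i => ?_) _ fun i c => ?_
  · simp only [proj_tensOfCoord_coinvCoord]
    exact Function.bijective_id
  · rw [tensOfCoord_apply]
    exact Witt.sum_single_sub_mem ρ i _ _

theorem Witt.single_smulElem_rot (i : Fin n) (a : R) (m : Fin (p ^ (i : ℕ)) → M) :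
    Witt.single ρ i (smulElem _ a fun l => m (finRotate _ l)) =
      Witt.single ρ i (smulElem _ a m) := by
  obtain ⟨v, h1, h2⟩ := exists_smulElem_rot (pow_pos hp.out.pos i) a m
  rw [h1, h2]
  exact Witt.single_elem_eq_single_rotZ ρ i v

/-- Distinct orbits keep the coefficients from being added together, and rotation invariance lets
any word stand for the chosen representative of its orbit. -/
theorem Witt.teichSum_sum (i : Fin n) (a : (Fin (p ^ (i : ℕ)) → ι) →₀ R)
    (ha : ∀ x ∈ a.support, ∀ y ∈ a.support,
      (∃ t : ℕ, y = x ∘ (finRotate (p ^ (i : ℕ)))^[t]) → x = y) :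
    Witt.teichSum ρ b i (∑ x ∈ a.support,
        (Bimod.ofCentral R M).proj _ (smulElem _ (a x) fun l => b (x l))) =
      ∑ x ∈ a.support, Witt.single ρ i (smulElem _ (a x) fun l => b (x l)) := by
  have hk : 0 < p ^ (i : ℕ) := pow_pos hp.out.pos _
  unfold Witt.teichSum
  rw [map_sum]
  simp only [coinvCoord_smulElem hk]
  rw [finsupp_sum_sum_single CycWord.mk a _ (fun o => ?_) a.support fun x hx y hy hxy =>
    ha x hx y hy (Quotient.exact hxy)]
  · refine Finset.sum_congr rfl fun x _ => ?_
    exact eq_of_cycWord_eq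
      (fun z : Fin (p ^ (i : ℕ)) → ι => Witt.single ρ i (smulElem _ (a x) fun l => b (z l)))
      (fun z => Witt.single_smulElem_rot ρ i (a x) fun l => b (z l)) (Quotient.out_eq _)
  · exact (congrArg (Witt.single ρ i) (map_zero (smulElemHom hk _))).trans (Witt.single_zero ρ i)

end WittCentral

end WittCoeff

end

theorem mainTheorem11 (p : ℕ) [Fact p.Prime] (n : ℕ) :
    -- the general statement
    (∀ (A : Bimod.{u, v}) (ρ : FreeResolution.{u, v, u₁, v₁, u₂, v₂} A),
      ∃ (G : ∀ k : ℕ, AddCommGroup (Witt ρ p k))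
        (V : ∀ i : ℕ, A.coinv (p ^ i) →+ Witt ρ p (i + 1)),
        (∀ k : ℕ, IsWittGroup ρ (G k)) ∧
        (∀ (i : ℕ) (x : A.tens (p ^ i)), V i (A.proj (p ^ i) x) = Witt.single ρ (Fin.last i) x) ∧
        ∀ s : ∀ i : Fin (n + 1), A.coinv (p ^ (i : ℕ)) ⧸ (V (i : ℕ)).ker → A.tens (p ^ (i : ℕ)),
          (∀ (i : Fin (n + 1)) (c : A.coinv (p ^ (i : ℕ)) ⧸ (V (i : ℕ)).ker),
            QuotientAddGroup.mk' (V (i : ℕ)).ker (A.proj (p ^ (i : ℕ)) (s i c)) = c) →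
          Function.Bijective
            (fun c : ∀ i : Fin (n + 1), A.coinv (p ^ (i : ℕ)) ⧸ (V (i : ℕ)).ker =>
              (Witt.mk ρ (fun i => s i (c i)) : Witt ρ p (n + 1)))) ∧
    -- the case `M = R`
    (∀ (R : Type u) [Ring R] (ρ : FreeResolution.{u, u, u₁, v₁, u₂, v₂} (Bimod.self R)),
      (∀ (k : ℕ) (x : Comm R), p ^ k • x = 0 → x = 0) →
      ∀ s : Comm R → R, (∀ c, (QuotientAddGroup.mk (s c) : Comm R) = c) →
        Function.Bijective (fun c : Fin (n + 1) → Comm R =>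
          (Witt.mk ρ (fun i => smulElem (Bimod.self R) (s (c i)) (fun _ => (1 : R))) :
            Witt ρ p (n + 1)))) ∧
    -- the case of a free module over a commutative ring
    (∀ (R : Type u) (M : Type v) [CommRing R] [AddCommGroup M] [Module R M]
      (ρ : FreeResolution.{u, v, u₁, v₁, u₂, v₂} (Bimod.ofModule R M)),
      (∀ (k : ℕ) (x : R), p ^ k • x = 0 → x = 0) →
      ∀ (ι : Type w) (b : Module.Basis ι R M),
        -- every choice of sections gives a bijection
        (∀ s : ∀ i : Fin (n + 1),
            (Bimod.ofModule R M).coinv (p ^ (i : ℕ)) → (Bimod.ofModule R M).tens (p ^ (i : ℕ)),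
          (∀ (i : Fin (n + 1)) (c : (Bimod.ofModule R M).coinv (p ^ (i : ℕ))),
            (Bimod.ofModule R M).proj (p ^ (i : ℕ)) (s i c) = c) →
          Function.Bijective
            (fun c : ∀ i : Fin (n + 1), (Bimod.ofModule R M).coinv (p ^ (i : ℕ)) =>
              (Witt.mk ρ (fun i => s i (c i)) : Witt ρ p (n + 1)))) ∧
        -- the bijection determined by the basis alone
        ∃ (G : AddCommGroup (Witt ρ p (n + 1)))
          (Φ : (∀ i : Fin (n + 1), (Bimod.ofModule R M).coinv (p ^ (i : ℕ))) → Witt ρ p (n + 1)),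
          IsWittGroup ρ G ∧ Function.Bijective Φ ∧
          ∀ a : ∀ i : Fin (n + 1), (Fin (p ^ (i : ℕ)) → ι) →₀ R,
            (∀ i, ∀ x ∈ (a i).support, ∀ y ∈ (a i).support,
              (∃ t : ℕ, y = x ∘ (finRotate (p ^ (i : ℕ)))^[t]) → x = y) →
            Φ (fun i => ∑ x ∈ (a i).support, (Bimod.ofModule R M).proj (p ^ (i : ℕ))
                (smulElem (Bimod.ofModule R M) (a i x) (fun l => b (x l)))) =
              ∑ i : Fin (n + 1), ∑ x ∈ (a i).support,
                Witt.single ρ i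
                  (smulElem (Bimod.ofModule R M) (a i x) (fun l => b (x l)))) := by
  refine ⟨fun A ρ => ⟨fun _ => Witt.addCommGroup ρ, Witt.versch ρ p, fun _ => Witt.isWittGroup ρ,
      Witt.versch_proj ρ, fun s hs => Witt.bijective_mk_of_section ρ s hs⟩,
    fun R _ ρ htf s hs => Witt.bijective_mk_self ρ htf s hs,
    fun R M _ _ _ ρ htf ι b => ?_⟩
  -- With this right action `Bimod.ofModule` unfolds to `Bimod.ofCentral`.
  let _ : Module Rᵐᵒᵖ M := (Bimod.ofModule R M).right
  have _ : IsCentralScalar R M := ⟨fun _ _ => rfl⟩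
  refine ⟨fun s hs => Witt.bijective_mk_of_torsion_free ρ (fun i => coinv_torsion_free_of_central b
      (pow_pos (Fact.out : p.Prime).pos i) htf i) s fun i => ?_,
    Witt.addCommGroup ρ, _, Witt.isWittGroup ρ, Witt.bijective_sum_teichSum ρ b htf,
    fun a ha => Finset.sum_congr rfl fun i _ => Witt.teichSum_sum ρ b i (a i) (ha i)⟩
  simp only [hs]
  exact Function.bijective_id
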